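/- **Setting.** Let $\alpha_0>0$, let $D\subseteq\mathbb C$ be a domain containing $0$, and for $\alpha\in[0,\alpha_0]$ let $f(\alpha,\cdot)$ and $g$ be analytic in $D\setminus\{0\}$ with $f(\alpha,z)=\frac{\alpha^2}{4z^2}+\frac1z\times(\text{analytic})$ and $g(z)=-\frac1{4z^2}+\frac1z\times(\text{analytic})$ near $z=0$. For $\alpha>0$, $f(\alpha,\cdot)$ has exactly one zero $z_t$ in $D\setminus\{0\}$; it is simple and $z_t>0$. For $\alpha=0$, $f(0,\cdot)$ has no zero and a simple pole at $0$, and is negative (positive) at positive (negative) real points of $D$. Let $\zeta=\zeta(\alpha,z)$ be analytic and one-to-one in $D$ with $\zeta=0$ at $z=0$, $\zeta=\alpha^2$ at $z=z_t$ (if $\alpha>0$) and $$f(\alpha,z)\Big(\frac{dz}{d\zeta}\Big)^2=\frac{\alpha^2}{4\zeta^2}-\frac1{4\zeta}.$$ Assume that $\zeta(D)$ contains the negative real axis and that the part of the Riemann surface of $\log\zeta$ over $\zeta(D)\setminus\{0\}$ is simply connected ($D$ has no holes). For $u>0$ put $\mu=u\alpha$ and consider on this surface the equation $$\frac{d^2\tilde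 W}{d\zeta^2}=\Big\{u^2\Big(\frac{\alpha^2}{4\zeta^2}-\frac1{4\zeta}\Big)-\frac1{4\zeta^2}+\frac{\tilde\psi}{\zeta}\Big\}\tilde W,\qquad \tilde\psi=\frac{\zeta\{2\zeta'\zeta'''-3(\zeta'')^2\}}{4(\zeta')^4}+\frac1{4\zeta}+\frac{\zeta g(z)}{(\zeta')^2},\tag{E}$$ where primes are $z$-derivatives; it is the transform of $w''=\{u^2f+g\}w$ under $\tilde W=(d\zeta/dz)^{1/2}w$. Let $$\xi=-i(\zeta-\alpha^2)^{1/2}+i\alpha\arccos(\alpha\zeta^{-1/2})$$ in the $\zeta$ plane cut along $(-\infty,\alpha^2]$, with $i\xi>0$ for $\zeta>\alpha^2$, extended continuously to the two edges of $\zeta<0$; let $\psi=\frac{4ff''-5f'^2}{16f^3}+\frac gf$, $F_1=\frac12\psi$, $F_{s+1}=-\frac12\frac{dF_s}{d\xi}-\frac12\sum_{j=1}^{s-1}F_jF_{s-j}$. Assume that for each $\alpha\in[0,\alpha_0]$ there is a piecewise $C^1$ path $\mathcal L_\alpha$ in the cut plane (edges of $\zeta<0$ included) within $\zeta(D)$,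 which comes in from $\zeta_1=-\infty+i0$ along the upper edge, goes out to $\zeta_2=-\infty-i0$ along the lower edge, avoids the segment $\Re\xi=0$, $0\le\Im\xi\le\alpha\pi/2$, along which $\Re\xi$ is decreasing, and for which $\int_{\mathcal L_\alpha}|F_n\,d\xi|<\infty$ for all $n\ge1$. **Theorem.** (a) For $u>0$ and $\alpha\in[0,\alpha_0]$ there are unique solutions $\tilde W^{(1)}_\mu,\tilde W^{(2)}_\mu$ of (E) with $$\tilde W^{(1,2)}_\mu\sim\frac{\zeta^{1/2}}{(\zeta-\alpha^2)^{1/4}}\,e^{\mp u\xi\mp\pi i/4}\qquad(\zeta\to-\infty\pm i0).$$ (b) Let $u>0$, $\alpha\in[0,\alpha_0]$ be such that $\tilde W^{(1)}_\mu,\tilde W^{(2)}_\mu$ are linearly independent. The solutions of (E) of the form $\zeta^{(\mu+1)/2}V(\zeta)$, $V$ analytic at $0$, are the multiples of one solution, which has $V(0)\ne0$, and with a suitable normalization $\tilde W^{(0)}_\mu$ of it $$\tilde W^{(0)}_\mu=\tilde W^{(1)}_\mu+\gamma_\mu(u,\alpha)\,\tilde W^{(2)}_\mu .$$ The solutions of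 (E) of the form $\zeta^{(1-\mu)/2}V(\zeta)$, $V$ analytic at $0$, are also the multiples of one solution, with $V(0)\ne0$ unless $\mu\in\{1,2,3,\dots\}$, and with a suitable normalization $\tilde W_{-\mu}$ of it $$\tilde W_{-\mu}=e^{\mu\pi i}\,\tilde W^{(1)}_\mu+\gamma_\mu(u,\alpha)\,e^{-\mu\pi i}\,\tilde W^{(2)}_\mu ,$$ with the same constant $\gamma_\mu(u,\alpha)$. (c) For each $\alpha$, $\tilde W^{(1)}_\mu,\tilde W^{(2)}_\mu$ are linearly independent for all sufficiently large $u$, and for every $n$ $$\gamma_\mu(u,\alpha)=1+O(u^{-n})\qquad(u\to\infty).$$ Both statements hold uniformly for $\alpha$ in any set $A\subseteq[0,\alpha_0]$ on which, for each $n\geq 1$, the integrals $\int_{\mathcal L_\alpha}|F_n\,d\xi|$ are bounded. -/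

import Mathlib

open Filter Topology Set

noncomputable section

/-- The function `ψ(α,z)` of the Liouville-Green form `W'' = (u² + ψ) W` of
`w'' = (u² f + g) w`. -/
def lgPsi (f g : ℂ → ℂ) (z : ℂ) : ℂ :=
  (4 * f z * iteratedDeriv 2 f z - 5 * deriv f z ^ 2) / (16 * f z ^ 3) + g z / f z

/-- The function `ψ̃` of the transformed equation, as a function of `z`
(primes are `z`-derivatives of `ζ`). -/
def psiTilde (g ζ : ℂ → ℂ) (z : ℂ) : ℂ :=
  ζ z * (2 * deriv ζ z * iteratedDeriv 3 ζ z - 3 * iteratedDeriv 2 ζ z ^ 2) /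
      (4 * deriv ζ z ^ 4)
    + 1 / (4 * ζ z) + ζ z * g z / deriv ζ z ^ 2

/-- Multivalued functions of `ζ` are treated as functions of `s = log ζ`, that is, on the Riemann
surface of the logarithm. This is the part of that surface lying over `ζ(D) \ {0}`. The upper and
lower edges of the cut `ζ < 0` are the lines `Im s = π` and `Im s = -π`. -/
def logSurface (D : Set ℂ) (ζ : ℂ → ℂ) : Set ℂ := {s | Complex.exp s ∈ ζ '' D}

/-- The point `z ∈ D` with `ζ(z) = exp s`. -/
def zOf (D : Set ℂ) (ζ : ℂ → ℂ) (s : ℂ) : ℂ := Function.invFunOn ζ D (Complex.exp s)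

/-- `(ζ - α²)^κ` as a function of `s = log ζ`. With `p = ζ^{1/2} = exp (s / 2)` it is
`(p - α)^κ (p + α)^κ`, principal powers: positive for `ζ > α²` (`κ` real) and continuous in
`|Im s| ≤ π` off the cut `0 < ζ ≤ α²`. -/
def shiftPow (α : ℝ) (κ s : ℂ) : ℂ :=
  (Complex.exp (s / 2) - α) ^ κ * (Complex.exp (s / 2) + α) ^ κ

/-- The Liouville-Green variable
`ξ = -i (ζ - α²)^{1/2} + i α arccos (α ζ^{-1/2})` as a function of `s = log ζ`, for
`|Im s| ≤ π` off the cut `0 < ζ ≤ α²`; here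
`i arccos (α / p) = log (α + i (p² - α²)^{1/2}) - log p`. Thus `i ξ > 0` for `ζ > α²`. -/
def lgXi (α : ℝ) (s : ℂ) : ℂ :=
  -Complex.I * shiftPow α (1 / 2) s
    + α * (Complex.log (α + Complex.I * shiftPow α (1 / 2) s) - s / 2)

/-- The derivative `dξ/ds = ζ dξ/dζ = -(i/2) (ζ - α²)^{1/2}`. -/
def lgXiDeriv (α : ℝ) (s : ℂ) : ℂ := -(Complex.I / 2) * shiftPow α (1 / 2) s

/-- The Liouville-Green coefficients `F_1, F_2, …` as functions of `s`:
`F_1 = ψ / 2` and `F_{k+1} = -(1/2) dF_k/dξ - (1/2) ∑_{j=1}^{k-1} F_j F_{k-j}`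
(`d/dξ = f^{-1/2} d/dz`). The value at index `0` is irrelevant. -/
def lgF (D : Set ℂ) (f g ζ : ℂ → ℂ) (α : ℝ) : ℕ → ℂ → ℂ
  | 0 => fun _ => 0
  | 1 => fun s => lgPsi f g (zOf D ζ s) / 2
  | k + 2 => fun s =>
      -(1 / 2) * (deriv (lgF D f g ζ α (k + 1)) s / lgXiDeriv α s)
        - 1 / 2 * ∑ j : Fin k, lgF D f g ζ α (j + 1) s * lgF D f g ζ α (k - j) s

/-- The standing assumptions on the equation `w'' = (u² f(α,z) + g(z)) w` in `D` and on the
Liouville variable `ζ = ζ(α,z)`, for one value of `α`. -/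
structure IsSetting (D : Set ℂ) (f g ζ : ℂ → ℂ) (α : ℝ) : Prop where
  isOpen : IsOpen D
  isConnected : IsConnected D
  zero_mem : (0 : ℂ) ∈ D
  f_diff : DifferentiableOn ℂ f (D \ {0})
  g_diff : DifferentiableOn ℂ g (D \ {0})
  f_laurent : ∃ φ : ℂ → ℂ, AnalyticAt ℂ φ 0 ∧ (α = 0 → φ 0 ≠ 0) ∧
    ∀ᶠ z in 𝓝[≠] (0 : ℂ), f z = (α : ℂ) ^ 2 / (4 * z ^ 2) + φ z / z
  g_laurent : ∃ φ : ℂ → ℂ, AnalyticAt ℂ φ 0 ∧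
    ∀ᶠ z in 𝓝[≠] (0 : ℂ), g z = -1 / (4 * z ^ 2) + φ z / z
  /-- For `α > 0` there is exactly one turning point; it is simple, lies on the positive real
  axis and corresponds to `ζ = α²`. -/
  turning_point : 0 < α → ∃ x : ℝ, 0 < x ∧ (x : ℂ) ∈ D ∧ f x = 0 ∧ deriv f x ≠ 0 ∧
    ζ x = (α : ℂ) ^ 2 ∧ ∀ z ∈ D, z ≠ 0 → f z = 0 → z = x
  /-- For `α = 0` there is no turning point, and `f` has the sign of `-x` for real `x ∈ D`. -/
  coalesced : α = 0 → (∀ z ∈ D, z ≠ 0 → f z ≠ 0) ∧ ∀ x : ℝ, (x : ℂ) ∈ D →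
    (0 < x → ∃ y : ℝ, y < 0 ∧ f x = y) ∧ (x < 0 → ∃ y : ℝ, 0 < y ∧ f x = y)
  zeta_diff : DifferentiableOn ℂ ζ D
  zeta_inj : InjOn ζ D
  zeta_zero : ζ 0 = 0
  /-- `f (dz/dζ)² = α²/(4ζ²) - 1/(4ζ)`. -/
  zeta_eq : ∀ z ∈ D, z ≠ 0 →
    f z = deriv ζ z ^ 2 * ((α : ℂ) ^ 2 / (4 * ζ z ^ 2) - 1 / (4 * ζ z))
  /-- The cut `ζ < 0`, whose two edges end at `ζ₁ = -∞ + i0` and `ζ₂ = -∞ - i0`, lies in `ζ(D)`. -/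
  neg_mem : ∀ r : ℝ, 0 < r → (-r : ℂ) ∈ ζ '' D
  /-- `D` has no holes: the surface on which the solutions live is simply connected. -/
  simplyConnected : IsSimplyConnected (logSurface D ζ)

/-- A piecewise continuously differentiable curve: continuous, and continuously differentiable on
each closed interval that has no break point in its interior. -/
def IsPiecewiseC1 (L : ℝ → ℂ) : Prop :=
  Continuous L ∧ ∃ B : Finset ℝ, ∀ a b : ℝ, a < b → (∀ t ∈ B, t ∉ Ioo a b) →
    ContDiffOn ℝ 1 L (Icc a b)

/-- An admissible path, in the variable `s = log ζ`, from `ξ₁ = +∞ + iαπ/2` to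
`ξ₂ = -∞ + iαπ/2`: it lies in the plane cut along `ζ ≤ α²` (the edges of `ζ < 0` included),
avoids the segment `Re ξ = 0`, `0 ≤ Im ξ ≤ απ/2`, comes in along the upper edge and leaves along
the lower edge of the cut, and `Re ξ` decreases along it. -/
structure IsLGPath (D : Set ℂ) (ζ : ℂ → ℂ) (α : ℝ) (L : ℝ → ℂ) : Prop where
  piecewiseC1 : IsPiecewiseC1 L
  mem : ∀ t, L t ∈ logSurface D ζ
  im_le : ∀ t, |(L t).im| ≤ Real.pi
  off_cut : ∀ t, (L t).im = 0 → α ^ 2 < Real.exp (L t).re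
  off_segment : ∀ t, ¬ ((lgXi α (L t)).re = 0 ∧ 0 ≤ (lgXi α (L t)).im ∧
    (lgXi α (L t)).im ≤ α * Real.pi / 2)
  antitone : Antitone fun t => (lgXi α (L t)).re
  start_edge : ∀ᶠ t in atBot, (L t).im = Real.pi
  end_edge : ∀ᶠ t in atTop, (L t).im = -Real.pi
  start_infty : Tendsto (fun t => (L t).re) atBot atTop
  end_infty : Tendsto (fun t => (L t).re) atTop atTop

/-- The integrand, in the parameter of the path `L`, of `∫ |F_n f^{1/2} dz| = ∫ |F_n dξ|`. -/
def lgIntegrand (D : Set ℂ) (f g ζ : ℂ → ℂ) (α : ℝ) (L : ℝ → ℂ) (n : ℕ) (t : ℝ) : ℝ :=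
  ‖lgF D f g ζ α n (L t) * lgXiDeriv α (L t) * deriv L t‖

/-- `d/dζ` in the variable `s = log ζ`. -/
def dZeta (W : ℂ → ℂ) (s : ℂ) : ℂ := Complex.exp (-s) * deriv W s

/-- `W`, a function of `s = log ζ`, is an analytic solution of the transformed equation
`d²W/dζ² = {u²(α²/(4ζ²) - 1/(4ζ)) - 1/(4ζ²) + ψ̃/ζ} W`. -/
def IsSolution (D : Set ℂ) (g ζ : ℂ → ℂ) (u α : ℝ) (W : ℂ → ℂ) : Prop :=
  DifferentiableOn ℂ W (logSurface D ζ) ∧ ∀ s ∈ logSurface D ζ,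
    dZeta (dZeta W) s =
      ((u : ℂ) ^ 2 * ((α : ℂ) ^ 2 / (4 * Complex.exp s ^ 2) - 1 / (4 * Complex.exp s))
        - 1 / (4 * Complex.exp s ^ 2) + psiTilde g ζ (zOf D ζ s) / Complex.exp s) * W s

/-- The factor `ζ^{1/2} / (ζ - α²)^{1/4}`. -/
def lgFactor (α : ℝ) (s : ℂ) : ℂ := Complex.exp (s / 2) / shiftPow α (1 / 4) s

/-- `W` is the solution `W̃^{(1)}_μ` recessive at `ζ₁ = -∞ + i0`:
`W = ζ^{1/2} (ζ - α²)^{-1/4} exp(-uξ - πi/4) (1 + η)` with `η → 0` at `ζ₁`. -/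
def IsLG1 (D : Set ℂ) (g ζ : ℂ → ℂ) (u α : ℝ) (W : ℂ → ℂ) : Prop :=
  IsSolution D g ζ u α W ∧
    Tendsto (fun x : ℝ => W (x + Real.pi * Complex.I) /
      (lgFactor α (x + Real.pi * Complex.I) *
        Complex.exp (-u * lgXi α (x + Real.pi * Complex.I) - Real.pi * Complex.I / 4)))
      atTop (𝓝 1)

/-- `W` is the solution `W̃^{(2)}_μ` recessive at `ζ₂ = -∞ - i0`:
`W = ζ^{1/2} (ζ - α²)^{-1/4} exp(uξ + πi/4) (1 + η)` with `η → 0` at `ζ₂`. -/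
def IsLG2 (D : Set ℂ) (g ζ : ℂ → ℂ) (u α : ℝ) (W : ℂ → ℂ) : Prop :=
  IsSolution D g ζ u α W ∧
    Tendsto (fun x : ℝ => W (x - Real.pi * Complex.I) /
      (lgFactor α (x - Real.pi * Complex.I) *
        Complex.exp (u * lgXi α (x - Real.pi * Complex.I) + Real.pi * Complex.I / 4)))
      atTop (𝓝 1)

/-- `W` is a solution of the form `ζ^σ V(ζ)` with `V` analytic at `ζ = 0` and `V(0) = c`. -/
def IsFrobenius (D : Set ℂ) (g ζ : ℂ → ℂ) (u α : ℝ) (σ c : ℂ) (W : ℂ → ℂ) : Prop :=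
  IsSolution D g ζ u α W ∧ ∃ V : ℂ → ℂ, AnalyticAt ℂ V 0 ∧ V 0 = c ∧
    ∀ᶠ x in 𝓝[≠] (0 : ℂ), ∀ s : ℂ, Complex.exp s = x → W s = Complex.exp (σ * s) * V x

/-- Linear independence of two functions on a set. -/
def LinIndepOn (S : Set ℂ) (A B : ℂ → ℂ) : Prop :=
  ∀ a b : ℂ, (∀ s ∈ S, a * A s + b * B s = 0) → a = 0 ∧ b = 0

end

/-! The constant is exactly `γ = 1`, and this comes from monodromy around ζ = 0. In the variable s =
log ζ the function y = ζ^{-1/2} W satisfies y'' = Q y, where Q is 2πi-periodic and there is no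
first-order term. Hence T : y(s) ↦ y(s + 2πi) acts on the two-dimensional solution space, and it
preserves the Wronskian, so det T = 1.

On the two edges of the cut the Liouville-Green approximations have the same modulus and differ by a
constant phase. A recessive solution is determined by its asymptotics (`IsLG2.unique`), so
continuing W₁ once around the origin gives Λ W₂ with Λ = e^{-μπi} (`IsLG1.shift_eq`); for y this
reads T y₁ = -Λ y₂. If y₁, y₂ are independent and T y₂ = A y₁ + B y₂, then det T = 1 means ΛA = 1.
Comparing the y₁ coefficients in T y = κ y now shows that every such y is a multiple of y₁ + κΛ y₂,
whatever B is (`exists_eq_of_monodromy`). A Frobenius solution with exponent (1 ± μ)/2 is such a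
solution with κ = e^{±μπi}. The two cases give W₁ + W₂ and, up to a factor, e^{μπi} W₁ + e^{-μπi}
W₂.

What remains is existence and independence. Solutions with prescribed data exist globally because
the surface is simply connected: the germs of solutions form a covering space, which has a section
(`exists_solvesOn_of_isSimplyConnected`). Writing W = ζ^{1/2}(ζ - α²)^{-1/4} e^{uξ} v turns the
equation into a Volterra equation for v along the path, which is a contraction wherever the integral
of |ψ dξ| is at most u/4 (`exists_volterra_solution`, `exists_lg_solution_path`). Near the end of
the path this produces W₂. For large u it holds on the whole path, so W₂ is dominant at the start,
where W₁ is recessive, and the two are independent (`linIndepOn_of_small`). The Frobenius solutions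
come from a convergent power series (`exists_frobenius_series`). -/

/-! ### The equation `y'' = Q y` on an open set of the complex plane -/

/-- `y` solves `y'' = Q y` on `S`. -/
def SolvesOn (Q : ℂ → ℂ) (S : Set ℂ) (y : ℂ → ℂ) : Prop :=
  ∀ s ∈ S, DifferentiableAt ℂ y s ∧ HasDerivAt (deriv y) (Q s * y s) s

/-- The Wronskian of two functions. -/
noncomputable def wron (y w : ℂ → ℂ) (s : ℂ) : ℂ := y s * deriv w s - deriv y s * w s

theorem SolvesOn.mono {Q y : ℂ → ℂ} {S T : Set ℂ} (h : SolvesOn Q S y) (hT : T ⊆ S) :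
    SolvesOn Q T y := fun s hs => h s (hT hs)

theorem SolvesOn.differentiableOn {Q y : ℂ → ℂ} {S : Set ℂ} (h : SolvesOn Q S y) :
    DifferentiableOn ℂ y S := fun s hs => (h s hs).1.differentiableWithinAt

theorem solvesOn_of_hasDerivAt {Q y y' : ℂ → ℂ} {S : Set ℂ} (hS : IsOpen S)
    (h : ∀ s ∈ S, HasDerivAt y (y' s) s) (h' : ∀ s ∈ S, HasDerivAt y' (Q s * y s) s) :
    SolvesOn Q S y := fun s hs => by
  refine ⟨(h s hs).differentiableAt, (h' s hs).congr_of_eventuallyEq ?_⟩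
  filter_upwards [hS.mem_nhds hs] with t ht using (h t ht).deriv

theorem SolvesOn.congr {Q y w : ℂ → ℂ} {S : Set ℂ} (hS : IsOpen S) (h : SolvesOn Q S y)
    (hw : EqOn w y S) : SolvesOn Q S w := by
  have e : ∀ s ∈ S, w =ᶠ[𝓝 s] y := fun s hs => hw.eventuallyEq_of_mem (hS.mem_nhds hs)
  refine solvesOn_of_hasDerivAt (y' := deriv y) hS
    (fun s hs => (h s hs).1.hasDerivAt.congr_of_eventuallyEq (e s hs)) fun s hs => ?_
  rw [hw hs]
  exact (h s hs).2

theorem SolvesOn.deriv_lin {Q y w : ℂ → ℂ} {S : Set ℂ} (hy : SolvesOn Q S y)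
    (hw : SolvesOn Q S w) (a b : ℂ) {s : ℂ} (hs : s ∈ S) :
    deriv (fun s => a * y s + b * w s) s = a * deriv y s + b * deriv w s :=
  (((hy s hs).1.hasDerivAt.const_mul a).add ((hw s hs).1.hasDerivAt.const_mul b)).deriv

theorem SolvesOn.lin {Q y w : ℂ → ℂ} {S : Set ℂ} (hS : IsOpen S) (hy : SolvesOn Q S y)
    (hw : SolvesOn Q S w) (a b : ℂ) : SolvesOn Q S (fun s => a * y s + b * w s) := by
  refine solvesOn_of_hasDerivAt hS (y' := fun s => a * deriv y s + b * deriv w s)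
    (fun s hs => ((hy s hs).1.hasDerivAt.const_mul a).add ((hw s hs).1.hasDerivAt.const_mul b))
    fun s hs => ?_
  convert! ((hy s hs).2.const_mul a).add ((hw s hs).2.const_mul b) using 1
  ring

theorem SolvesOn.hasDerivAt_wron {Q y w : ℂ → ℂ} {S : Set ℂ} (hy : SolvesOn Q S y)
    (hw : SolvesOn Q S w) {s : ℂ} (hs : s ∈ S) : HasDerivAt (wron y w) 0 s := by
  convert! ((hy s hs).1.hasDerivAt.mul (hw s hs).2).sub
    ((hy s hs).2.mul (hw s hs).1.hasDerivAt) using 1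
  ring

theorem SolvesOn.wron_eq {Q y w : ℂ → ℂ} {S : Set ℂ} (hS : IsOpen S) (hc : IsPreconnected S)
    (hy : SolvesOn Q S y) (hw : SolvesOn Q S w) {s t : ℂ} (hs : s ∈ S) (ht : t ∈ S) :
    wron y w s = wron y w t := by
  refine hS.is_const_of_deriv_eq_zero hc
    (fun s hs => (hy.hasDerivAt_wron hw hs).differentiableAt.differentiableWithinAt)
    (fun s hs => (hy.hasDerivAt_wron hw hs).deriv) hs ht

/-- A solution is a combination of two solutions with Wronskian `c ≠ 0`. -/
theorem SolvesOn.exists_eq_lin {Q φ ψ y : ℂ → ℂ} {S : Set ℂ} (hS : IsOpen S)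
    (hc : IsPreconnected S) (hφ : SolvesOn Q S φ) (hψ : SolvesOn Q S ψ) (hy : SolvesOn Q S y)
    {s₀ : ℂ} (hs₀ : s₀ ∈ S) (h : wron φ ψ s₀ ≠ 0) :
    ∃ a b : ℂ, ∀ s ∈ S, y s = a * φ s + b * ψ s := by
  refine ⟨wron y ψ s₀ / wron φ ψ s₀, wron φ y s₀ / wron φ ψ s₀, fun s hs => ?_⟩
  have e₁ := hy.wron_eq hS hc hψ hs hs₀
  have e₂ := hφ.wron_eq hS hc hy hs hs₀
  have e₃ := hφ.wron_eq hS hc hψ hs hs₀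
  rw [← e₁, ← e₂, ← e₃]
  rw [← e₃] at h
  field_simp
  simp only [wron]
  ring

/-- Two solutions with vanishing Wronskian are linearly dependent. -/
theorem SolvesOn.exists_dependent {Q y w : ℂ → ℂ} {S : Set ℂ} (hS : IsOpen S)
    (hc : IsPreconnected S) (hy : SolvesOn Q S y) (hw : SolvesOn Q S w)
    {s₀ : ℂ} (hs₀ : s₀ ∈ S) (h : wron y w s₀ = 0) :
    ∃ a b : ℂ, ¬ (a = 0 ∧ b = 0) ∧ ∀ s ∈ S, a * y s + b * w s = 0 := by
  by_cases hz : ∀ s ∈ S, y s = 0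
  · exact ⟨1, 0, by simp, fun s hs => by simp [hz s hs]⟩
  push Not at hz
  obtain ⟨s₁, hs₁, h₁⟩ := hz
  have hw0 : ∀ s ∈ S, wron y w s = 0 := fun s hs => (hy.wron_eq hS hc hw hs hs₀).trans h
  refine ⟨-(w s₁ / y s₁), 1, by simp, ?_⟩
  have hl := hy.lin hS hw (-(w s₁ / y s₁)) 1
  have han : AnalyticOnNhd ℂ (fun s => -(w s₁ / y s₁) * y s + 1 * w s) S :=
    hl.differentiableOn.analyticOnNhd hS
  have hyc : ContinuousAt y s₁ := (hy s₁ hs₁).1.continuousAt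
  obtain ⟨r, hr, hball⟩ := Metric.eventually_nhds_iff_ball.1
    ((hS.eventually_mem hs₁).and (hyc.eventually_ne h₁) : ∀ᶠ s in 𝓝 s₁, s ∈ S ∧ y s ≠ 0)
  -- Where y ≠ 0 the derivative of w/y is the Wronskian over y², so the quotient is constant near
  -- s₁. The identity theorem spreads the relation over S.
  have hq : ∀ s ∈ Metric.ball s₁ r, HasDerivAt (fun s => w s / y s) 0 s := fun s hs => by
    obtain ⟨h2, h3⟩ := hball s hs
    convert! (hw s h2).1.hasDerivAt.div (hy s h2).1.hasDerivAt h3 using 1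
    have := hw0 s h2
    rw [eq_comm, div_eq_zero_iff]
    left
    rw [wron] at this
    linear_combination this
  have hconst : ∀ s ∈ Metric.ball s₁ r, w s / y s = w s₁ / y s₁ := fun s hs =>
    Metric.isOpen_ball.is_const_of_deriv_eq_zero (convex_ball s₁ r).isPreconnected
      (fun s hs => (hq s hs).differentiableAt.differentiableWithinAt)
      (fun s hs => (hq s hs).deriv) hs (Metric.mem_ball_self hr)
  have := han.eqOn_zero_of_preconnected_of_eventuallyEq_zero hc hs₁ (by
    filter_upwards [Metric.ball_mem_nhds s₁ hr] with s hs
    have h3 := (hball s hs).2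
    have := hconst s hs
    rw [← this]
    simp only [Pi.zero_apply]
    field_simp
    ring)
  exact fun s hs => this hs

theorem SolvesOn.eqOn_of_eventuallyEq {Q y w : ℂ → ℂ} {S : Set ℂ} (hS : IsOpen S)
    (hc : IsPreconnected S) (hy : SolvesOn Q S y) (hw : SolvesOn Q S w) {s₀ : ℂ} (hs₀ : s₀ ∈ S)
    (h : y =ᶠ[𝓝 s₀] w) : EqOn y w S :=
  (hy.differentiableOn.analyticOnNhd hS).eqOn_of_preconnected_of_eventuallyEq
    (hw.differentiableOn.analyticOnNhd hS) hc hs₀ h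

/-! ### Local existence -/

/-- This is one Picard step. A disc is convex, so holomorphic functions have primitives there, and
the mean value inequality costs one factor r per integration. -/
theorem exists_double_primitive {h : ℂ → ℂ} {c : ℂ} {r : ℝ} (hr : 0 < r)
    (hh : DifferentiableOn ℂ h (Metric.ball c r)) :
    ∃ G G₁ : ℂ → ℂ, G c = 0 ∧ G₁ c = 0 ∧
      (∀ s ∈ Metric.ball c r, HasDerivAt G (G₁ s) s ∧ HasDerivAt G₁ (h s) s) ∧
      ∀ C : ℝ, (∀ s ∈ Metric.ball c r, ‖h s‖ ≤ C) →
        ∀ s ∈ Metric.ball c r, ‖G₁ s‖ ≤ C * r ∧ ‖G s‖ ≤ C * r * r := by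
  have prim : ∀ k : ℂ → ℂ, DifferentiableOn ℂ k (Metric.ball c r) →
      ∃ G : ℂ → ℂ, G c = 0 ∧ (∀ s ∈ Metric.ball c r, HasDerivAt G (k s) s) := fun k hk => by
    obtain ⟨G, hG⟩ := (convex_ball c r).exists_forall_hasDerivWithinAt hk
    exact ⟨fun s => G s - G c, by simp, fun s hs =>
      ((hG s hs).hasDerivAt (Metric.isOpen_ball.mem_nhds hs)).sub_const _⟩
  obtain ⟨G₁, h1, h1'⟩ := prim h hh
  obtain ⟨G, h2, h2'⟩ := prim G₁ fun s hs => (h1' s hs).differentiableAt.differentiableWithinAt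
  have key : ∀ (K k : ℂ → ℂ) (B : ℝ), K c = 0 → (∀ s ∈ Metric.ball c r, HasDerivAt K (k s) s) →
      (∀ s ∈ Metric.ball c r, ‖k s‖ ≤ B) → ∀ s ∈ Metric.ball c r, ‖K s‖ ≤ B * r := by
    intro K k B hK hd hB s hs
    have hc : c ∈ Metric.ball c r := Metric.mem_ball_self hr
    have := (convex_ball c r).norm_image_sub_le_of_norm_hasDerivWithin_le
      (fun x hx => (hd x hx).hasDerivWithinAt) hB hc hs
    rw [hK, sub_zero] at this
    refine this.trans (mul_le_mul_of_nonneg_left ?_ ((norm_nonneg _).trans (hB c hc)))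
    rw [← dist_eq_norm]
    exact (Metric.mem_ball.1 hs).le
  refine ⟨G, G₁, h2, h1, fun s hs => ⟨h2' s hs, h1' s hs⟩, fun C hC s hs => ?_⟩
  have b1 := key G₁ h C h1 h1' hC
  exact ⟨b1 s hs, key G G₁ (C * r) h2 h2' b1 s hs⟩

/-- Picard iteration on a small disc. -/
theorem exists_solution_small_ball {Q : ℂ → ℂ} {c : ℂ} {r M : ℝ} (hr : 0 < r) (hr1 : r ≤ 1)
    (hQ : DifferentiableOn ℂ Q (Metric.ball c r)) (hM : ∀ s ∈ Metric.ball c r, ‖Q s‖ ≤ M)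
    (hMr : M * r ≤ 1 / 2) (a b : ℂ) :
    ∃ y, SolvesOn Q (Metric.ball c r) y ∧ y c = a ∧ deriv y c = b := by
  classical
  set U := Metric.ball c r with hU
  have hc : c ∈ U := Metric.mem_ball_self hr
  have hM0 : 0 ≤ M := (norm_nonneg _).trans (hM c hc)
  have step : ∀ y : {y : (ℂ → ℂ) × (ℂ → ℂ) // ∀ s ∈ U, HasDerivAt y.1 (y.2 s) s},
      ∃ w : {y : (ℂ → ℂ) × (ℂ → ℂ) // ∀ s ∈ U, HasDerivAt y.1 (y.2 s) s},
        (w.1.1 c = 0 ∧ w.1.2 c = 0 ∧ (∀ s ∈ U, HasDerivAt w.1.2 (Q s * y.1.1 s) s)) ∧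
        ∀ C : ℝ, (∀ s ∈ U, ‖y.1.1 s‖ ≤ C) →
          ∀ s ∈ U, ‖w.1.2 s‖ ≤ C / 2 ∧ ‖w.1.1 s‖ ≤ C / 2 := by
    intro y
    obtain ⟨G, G₁, h0, h1, h2, h3⟩ := exists_double_primitive (h := fun s => Q s * y.1.1 s) hr
      (hQ.mul fun s hs => (y.2 s hs).differentiableAt.differentiableWithinAt)
    refine ⟨⟨(G, G₁), fun s hs => (h2 s hs).1⟩, ⟨h0, h1, fun s hs => (h2 s hs).2⟩,
      fun C hC s hs => ?_⟩
    have hC0 : 0 ≤ C := (norm_nonneg _).trans (hC c hc)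
    have := h3 (M * C) (fun s hs => by
      rw [norm_mul]
      exact mul_le_mul (hM s hs) (hC s hs) (norm_nonneg _) hM0) s hs
    -- Since M r ≤ 1/2 and r ≤ 1, each step at least halves the sup bounds of the iterate and of its
    -- derivative.
    have e : M * C * r ≤ C / 2 := by nlinarith
    refine ⟨this.1.trans e, this.2.trans ?_⟩
    have : 0 ≤ M * C * r := by positivity
    nlinarith
  choose F hF hFb using step
  let y₀ : {y : (ℂ → ℂ) × (ℂ → ℂ) // ∀ s ∈ U, HasDerivAt y.1 (y.2 s) s} :=
    ⟨(fun s => a + b * (s - c), fun _ => b), fun s _ => by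
      simpa using (((hasDerivAt_id s).sub_const c).const_mul b).const_add a⟩
  let Y : ℕ → {y : (ℂ → ℂ) × (ℂ → ℂ) // ∀ s ∈ U, HasDerivAt y.1 (y.2 s) s} :=
    fun n => F^[n] y₀
  have Ysucc : ∀ n, Y (n + 1) = F (Y n) := fun n => Function.iterate_succ_apply' F n y₀
  set C : ℝ := ‖a‖ + ‖b‖ with hC
  have hC0 : 0 ≤ C := by positivity
  have b0 : ∀ n, ∀ s ∈ U, ‖(Y n).1.1 s‖ ≤ C * (1 / 2) ^ n := by
    intro n
    induction n with
    | zero =>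
      intro s hs
      have : ‖s - c‖ ≤ 1 := by
        rw [← dist_eq_norm]; exact (Metric.mem_ball.1 hs).le.trans hr1
      change ‖a + b * (s - c)‖ ≤ _
      calc _ ≤ ‖a‖ + ‖b‖ * ‖s - c‖ := (norm_add_le _ _).trans (by rw [norm_mul])
        _ ≤ _ := by rw [pow_zero, mul_one, hC]; nlinarith [norm_nonneg b]
    | succ n ih =>
      intro s hs
      rw [Ysucc]
      refine ((hFb (Y n) _ ih s hs).2).trans (le_of_eq ?_)
      ring
  have b1 : ∀ n, ∀ s ∈ U, ‖(Y n).1.2 s‖ ≤ C * (1 / 2) ^ n := by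
    intro n
    cases n with
    | zero => 
      intro s hs
      change ‖b‖ ≤ _
      simp [hC]
    | succ n =>
      intro s hs
      rw [Ysucc]
      refine ((hFb (Y n) _ (b0 n) s hs).1).trans (le_of_eq ?_)
      ring
  have hsum : Summable fun n : ℕ => C * (1 / 2 : ℝ) ^ n :=
    (summable_geometric_of_lt_one (by norm_num) (by norm_num)).mul_left C
  have s0 : ∀ s ∈ U, Summable fun n => (Y n).1.1 s := fun s hs =>
    Summable.of_norm_bounded hsum fun n => b0 n s hs
  have s1 : ∀ s ∈ U, Summable fun n => (Y n).1.2 s := fun s hs =>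
    Summable.of_norm_bounded hsum fun n => b1 n s hs
  have hpre : IsPreconnected U := (convex_ball c r).isPreconnected
  have d0 : ∀ s ∈ U, HasDerivAt (fun s => ∑' n, (Y n).1.1 s) (∑' n, (Y n).1.2 s) s :=
    fun s hs => hasDerivAt_tsum_of_isPreconnected hsum Metric.isOpen_ball hpre
      (fun n t ht => (Y n).2 t ht) (fun n t ht => b1 n t ht) hc (s0 c hc) hs
  -- These are the second derivatives of the terms. The zeroth term is affine, and each later one is
  -- Q times its predecessor, so the sum telescopes to Q times the solution.
  let D2 : ℕ → ℂ → ℂ := fun n s => match n with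
    | 0 => 0
    | n + 1 => Q s * (Y n).1.1 s
  have hD2 : ∀ n s, s ∈ U → HasDerivAt (Y n).1.2 (D2 n s) s := by
    intro n s hs
    cases n with
    | zero => exact hasDerivAt_const s b
    | succ n =>
      rw [Ysucc]
      exact (hF (Y n)).2.2 s hs
  have bD2 : ∀ n s, s ∈ U → ‖D2 n s‖ ≤ 2 * M * (C * (1 / 2) ^ n) := by
    intro n s hs
    cases n with
    | zero => simp [D2]; positivity
    | succ n =>
      simp only [D2, norm_mul]
      refine (mul_le_mul (hM s hs) (b0 n s hs) (norm_nonneg _) hM0).trans (le_of_eq ?_)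
      ring
  have d1 : ∀ s ∈ U, HasDerivAt (fun s => ∑' n, (Y n).1.2 s) (∑' n, D2 n s) s :=
    fun s hs => hasDerivAt_tsum_of_isPreconnected (hsum.mul_left (2 * M)) Metric.isOpen_ball hpre
      hD2 bD2 hc (s1 c hc) hs
  have eD2 : ∀ s ∈ U, ∑' n, D2 n s = Q s * ∑' n, (Y n).1.1 s := by
    intro s hs
    have : Summable fun n => D2 n s := Summable.of_norm_bounded (hsum.mul_left (2 * M))
      fun n => bD2 n s hs
    rw [this.tsum_eq_zero_add, ← tsum_mul_left]
    simp [D2]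
  have v0 : ∑' n, (Y n).1.1 c = a := by
    rw [tsum_eq_single 0]
    · change a + b * (c - c) = a
      simp
    · intro n hn
      obtain ⟨m, rfl⟩ := Nat.exists_eq_succ_of_ne_zero hn
      rw [Nat.succ_eq_add_one, Ysucc]
      exact (hF (Y m)).1
  have v1 : ∑' n, (Y n).1.2 c = b := by
    rw [tsum_eq_single 0]
    · rfl
    · intro n hn
      obtain ⟨m, rfl⟩ := Nat.exists_eq_succ_of_ne_zero hn
      rw [Nat.succ_eq_add_one, Ysucc]
      exact (hF (Y m)).2.1
  refine ⟨fun s => ∑' n, (Y n).1.1 s, solvesOn_of_hasDerivAt Metric.isOpen_ball d0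
    fun s hs => ?_, v0, (d0 c hc).deriv.trans v1⟩
  rw [← eD2 s hs]
  exact d1 s hs

/-- Near every point there are two solutions with Wronskian one. -/
theorem exists_local_fundamental {Q : ℂ → ℂ} {S : Set ℂ} (hS : IsOpen S)
    (hQ : DifferentiableOn ℂ Q S) {c : ℂ} (hc : c ∈ S) :
    ∃ (r : ℝ) (φ ψ : ℂ → ℂ), 0 < r ∧ Metric.ball c r ⊆ S ∧ SolvesOn Q (Metric.ball c r) φ ∧
      SolvesOn Q (Metric.ball c r) ψ ∧ ∀ s ∈ Metric.ball c r, wron φ ψ s = 1 := by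
  have hcont : ContinuousAt Q c := (hQ.differentiableAt (hS.mem_nhds hc)).continuousAt
  obtain ⟨r₀, hr₀, hb⟩ := Metric.eventually_nhds_iff_ball.1
    ((hS.eventually_mem hc).and (hcont.norm.eventually_lt_const (lt_add_one ‖Q c‖)) :
      ∀ᶠ s in 𝓝 c, s ∈ S ∧ ‖Q s‖ < ‖Q c‖ + 1)
  set M := ‖Q c‖ + 1
  have hM : 1 ≤ M := by simp [M]
  set r := min r₀ (1 / (2 * M)) with hr
  have hrp : 0 < r := lt_min hr₀ (by positivity)
  have hrM : M * r ≤ 1 / 2 := by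
    calc M * r ≤ M * (1 / (2 * M)) := by gcongr; exact min_le_right _ _
      _ = 1 / 2 := by field_simp
  have hr1 : r ≤ 1 := by nlinarith
  have hsub : Metric.ball c r ⊆ Metric.ball c r₀ := Metric.ball_subset_ball (min_le_left _ _)
  have hsubS : Metric.ball c r ⊆ S := fun s hs => (hb s (hsub hs)).1
  have ex := exists_solution_small_ball hrp hr1 (hQ.mono hsubS)
    (fun s hs => (hb s (hsub hs)).2.le) hrM
  obtain ⟨φ, hφ, e1, e2⟩ := ex 1 0
  obtain ⟨ψ, hψ, e3, e4⟩ := ex 0 1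
  refine ⟨r, φ, ψ, hrp, hsubS, hφ, hψ, fun s hs => ?_⟩
  rw [hφ.wron_eq Metric.isOpen_ball (convex_ball c r).isPreconnected hψ hs
    (Metric.mem_ball_self hrp), wron, e1, e2, e3, e4]
  norm_num

/-! ### Global existence on simply connected sets -/

/-- Initial data of a second order equation, with the discrete topology. -/
def InitialData : Type := ℂ × ℂ

instance : TopologicalSpace InitialData := ⊥

instance : DiscreteTopology InitialData := ⟨rfl⟩

/-- The coordinate change between two pairs of solutions with Wronskian one. -/
noncomputable def dataChange (φ ψ φ' ψ' : ℂ → ℂ) (x : ℂ) (v : InitialData) : InitialData :=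
  (v.1 * wron φ ψ' x + v.2 * wron ψ ψ' x, v.1 * wron φ' φ x + v.2 * wron φ' ψ x)

/-- The bundle, with discrete fibre, of germs of solutions of `y'' = Q y` over `S`, given by
local pairs `φ i`, `ψ i` of solutions with Wronskian one. -/
noncomputable def solutionBundle {Q : ℂ → ℂ} {S : Set ℂ} (r : S → ℝ) (φ ψ : S → ℂ → ℂ)
    (hr : ∀ i, 0 < r i) (hφ : ∀ i : S, SolvesOn Q (Metric.ball i (r i)) (φ i))
    (hψ : ∀ i : S, SolvesOn Q (Metric.ball i (r i)) (ψ i))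
    (hw : ∀ i : S, ∀ s ∈ Metric.ball (i : ℂ) (r i), wron (φ i) (ψ i) s = 1) :
    FiberBundleCore S S InitialData where
  baseSet i := {x | (x : ℂ) ∈ Metric.ball (i : ℂ) (r i)}
  isOpen_baseSet i := Metric.isOpen_ball.preimage continuous_subtype_val
  indexAt := id
  mem_baseSet_at x := Metric.mem_ball_self (hr x)
  coordChange i j x v := dataChange (φ i) (ψ i) (φ j) (ψ j) x v
  coordChange_self i x hx v := by
    have h1 : ∀ y : ℂ → ℂ, wron y y x = 0 := fun y => by simp [wron, mul_comm]
    have h2 := hw i x hx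
    exact Prod.ext (by simp [dataChange, h1, h2]) (by simp [dataChange, h1, h2])
  continuousOn_coordChange i j := by
    -- Two discs meet in a convex set, so the Wronskians in the transition maps are constant there.
    -- This is the continuity that a discrete fibre demands.
    have hd : ∀ (y w : ℂ → ℂ), SolvesOn Q (Metric.ball i (r i)) y →
        SolvesOn Q (Metric.ball j (r j)) w → ∀ x : ℂ,
        x ∈ Metric.ball (i : ℂ) (r i) ∩ Metric.ball (j : ℂ) (r j) →
        ∀ x' ∈ Metric.ball (i : ℂ) (r i) ∩ Metric.ball (j : ℂ) (r j),
        wron y w x' = wron y w x ∧ wron w y x' = wron w y x := by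
      intro y w hy hw x hx x' hx'
      have ho : IsOpen (Metric.ball (i : ℂ) (r i) ∩ Metric.ball (j : ℂ) (r j)) :=
        Metric.isOpen_ball.inter Metric.isOpen_ball
      have hc : IsPreconnected (Metric.ball (i : ℂ) (r i) ∩ Metric.ball (j : ℂ) (r j)) :=
        ((convex_ball _ _).inter (convex_ball _ _)).isPreconnected
      have hy' := hy.mono (inter_subset_left (t := Metric.ball (j : ℂ) (r j)))
      have hw' := hw.mono (inter_subset_right (s := Metric.ball (i : ℂ) (r i)))
      exact ⟨hy'.wron_eq ho hc hw' hx' hx, hw'.wron_eq ho hc hy' hx' hx⟩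
    rintro ⟨x, v⟩ ⟨hx, -⟩
    refine ContinuousWithinAt.congr_of_eventuallyEq
      (f := fun _ => dataChange (φ i) (ψ i) (φ j) (ψ j) x v)
      continuousWithinAt_const ?_ rfl
    have hv : ∀ᶠ p : S × InitialData in 𝓝 (x, v), p.2 = v :=
      (continuous_snd.tendsto (x, v)).eventually
        (eventually_of_mem ((isOpen_discrete {v}).mem_nhds rfl) fun _ h => h)
    filter_upwards [self_mem_nhdsWithin, nhdsWithin_le_nhds hv] with p hp hpv
    have hp' := hp.1
    simp only [dataChange]
    rw [hpv, (hd _ _ (hφ i) (hψ j) x hx _ hp').1, (hd _ _ (hψ i) (hψ j) x hx _ hp').1,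
      (hd _ _ (hφ i) (hφ j) x hx _ hp').2, (hd _ _ (hψ i) (hφ j) x hx _ hp').2]
  -- With Wronskian one, the middle pair reproduces each solution y as wron(y, ψ) φ + wron(φ, y) ψ.
  -- That is the cocycle identity.
  coordChange_comp i j k x hx v := by
    have h := hw j x hx.1.2
    simp only [dataChange, wron] at h ⊢
    refine Prod.ext ?_ ?_
    · simp only
      linear_combination (v.1 * (φ i x * deriv (ψ k) x - deriv (φ i) x * ψ k x) +
        v.2 * (ψ i x * deriv (ψ k) x - deriv (ψ i) x * ψ k x)) * h
    · simp only
      linear_combination (v.1 * (φ k x * deriv (φ i) x - deriv (φ k) x * φ i x) +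
        v.2 * (φ k x * deriv (ψ i) x - deriv (φ k) x * ψ i x)) * h

/-- On a simply connected open set the initial value problem for `y'' = Q y` is solvable. -/
theorem exists_solvesOn_of_isSimplyConnected {Q : ℂ → ℂ} {S : Set ℂ} (hS : IsOpen S)
    (hsc : IsSimplyConnected S) (hQ : DifferentiableOn ℂ Q S) {s₀ : ℂ} (hs₀ : s₀ ∈ S) (a b : ℂ) :
    ∃ y, SolvesOn Q S y ∧ y s₀ = a ∧ deriv y s₀ = b := by
  have ex : ∀ i : S, ∃ (r : ℝ) (φ ψ : ℂ → ℂ), 0 < r ∧ Metric.ball (i : ℂ) r ⊆ S ∧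
      SolvesOn Q (Metric.ball i r) φ ∧ SolvesOn Q (Metric.ball i r) ψ ∧
      ∀ s ∈ Metric.ball (i : ℂ) r, wron φ ψ s = 1 :=
    fun i => exists_local_fundamental hS hQ i.2
  choose r φ ψ hr hsub hφ hψ hw using ex
  let Z := solutionBundle r φ ψ hr hφ hψ hw
  have := hsc.simplyConnectedSpace
  have : LocallyPathConnectedSpace S := hS.locallyPathConnectedSpace
  have cov : IsCoveringMap (Bundle.TotalSpace.proj : Bundle.TotalSpace InitialData Z.Fiber → S) :=
    FiberBundle.isCoveringMap
  let i₀ : S := ⟨s₀, hs₀⟩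
  have hi₀ : s₀ ∈ Metric.ball (i₀ : ℂ) (r i₀) := Metric.mem_ball_self (hr i₀)
  -- By Cramer's rule these are the coefficients of the solution with data (a, b) in the pair at s₀.
  let v₀ : InitialData := (a * deriv (ψ i₀) s₀ - b * ψ i₀ s₀, φ i₀ s₀ * b - deriv (φ i₀) s₀ * a)
  -- The identity map of the simply connected S lifts to the covering. The lift is a global section,
  -- that is, a consistent choice of germs.
  obtain ⟨σ, ⟨hσ0, hσ⟩, -⟩ := cov.existsUnique_continuousMap_lifts (ContinuousMap.id S) i₀
    (⟨i₀, v₀⟩ : Bundle.TotalSpace InitialData Z.Fiber) rfl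
  have hproj : ∀ x : S, (σ x).proj = x := fun x => congrFun hσ x
  let co : S → S → InitialData := fun i x => (Z.localTriv i (σ x)).2
  have hco : ∀ i x, co i x = Z.coordChange x i x (σ x).2 := by
    intro i x
    have : co i x = Z.coordChange (σ x).proj i (σ x).proj (σ x).2 := rfl
    rw [this]
    simp only [hproj x]
  have hloc : ∀ i x : S, (x : ℂ) ∈ Metric.ball (i : ℂ) (r i) →
      ∀ᶠ x' in 𝓝 x, co i x' = co i x := by
    intro i x hx
    have hmem : σ x ∈ (Z.localTriv i).source := by
      rw [Z.mem_localTriv_source]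
      rw [hproj x]
      exact hx
    have c1 : ContinuousAt (fun x => Z.localTriv i (σ x)) x :=
      ContinuousAt.comp (f := σ) (((Z.localTriv i).continuousOn).continuousAt
        ((Z.localTriv i).open_source.mem_nhds hmem)) σ.continuous.continuousAt
    have c2 : ContinuousAt (co i) x := continuous_snd.continuousAt.comp c1
    exact c2.eventually (eventually_of_mem ((isOpen_discrete {co i x}).mem_nhds rfl) fun _ h => h)
  let val : S → InitialData → ℂ → ℂ := fun i v s => v.1 * φ i s + v.2 * ψ i s
  have hval : ∀ (i : S) (v : InitialData), SolvesOn Q (Metric.ball (i : ℂ) (r i)) (val i v) := fun i v =>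
    (hφ i).lin Metric.isOpen_ball (hψ i) v.1 v.2
  -- The value of a germ does not depend on the chart in which it is read. Near i the glued function
  -- is therefore a fixed combination of φ i and ψ i.
  have hchange : ∀ i x : S, (x : ℂ) ∈ Metric.ball (i : ℂ) (r i) →
      val i (co i x) x = val x (co x x) x := by
    intro i x hx
    have hxx : (x : ℂ) ∈ Metric.ball (x : ℂ) (r x) := Metric.mem_ball_self (hr x)
    have e1 : co x x = (σ x).2 := by
      rw [hco]
      exact Z.coordChange_self x x hxx _
    have h := hw i x hx
    rw [e1, hco i x]
    generalize ((σ x).2 : InitialData) = v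
    change (v.1 * wron (φ x) (ψ i) x + v.2 * wron (ψ x) (ψ i) x) * φ i x +
      (v.1 * wron (φ i) (φ x) x + v.2 * wron (φ i) (ψ x) x) * ψ i x =
      v.1 * φ x x + v.2 * ψ x x
    simp only [wron] at h ⊢
    linear_combination (v.1 * φ x x + v.2 * ψ x x) * h
  classical
  let y : ℂ → ℂ := fun s => if hs : s ∈ S then val ⟨s, hs⟩ (co ⟨s, hs⟩ ⟨s, hs⟩) s else 0
  have hy : ∀ i : S, y =ᶠ[𝓝 (i : ℂ)] val i (co i i) := by
    intro i
    have h1 := hloc i i (Metric.mem_ball_self (hr i))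
    rw [nhds_subtype_eq_comap, eventually_comap] at h1
    filter_upwards [h1, hS.mem_nhds i.2,
      Metric.isOpen_ball.mem_nhds (Metric.mem_ball_self (hr i))] with s h2 hs hb
    have : y s = val ⟨s, hs⟩ (co ⟨s, hs⟩ ⟨s, hs⟩) s := dif_pos hs
    rw [this, ← hchange i ⟨s, hs⟩ hb, h2 ⟨s, hs⟩ rfl]
  have hball : ∀ i : S, (i : ℂ) ∈ Metric.ball (i : ℂ) (r i) := fun i => Metric.mem_ball_self (hr i)
  have hsol : SolvesOn Q S y := by
    intro s hs
    have e := hy ⟨s, hs⟩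
    obtain ⟨d1, d2⟩ := hval ⟨s, hs⟩ (co ⟨s, hs⟩ ⟨s, hs⟩) s (hball ⟨s, hs⟩)
    refine ⟨d1.congr_of_eventuallyEq e, ?_⟩
    rw [e.eq_of_nhds]
    exact d2.congr_of_eventuallyEq e.deriv
  have e0 : co i₀ i₀ = v₀ := by
    rw [hco, hσ0]
    exact Z.coordChange_self i₀ i₀ hi₀ _
  have hw0 := hw i₀ s₀ hi₀
  rw [wron] at hw0
  refine ⟨y, hsol, ?_, ?_⟩
  · rw [(hy i₀).eq_of_nhds, e0]
    change (a * deriv (ψ i₀) s₀ - b * ψ i₀ s₀) * φ i₀ s₀ +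
      (φ i₀ s₀ * b - deriv (φ i₀) s₀ * a) * ψ i₀ s₀ = a
    linear_combination a * hw0
  · rw [(hy i₀).deriv_eq, e0]
    change deriv (fun s => v₀.1 * φ i₀ s + v₀.2 * ψ i₀ s) s₀ = b
    rw [(hφ i₀).deriv_lin (hψ i₀) _ _ hi₀]
    change (a * deriv (ψ i₀) s₀ - b * ψ i₀ s₀) * deriv (φ i₀) s₀ +
      (φ i₀ s₀ * b - deriv (φ i₀) s₀ * a) * deriv (ψ i₀) s₀ = b
    linear_combination b * hw0

/-- A fundamental pair of solutions on a simply connected open set. -/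
theorem exists_fundamental {Q : ℂ → ℂ} {S : Set ℂ} (hS : IsOpen S)
    (hsc : IsSimplyConnected S) (hQ : DifferentiableOn ℂ Q S) :
    ∃ φ ψ, SolvesOn Q S φ ∧ SolvesOn Q S ψ ∧ ∀ s ∈ S, wron φ ψ s = 1 := by
  obtain ⟨s₀, hs₀⟩ := hsc.nonempty
  obtain ⟨φ, hφ, h1, h2⟩ := exists_solvesOn_of_isSimplyConnected hS hsc hQ hs₀ 1 0
  obtain ⟨ψ, hψ, h3, h4⟩ := exists_solvesOn_of_isSimplyConnected hS hsc hQ hs₀ 0 1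
  refine ⟨φ, ψ, hφ, hψ, fun s hs => ?_⟩
  rw [hφ.wron_eq hS hsc.isPathConnected.isConnected.isPreconnected hψ hs hs₀, wron, h1, h2, h3, h4]
  norm_num

/-! ### A Volterra equation on the line -/

section Volterra

open MeasureTheory
open scoped BoundedContinuousFunction NNReal

theorem continuous_integral_Ioi {k : ℝ → ℂ} (hk : ∀ t, IntegrableOn k (Ioi t)) :
    Continuous fun t => ∫ x in Ioi t, k x := by
  refine continuous_iff_continuousAt.2 fun t₀ => ?_
  have hi : IntervalIntegrable k volume (t₀ - 1) (t₀ + 1) :=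
    (intervalIntegrable_iff_integrableOn_Ioc_of_le (by linarith)).2
      ((hk (t₀ - 1)).mono_set Ioc_subset_Ioi_self)
  have hc : ContinuousAt (fun t => ∫ x in (t₀ - 1)..t, k x) t₀ := by
    have := intervalIntegral.continuousOn_primitive_interval' hi (left_mem_uIcc)
    refine this.continuousAt ?_
    rw [uIcc_of_le (by linarith)]
    exact Icc_mem_nhds (by linarith) (by linarith)
  have e : (fun t => ∫ x in Ioi t, k x) =
      fun t => (∫ x in Ioi (t₀ - 1), k x) - ∫ x in (t₀ - 1)..t, k x := by
    funext t
    rw [← intervalIntegral.integral_Ioi_sub_Ioi' (hk (t₀ - 1)) (hk t), sub_sub_cancel]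
  rw [e]
  exact continuousAt_const.sub hc

theorem hasDerivAt_integral_Ioi {k : ℝ → ℂ} (hk : ∀ t, IntegrableOn k (Ioi t)) {t : ℝ}
    (hc : ContinuousAt k t) : HasDerivAt (fun t => ∫ x in Ioi t, k x) (-k t) t := by
  have hi : IntervalIntegrable k volume (t - 1) t :=
    (intervalIntegrable_iff_integrableOn_Ioc_of_le (by linarith)).2
      ((hk (t - 1)).mono_set Ioc_subset_Ioi_self)
  have e : (fun t => ∫ x in Ioi t, k x) =
      fun t' => (∫ x in Ioi (t - 1), k x) - ∫ x in (t - 1)..t', k x := by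
    funext t'
    rw [← intervalIntegral.integral_Ioi_sub_Ioi' (hk (t - 1)) (hk t'), sub_sub_cancel]
  rw [e]
  refine (intervalIntegral.integral_hasDerivAt_right hi ?_ hc).const_sub _
  exact ⟨Ioi (t - 1), Ioi_mem_nhds (by linarith), (hk (t - 1)).aestronglyMeasurable⟩

/-- The system `v' = a b`, `b' = -2 u a b + h v` along a path on which `Re Ξ` decreases,
`a = Ξ'`, has a solution with `v → 1` at the end of the path, if `h` is small in `L¹`. -/
theorem exists_volterra_solution {Ξ h : ℝ → ℂ} {u : ℝ} (hu : 0 < u) (hΞ : Continuous Ξ)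
    (hanti : Antitone fun t => (Ξ t).re) (hint : Integrable h) (hsmall : ∫ t, ‖h t‖ ≤ u / 4) :
    ∃ v b : ℝ → ℂ, Continuous v ∧ Continuous b ∧ (∀ t, ‖v t - 1‖ ≤ 1 / 3) ∧
      Tendsto v atTop (𝓝 1) ∧ ∀ t a, ContinuousAt h t → HasDerivAt Ξ a t →
        HasDerivAt v (a * b t) t ∧ HasDerivAt b (-2 * u * a * b t + h t * v t) t := by
  have hu' : (u : ℂ) ≠ 0 := by exact_mod_cast hu.ne'
  -- Since Re Ξ decreases, |e| decreases along the path, so e(x)/e(t) has modulus at most one for x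
  -- ≥ t.
  let e : ℝ → ℂ := fun t => Complex.exp (2 * u * Ξ t)
  have he : Continuous e := by fun_prop
  have hen : ∀ t, ‖e t‖ = Real.exp (2 * u * (Ξ t).re) := fun t => by
    simp [e, Complex.norm_exp]
  have hemono : ∀ t x, t ≤ x → ‖e x‖ ≤ ‖e t‖ := fun t x htx => by
    rw [hen, hen]
    have := hanti htx
    simp only at this
    gcongr
  have he0 : ∀ t, e t ≠ 0 := fun t => Complex.exp_ne_zero _
  have i1 : ∀ w : ℝ →ᵇ ℂ, Integrable fun x => w x * h x := fun w =>
    hint.bdd_mul (c := ‖w‖) w.continuous.aestronglyMeasurable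
      (Eventually.of_forall fun x => w.norm_coe_le_norm x)
  have i1' : ∀ (w : ℝ →ᵇ ℂ) (t : ℝ), IntegrableOn (fun x => w x * h x) (Ioi t) :=
    fun w t => (i1 w).integrableOn
  have i2 : ∀ (w : ℝ →ᵇ ℂ) (t : ℝ), IntegrableOn (fun x => e x * (w x * h x)) (Ioi t) := by
    intro w t
    refine (i1' w t).bdd_mul (c := ‖e t‖) he.aestronglyMeasurable ?_
    exact (ae_restrict_mem measurableSet_Ioi).mono fun x hx => hemono t x (le_of_lt hx)
  -- Solving the second equation gives b = -I2. Inserting this in v' = a b and exchanging the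
  -- integrations gives v = 1 - (I1 - I2)/(2u). In this form the equation no longer involves the
  -- derivative of Ξ.
  let I1 : (ℝ →ᵇ ℂ) → ℝ → ℂ := fun w t => ∫ x in Ioi t, w x * h x
  let I2 : (ℝ →ᵇ ℂ) → ℝ → ℂ := fun w t => (e t)⁻¹ * ∫ x in Ioi t, e x * (w x * h x)
  have c1 : ∀ w, Continuous (I1 w) := fun w => continuous_integral_Ioi (i1' w)
  have c2 : ∀ w, Continuous (I2 w) := fun w =>
    (he.inv₀ he0).mul (continuous_integral_Ioi (i2 w))
  have hwh : ∀ (w : ℝ →ᵇ ℂ) x, ‖w x * h x‖ ≤ ‖w‖ * ‖h x‖ := fun w x => by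
    rw [norm_mul]
    exact mul_le_mul_of_nonneg_right (w.norm_coe_le_norm x) (norm_nonneg _)
  have n1 : ∀ w t, ‖I1 w t‖ ≤ ‖w‖ * ∫ x in Ioi t, ‖h x‖ := by
    intro w t
    rw [← integral_const_mul]
    exact norm_integral_le_of_norm_le (hint.norm.integrableOn.const_mul _)
      (Eventually.of_forall fun x => hwh w x)
  have n2 : ∀ w t, ‖I2 w t‖ ≤ ‖w‖ * ∫ x in Ioi t, ‖h x‖ := by
    intro w t
    have : I2 w t = ∫ x in Ioi t, (e t)⁻¹ * (e x * (w x * h x)) :=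
      (integral_const_mul _ _).symm
    rw [this, ← integral_const_mul]
    refine norm_integral_le_of_norm_le (hint.norm.integrableOn.const_mul _)
      ((ae_restrict_mem measurableSet_Ioi).mono fun x hx => ?_)
    rw [norm_mul, norm_mul, norm_inv, ← mul_assoc]
    have h1 : ‖e t‖⁻¹ * ‖e x‖ ≤ 1 := by
      rw [inv_mul_le_iff₀ (norm_pos_iff.2 (he0 t)), mul_one]
      exact hemono t x (le_of_lt hx)
    calc _ ≤ 1 * ‖w x * h x‖ := by gcongr
      _ ≤ _ := by rw [one_mul]; exact hwh w x
  have htail : ∀ t, ∫ x in Ioi t, ‖h x‖ ≤ u / 4 := fun t =>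
    (setIntegral_le_integral hint.norm (Eventually.of_forall fun x => norm_nonneg _)).trans hsmall
  have n3 : ∀ w t, ‖(I1 w t - I2 w t) / (2 * u)‖ ≤ ‖w‖ * (∫ x in Ioi t, ‖h x‖) / u := by
    intro w t
    have h2u : ‖(2 * u : ℂ)‖ = 2 * u := by
      rw [norm_mul, Complex.norm_real, Real.norm_of_nonneg hu.le]; norm_num
    rw [norm_div, h2u, div_le_div_iff₀ (by positivity) hu]
    have := (norm_sub_le (I1 w t) (I2 w t)).trans (add_le_add (n1 w t) (n2 w t))
    nlinarith
  -- Both integrals are at most ‖w‖ u/4, so after division by 2u the contraction constant is 1/4.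
  -- Then ‖v‖ ≤ 4/3 and |v - 1| ≤ 1/3.
  have n4 : ∀ w t, ‖(I1 w t - I2 w t) / (2 * u)‖ ≤ 1 / 4 * ‖w‖ := by
    intro w t
    refine (n3 w t).trans ?_
    rw [div_le_iff₀ hu]
    have := mul_le_mul_of_nonneg_left (htail t) (norm_nonneg w)
    linarith
  let Φ : (ℝ →ᵇ ℂ) → (ℝ →ᵇ ℂ) := fun w => BoundedContinuousFunction.ofNormedAddCommGroup
    (fun t => 1 - (I1 w t - I2 w t) / (2 * u))
    (continuous_const.sub (((c1 w).sub (c2 w)).div_const _)) (1 + 1 / 4 * ‖w‖)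
    (fun t => (norm_sub_le _ _).trans (by rw [norm_one]; gcongr; exact n4 w t))
  have hΦ : ∀ w t, Φ w t = 1 - (I1 w t - I2 w t) / (2 * u) := fun w t => rfl
  have hcontr : ContractingWith (1 / 4 : ℝ≥0) Φ := by
    refine ⟨by rw [div_lt_one (by norm_num)]; norm_num, LipschitzWith.of_dist_le_mul fun w w' => ?_⟩
    refine (BoundedContinuousFunction.dist_le (by positivity)).2 fun t => ?_
    have e1 : I1 (w' - w) t = I1 w' t - I1 w t := by
      simp only [I1]
      rw [← integral_sub (i1' w' t) (i1' w t)]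
      congr 1
      funext x
      simp [sub_mul]
    have e2 : I2 (w' - w) t = I2 w' t - I2 w t := by
      simp only [I2]
      rw [← mul_sub, ← integral_sub (i2 w' t) (i2 w t)]
      congr 2
      funext x
      simp [sub_mul, mul_sub]
    have : Φ w t - Φ w' t = (I1 (w' - w) t - I2 (w' - w) t) / (2 * u) := by
      rw [hΦ, hΦ, e1, e2]; ring
    rw [dist_eq_norm, this, dist_comm, dist_eq_norm]
    refine (n4 (w' - w) t).trans (le_of_eq ?_)
    norm_num
  let v := ContractingWith.fixedPoint Φ hcontr
  have hv : ∀ t, v t = 1 - (I1 v t - I2 v t) / (2 * u) := fun t => by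
    have : Φ v = v := hcontr.fixedPoint_isFixedPt
    rw [← hΦ, this]
  have hvn : ‖v‖ ≤ 4 / 3 := by
    have : ‖v‖ ≤ 1 + 1 / 4 * ‖v‖ := (BoundedContinuousFunction.norm_le (by positivity)).2
      fun t => by
        rw [hv t]
        exact (norm_sub_le _ _).trans (by rw [norm_one]; gcongr; exact n4 v t)
    linarith
  have hv1 : ∀ t, ‖v t - 1‖ = ‖(I1 v t - I2 v t) / (2 * u)‖ := fun t => by
    rw [hv t, sub_sub_cancel_left, norm_neg]
  refine ⟨v, fun t => - I2 v t, v.continuous, (c2 v).neg, fun t => ?_, ?_, ?_⟩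
  · rw [hv1]
    refine (n4 v t).trans ?_
    linarith
  · rw [tendsto_iff_norm_sub_tendsto_zero]
    have ht0 : Tendsto (fun t => ∫ x in Ioi t, ‖h x‖) atTop (𝓝 0) :=
      tendsto_integral_Ioi_zero tendsto_id
    have h3 := (ht0.const_mul ‖v‖).div_const u
    rw [mul_zero, zero_div] at h3
    exact squeeze_zero (fun t => norm_nonneg _) (fun t => (hv1 t).le.trans (n3 v t)) h3
  · intro t a hh hd
    have ct1 : ContinuousAt (fun x => v x * h x) t := v.continuous.continuousAt.mul hh
    have d1 : HasDerivAt (I1 v) (-(v t * h t)) t := hasDerivAt_integral_Ioi (i1' v) ct1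
    have d2 := hasDerivAt_integral_Ioi (i2 v) (he.continuousAt.mul ct1)
    have de : HasDerivAt (fun t => (e t)⁻¹) (-(2 * u * a) * (e t)⁻¹) t := by
      have : (fun t => (e t)⁻¹) = fun t => Complex.exp (-(2 * u * Ξ t)) := by
        funext t; simp [e, Complex.exp_neg]
      rw [this]
      convert! ((hd.const_mul (2 * (u : ℂ))).neg).cexp using 1
      simp only [e, Pi.neg_apply, Complex.exp_neg]
      ring
    have d3 : HasDerivAt (I2 v) (-(2 * u * a) * I2 v t - v t * h t) t := by
      convert! de.mul d2 using 1
      simp only [I2]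
      have := he0 t
      field_simp
      ring
    constructor
    · have d4 : HasDerivAt (fun t => 1 - (I1 v t - I2 v t) / (2 * u))
        (-((-(v t * h t) - (-(2 * u * a) * I2 v t - v t * h t)) / (2 * u))) t :=
        ((d1.sub d3).div_const (2 * (u : ℂ))).const_sub 1
      have hfun : (v : ℝ → ℂ) = fun t => 1 - (I1 v t - I2 v t) / (2 * u) := funext hv
      rw [hfun]
      convert! d4 using 1
      field_simp
      ring
    · convert! d3.neg using 1
      ring

end Volterra

/-! ### The Liouville-Green variable -/

/-- The closed strip `|Im s| ≤ π` without the cut `0 < ζ ≤ α²`. -/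
def cutStrip (α : ℝ) : Set ℂ := {s | |s.im| ≤ Real.pi ∧ (s.im = 0 → α ^ 2 < Real.exp s.re)}

theorem exp_half_re (s : ℂ) :
    (Complex.exp (s / 2)).re = Real.exp (s.re / 2) * Real.cos (s.im / 2) := by
  rw [Complex.exp_re]; simp

theorem exp_half_im (s : ℂ) :
    (Complex.exp (s / 2)).im = Real.exp (s.re / 2) * Real.sin (s.im / 2) := by
  rw [Complex.exp_im]; simp

theorem exp_half_sq (s : ℂ) : Complex.exp (s / 2) ^ 2 = Complex.exp s := by
  rw [← Complex.exp_nat_mul]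
  congr 1
  push_cast
  ring

theorem exp_half_re_nonneg {α : ℝ} {s : ℂ} (hs : s ∈ cutStrip α) :
    0 ≤ (Complex.exp (s / 2)).re := by
  have := abs_le.1 hs.1
  rw [exp_half_re]
  exact mul_nonneg (Real.exp_pos _).le
    (Real.cos_nonneg_of_neg_pi_div_two_le_of_le (by linarith) (by linarith))

theorem exp_half_im_ne_zero {α : ℝ} {s : ℂ} (hs : s ∈ cutStrip α) (h : s.im ≠ 0) :
    (Complex.exp (s / 2)).im ≠ 0 := by
  have := abs_le.1 hs.1
  have hpi := Real.pi_pos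
  rw [exp_half_im]
  refine mul_ne_zero (Real.exp_pos _).ne' ?_
  rw [Ne, Real.sin_eq_zero_iff_of_lt_of_lt (by linarith) (by linarith)]
  exact fun h' => h (by linarith)

theorem exp_half_sub_mem_slitPlane {α : ℝ} (hα : 0 ≤ α) {s : ℂ} (hs : s ∈ cutStrip α) :
    Complex.exp (s / 2) - α ∈ Complex.slitPlane := by
  rw [Complex.mem_slitPlane_iff]
  by_cases h : s.im = 0
  · left
    rw [Complex.sub_re, exp_half_re, h]
    have h2 := hs.2 h
    have h3 : Real.exp (s.re / 2) ^ 2 = Real.exp s.re := by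
      rw [← Real.exp_nat_mul]; congr 1; push_cast; ring
    rw [← h3] at h2
    have := (sq_lt_sq₀ hα (Real.exp_pos _).le).1 h2
    simpa using this
  · right
    simpa using exp_half_im_ne_zero hs h

theorem exp_half_add_mem_slitPlane {α : ℝ} (hα : 0 ≤ α) {s : ℂ} (hs : s ∈ cutStrip α) :
    Complex.exp (s / 2) + α ∈ Complex.slitPlane := by
  rw [Complex.mem_slitPlane_iff]
  by_cases h : s.im = 0
  · left
    rw [Complex.add_re, exp_half_re, h]
    have := Real.exp_pos (s.re / 2)
    simp
    linarith
  · right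
    simpa using exp_half_im_ne_zero hs h

theorem exp_sub_sq_ne_zero {α : ℝ} (hα : 0 ≤ α) {s : ℂ} (hs : s ∈ cutStrip α) :
    Complex.exp s - (α : ℂ) ^ 2 ≠ 0 := by
  rw [← exp_half_sq, sq_sub_sq]
  exact mul_ne_zero (Complex.slitPlane_ne_zero (exp_half_add_mem_slitPlane hα hs))
    (Complex.slitPlane_ne_zero (exp_half_sub_mem_slitPlane hα hs))

theorem shiftPow_ne_zero {α : ℝ} (hα : 0 ≤ α) {s : ℂ} (hs : s ∈ cutStrip α) (κ : ℂ) :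
    shiftPow α κ s ≠ 0 := by
  refine mul_ne_zero ?_ ?_ <;> rw [Ne, Complex.cpow_eq_zero_iff, not_and_or]
  · exact Or.inl (Complex.slitPlane_ne_zero (exp_half_sub_mem_slitPlane hα hs))
  · exact Or.inl (Complex.slitPlane_ne_zero (exp_half_add_mem_slitPlane hα hs))

theorem shiftPow_half_sq (α : ℝ) (s : ℂ) :
    shiftPow α (1 / 2) s ^ 2 = Complex.exp s - (α : ℂ) ^ 2 := by
  have h : ∀ z : ℂ, (z ^ (1 / 2 : ℂ)) ^ 2 = z := fun z => by
    rw [← Complex.cpow_nat_mul]; norm_num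
  rw [shiftPow, mul_pow, h, h, ← exp_half_sq s]
  ring

theorem hasDerivAt_shiftPow {α : ℝ} (hα : 0 ≤ α) {s : ℂ} (hs : s ∈ cutStrip α) (κ : ℂ) :
    HasDerivAt (shiftPow α κ)
      (κ * (Complex.exp s / (Complex.exp s - (α : ℂ) ^ 2)) * shiftPow α κ s) s := by
  have m1 := exp_half_sub_mem_slitPlane hα hs
  have m2 := exp_half_add_mem_slitPlane hα hs
  have n1 := Complex.slitPlane_ne_zero m1
  have n2 := Complex.slitPlane_ne_zero m2
  have dp : HasDerivAt (fun s => Complex.exp (s / 2)) (Complex.exp (s / 2) * (1 / 2)) s :=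
    ((hasDerivAt_id s).div_const 2).cexp
  have d1 := (dp.sub_const (α : ℂ)).cpow_const (c := κ) m1
  have d2 := (dp.add_const (α : ℂ)).cpow_const (c := κ) m2
  convert! d1.mul d2 using 1
  rw [Complex.cpow_sub _ _ n1, Complex.cpow_sub _ _ n2, Complex.cpow_one, Complex.cpow_one, shiftPow]
  have n3 : Complex.exp (s / 2) ^ 2 - (α : ℂ) ^ 2 ≠ 0 := by
    rw [exp_half_sq]; exact exp_sub_sq_ne_zero hα hs
  rw [← exp_half_sq s]
  field_simp
  ring

theorem cpow_half_re_pos {z : ℂ} (hz : z ∈ Complex.slitPlane) : 0 < (z ^ (1 / 2 : ℂ)).re := by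
  have hz0 := Complex.slitPlane_ne_zero hz
  rw [Complex.cpow_def_of_ne_zero hz0, Complex.exp_re]
  have e : (Complex.log z * (1 / 2)).im = z.arg / 2 := by
    have : (1 / 2 : ℂ) = ((1 / 2 : ℝ) : ℂ) := by norm_num
    rw [this, Complex.im_mul_ofReal, Complex.log_im]
    ring
  rw [e]
  have h1 := Complex.neg_pi_lt_arg z
  have h2 := lt_of_le_of_ne (Complex.arg_le_pi z) (Complex.slitPlane_arg_ne_pi hz)
  exact mul_pos (Real.exp_pos _) (Real.cos_pos_of_mem_Ioo ⟨by linarith, by linarith⟩)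

/-- Let p = ζ^{1/2} and X = ab with a² = p - α, b² = p + α, Re a > 0, Re b > 0. From a² and b² one
finds Im X = c Im p with c > 0, and X² = p² - α² gives Re X Im X = Re p Im p. If Im p ≠ 0 then c Re
X = Re p ≥ 0; otherwise a and b are real and positive. This fixes the branch of the logarithm in ξ.
-/
theorem shiftPow_half_re_nonneg {α : ℝ} (hα : 0 ≤ α) {s : ℂ} (hs : s ∈ cutStrip α) :
    0 ≤ (shiftPow α (1 / 2) s).re := by
  have hP := exp_half_re_nonneg hs
  have ha := cpow_half_re_pos (exp_half_sub_mem_slitPlane hα hs)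
  have hb := cpow_half_re_pos (exp_half_add_mem_slitPlane hα hs)
  have h : ∀ z : ℂ, (z ^ (1 / 2 : ℂ)) ^ 2 = z := fun z => by
    rw [← Complex.cpow_nat_mul]; norm_num
  have ea := congrArg Complex.im (h (Complex.exp (s / 2) - α))
  have eb := congrArg Complex.im (h (Complex.exp (s / 2) + α))
  have eX := congrArg Complex.im (shiftPow_half_sq α s)
  have eX' : (shiftPow α (1 / 2) s).re * (shiftPow α (1 / 2) s).im =
      (Complex.exp (s / 2)).re * (Complex.exp (s / 2)).im := by
    rw [← exp_half_sq] at eX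
    simp only [pow_two, Complex.sub_im, Complex.mul_im, Complex.ofReal_re, Complex.ofReal_im,
      mul_zero, zero_mul, add_zero, sub_zero] at eX
    linarith
  simp only [shiftPow] at eX' ⊢
  simp only [pow_two, Complex.mul_im, Complex.sub_im, Complex.add_im, Complex.ofReal_im,
    sub_zero, add_zero] at ea eb
  set a := (Complex.exp (s / 2) - α) ^ (1 / 2 : ℂ)
  set b := (Complex.exp (s / 2) + α) ^ (1 / 2 : ℂ)
  set P := (Complex.exp (s / 2)).re
  set I := (Complex.exp (s / 2)).im
  have hai : a.im = I / (2 * a.re) := by field_simp; linarith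
  have hbi : b.im = I / (2 * b.re) := by field_simp; linarith
  have him : (a * b).im = I * (a.re / (2 * b.re) + b.re / (2 * a.re)) := by
    rw [Complex.mul_im, hai, hbi]; ring
  by_cases hI : I = 0
  · rw [Complex.mul_re, hai, hbi, hI]
    simp
    positivity
  · set c := a.re / (2 * b.re) + b.re / (2 * a.re) with hc
    have hcp : 0 < c := by positivity
    have : (a * b).re * c = P := by
      rw [him] at eX'
      have : (a * b).re * c * I = P * I := by linarith
      exact mul_right_cancel₀ hI this
    by_contra hneg
    push Not at hneg
    nlinarith

/-- The branch of the Liouville-Green variable that is analytic across the edges of the strip. -/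
noncomputable def lgXiAnalytic (α : ℝ) (s : ℂ) : ℂ :=
  -Complex.I * shiftPow α (1 / 2) s
    + α * (Complex.log (shiftPow α (1 / 2) s - Complex.I * α) + Real.pi / 2 * Complex.I - s / 2)

/-- The value X = iα would force ζ = 0, so X - iα is a nonzero point of the closed right half-plane
and its principal logarithm is analytic up to the edges. The original argument α + iX is negative on
the upper edge. -/
theorem shiftPow_sub_mem {α : ℝ} (hα : 0 ≤ α) {s : ℂ} (hs : s ∈ cutStrip α) :
    shiftPow α (1 / 2) s - Complex.I * α ∈ Complex.slitPlane ∧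
      0 ≤ (shiftPow α (1 / 2) s - Complex.I * α).re := by
  have h0 := shiftPow_half_re_nonneg hα hs
  have hre : (shiftPow α (1 / 2) s - Complex.I * α).re = (shiftPow α (1 / 2) s).re := by simp
  have hne : shiftPow α (1 / 2) s - Complex.I * α ≠ 0 := by
    intro h
    have h2 := shiftPow_half_sq α s
    rw [sub_eq_zero.1 h, mul_pow, Complex.I_sq] at h2
    exact Complex.exp_ne_zero s (by linear_combination -h2)
  refine ⟨?_, hre ▸ h0⟩
  rw [Complex.mem_slitPlane_iff]
  by_contra hc
  push Not at hc
  exact hne (Complex.ext (le_antisymm hc.1 (hre ▸ h0)) hc.2)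

theorem lgXi_eq_lgXiAnalytic {α : ℝ} (hα : 0 ≤ α) {s : ℂ} (hs : s ∈ cutStrip α) :
    lgXi α s = lgXiAnalytic α s := by
  obtain ⟨h1, h2⟩ := shiftPow_sub_mem hα hs
  have harg := abs_le.1 (Complex.abs_arg_le_pi_div_two_iff.2 h2)
  have e : (α : ℂ) + Complex.I * shiftPow α (1 / 2) s =
      Complex.I * (shiftPow α (1 / 2) s - Complex.I * α) := by
    rw [mul_sub, ← mul_assoc, Complex.I_mul_I]; ring
  have hpi := Real.pi_pos
  rw [lgXi, lgXiAnalytic, e, Complex.log_mul Complex.I_ne_zero (Complex.slitPlane_ne_zero h1)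
    (by rw [Complex.arg_I]; exact ⟨by linarith, by linarith⟩), Complex.log_I]
  ring

theorem hasDerivAt_lgXiAnalytic {α : ℝ} (hα : 0 ≤ α) {s : ℂ} (hs : s ∈ cutStrip α) :
    HasDerivAt (lgXiAnalytic α) (lgXiDeriv α s) s := by
  have h1 := (shiftPow_sub_mem hα hs).1
  have dX := hasDerivAt_shiftPow hα hs (1 / 2)
  have hX2 := shiftPow_half_sq α s
  have hX0 := shiftPow_ne_zero hα hs (1 / 2)
  have hw0 := Complex.slitPlane_ne_zero h1
  have hE := exp_sub_sq_ne_zero hα hs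
  have d := (dX.const_mul (-Complex.I)).add (((((dX.sub_const (Complex.I * α)).clog h1).add_const
    (Real.pi / 2 * Complex.I)).sub ((hasDerivAt_id s).div_const 2)).const_mul (α : ℂ))
  convert! d using 1
  rw [lgXiDeriv]
  set X := shiftPow α (1 / 2) s
  have hes : Complex.exp s = X ^ 2 + (α : ℂ) ^ 2 := by rw [hX2]; ring
  rw [hes]
  have : X ^ 2 + (α : ℂ) ^ 2 - (α : ℂ) ^ 2 = X ^ 2 := by ring
  rw [this]
  have hI := Complex.I_sq
  field_simp
  ring_nf
  simp only [hI]
  ring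

theorem lgXiDeriv_sq (α : ℝ) (s : ℂ) :
    lgXiDeriv α s ^ 2 = ((α : ℂ) ^ 2 - Complex.exp s) / 4 := by
  rw [lgXiDeriv, mul_pow, shiftPow_half_sq, neg_sq, div_pow, Complex.I_sq]
  ring

theorem lgXiDeriv_ne_zero {α : ℝ} (hα : 0 ≤ α) {s : ℂ} (hs : s ∈ cutStrip α) :
    lgXiDeriv α s ≠ 0 := by
  rw [lgXiDeriv]
  exact mul_ne_zero (by simp) (shiftPow_ne_zero hα hs _)

theorem hasDerivAt_lgXiDeriv {α : ℝ} (hα : 0 ≤ α) {s : ℂ} (hs : s ∈ cutStrip α) :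
    HasDerivAt (lgXiDeriv α)
      (1 / 2 * (Complex.exp s / (Complex.exp s - (α : ℂ) ^ 2)) * lgXiDeriv α s) s := by
  convert! (hasDerivAt_shiftPow hα hs (1 / 2)).const_mul (-(Complex.I / 2)) using 1
  rw [lgXiDeriv]
  ring

/-! ### Values on the edges of the cut -/

/-- For p = iq the numbers p - α and p + α are mirror images in the imaginary axis, so their moduli
agree and their arguments add up to π. -/
theorem log_add_log_upper {α q : ℝ} (hq : 0 < q) :
    Complex.log (Complex.I * q - α) + Complex.log (Complex.I * q + α) =
      Real.log (q ^ 2 + α ^ 2) + Real.pi * Complex.I := by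
  set w : ℂ := Complex.I * q + α with hw
  have him : 0 < w.im := by simp [hw, hq]
  have e : Complex.I * q - α = -(starRingEnd ℂ) w := by
    simp [hw]
    ring
  have hn : ‖w‖ ^ 2 = q ^ 2 + α ^ 2 := by
    rw [Complex.sq_norm, Complex.normSq_apply]; simp [hw]; ring
  have hargw : w.arg ≠ Real.pi := fun h => by
    rw [Complex.arg_eq_pi_iff] at h; exact him.ne' h.2
  rw [e, Complex.log, Complex.log, norm_neg, RCLike.norm_conj,
    Complex.arg_neg_eq_arg_add_pi_of_im_neg (by simpa using him), Complex.arg_conj, if_neg hargw,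
    ← hn, Real.log_pow]
  push_cast
  ring

theorem log_add_log_lower {α q : ℝ} (hq : 0 < q) :
    Complex.log (-(Complex.I * q) - α) + Complex.log (-(Complex.I * q) + α) =
      Real.log (q ^ 2 + α ^ 2) - Real.pi * Complex.I := by
  set w : ℂ := Complex.I * q + α with hw
  have him : 0 < w.im := by simp [hw, hq]
  have e : -(Complex.I * q) + α = (starRingEnd ℂ) w := by
    simp [hw]
  have e' : -(Complex.I * q) - α = -w := by rw [hw]; ring
  have hn : ‖w‖ ^ 2 = q ^ 2 + α ^ 2 := by
    rw [Complex.sq_norm, Complex.normSq_apply]; simp [hw]; ring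
  have hargw : w.arg ≠ Real.pi := fun h => by
    rw [Complex.arg_eq_pi_iff] at h; exact him.ne' h.2
  rw [e, e', Complex.log, Complex.log, norm_neg, RCLike.norm_conj,
    Complex.arg_neg_eq_arg_sub_pi_of_im_pos him, Complex.arg_conj, if_neg hargw,
    ← hn, Real.log_pow]
  push_cast
  ring

theorem edge_mem_cutStrip (α x : ℝ) : (x + Real.pi * Complex.I : ℂ) ∈ cutStrip α ∧
    (x - Real.pi * Complex.I : ℂ) ∈ cutStrip α := by
  have := Real.pi_pos
  constructor <;> refine ⟨by simp [abs_of_pos this], fun h => ?_⟩ <;>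
  · simp at h

theorem exp_half_upper (x : ℝ) :
    Complex.exp ((x + Real.pi * Complex.I) / 2) = Complex.I * Real.exp (x / 2) := by
  rw [add_div, Complex.exp_add, mul_div_right_comm, Complex.exp_pi_div_two_mul_I]
  push_cast
  ring

theorem exp_half_lower (x : ℝ) :
    Complex.exp ((x - Real.pi * Complex.I) / 2) = -(Complex.I * Real.exp (x / 2)) := by
  rw [sub_div, Complex.exp_sub, mul_div_right_comm, Complex.exp_pi_div_two_mul_I]
  push_cast
  rw [div_eq_mul_inv, Complex.inv_I]
  ring

theorem shiftPow_eq_exp {α : ℝ} (hα : 0 ≤ α) {s : ℂ} (hs : s ∈ cutStrip α) (κ : ℂ) :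
    shiftPow α κ s = Complex.exp (κ * (Complex.log (Complex.exp (s / 2) - α) +
      Complex.log (Complex.exp (s / 2) + α))) := by
  rw [shiftPow, Complex.cpow_def_of_ne_zero
    (Complex.slitPlane_ne_zero (exp_half_sub_mem_slitPlane hα hs)),
    Complex.cpow_def_of_ne_zero (Complex.slitPlane_ne_zero (exp_half_add_mem_slitPlane hα hs)),
    ← Complex.exp_add]
  congr 1
  ring

theorem exp_half_real_sq (x : ℝ) : Real.exp (x / 2) ^ 2 = Real.exp x := by
  rw [← Real.exp_nat_mul]; congr 1; push_cast; ring

theorem shiftPow_upper {α : ℝ} (hα : 0 ≤ α) (x : ℝ) (κ : ℂ) :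
    shiftPow α κ (x + Real.pi * Complex.I) =
      Complex.exp (κ * (Real.log (Real.exp x + α ^ 2) + Real.pi * Complex.I)) := by
  rw [shiftPow_eq_exp hα (edge_mem_cutStrip α x).1, exp_half_upper,
    log_add_log_upper (Real.exp_pos _), exp_half_real_sq]

theorem shiftPow_lower {α : ℝ} (hα : 0 ≤ α) (x : ℝ) (κ : ℂ) :
    shiftPow α κ (x - Real.pi * Complex.I) =
      Complex.exp (κ * (Real.log (Real.exp x + α ^ 2) - Real.pi * Complex.I)) := by
  rw [shiftPow_eq_exp hα (edge_mem_cutStrip α x).2, exp_half_lower,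
    log_add_log_lower (Real.exp_pos _), exp_half_real_sq]

/-- `Re ξ` on the upper edge of the cut. -/
noncomputable def edgeRho (α x : ℝ) : ℝ :=
  √(Real.exp x + α ^ 2) - α * (Real.log (√(Real.exp x + α ^ 2) + α) - x / 2)

theorem exp_half_log {r : ℝ} (hr : 0 < r) : Complex.exp (1 / 2 * Real.log r) = √r := by
  have : (1 / 2 * Real.log r : ℂ) = ((Real.log r / 2 : ℝ) : ℂ) := by push_cast; ring
  rw [this, ← Complex.ofReal_exp, ← Real.log_sqrt hr.le, Real.exp_log (Real.sqrt_pos.2 hr)]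

theorem lt_sqrt_exp_add {α : ℝ} (x : ℝ) : α < √(Real.exp x + α ^ 2) :=
  Real.lt_sqrt_of_sq_lt (by linarith [Real.exp_pos x])

theorem lgXi_upper {α : ℝ} (hα : 0 ≤ α) (x : ℝ) :
    lgXi α (x + Real.pi * Complex.I) = edgeRho α x + α * Real.pi / 2 * Complex.I := by
  have hr : 0 < Real.exp x + α ^ 2 := by positivity
  have hX : shiftPow α (1 / 2) (x + Real.pi * Complex.I) =
      Complex.I * √(Real.exp x + α ^ 2) := by
    rw [shiftPow_upper hα, mul_add, Complex.exp_add, exp_half_log hr,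
      show (1 / 2 * (Real.pi * Complex.I) : ℂ) = Real.pi / 2 * Complex.I by ring,
      Complex.exp_pi_div_two_mul_I]
    ring
  rw [lgXi, hX, edgeRho]
  have hR := lt_sqrt_exp_add (α := α) x
  have hsq : √(Real.exp x + α ^ 2) ^ 2 = Real.exp x + α ^ 2 := Real.sq_sqrt hr.le
  set R := √(Real.exp x + α ^ 2)
  have e1 : (α + Complex.I * (Complex.I * R) : ℂ) = ((α - R : ℝ) : ℂ) := by
    rw [← mul_assoc, Complex.I_mul_I]; push_cast; ring
  -- On the upper edge α + iX = α - R, and (R - α)(R + α) = e^x brings the logarithm to the form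
  -- that occurs on the lower edge.
  have e2 : Real.log (R - α) = x - Real.log (R + α) := by
    rw [eq_sub_iff_add_eq, ← Real.log_mul (by linarith) (by linarith)]
    rw [show (R - α) * (R + α) = Real.exp x by nlinarith, Real.log_exp]
  rw [e1, Complex.log, Complex.arg_ofReal_of_neg (by linarith), Complex.norm_real,
    Real.norm_eq_abs, abs_of_neg (by linarith), neg_sub, e2]
  have hI := Complex.I_sq
  push_cast
  ring_nf
  simp only [hI]
  ring

theorem lgXi_lower {α : ℝ} (hα : 0 ≤ α) (x : ℝ) :
    lgXi α (x - Real.pi * Complex.I) = -edgeRho α x + α * Real.pi / 2 * Complex.I := by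
  have hr : 0 < Real.exp x + α ^ 2 := by positivity
  have hX : shiftPow α (1 / 2) (x - Real.pi * Complex.I) =
      -(Complex.I * √(Real.exp x + α ^ 2)) := by
    rw [shiftPow_lower hα, mul_sub, Complex.exp_sub, exp_half_log hr,
      show (1 / 2 * (Real.pi * Complex.I) : ℂ) = Real.pi / 2 * Complex.I by ring,
      Complex.exp_pi_div_two_mul_I, div_eq_mul_inv, Complex.inv_I]
    ring
  rw [lgXi, hX, edgeRho]
  have hR := lt_sqrt_exp_add (α := α) x
  set R := √(Real.exp x + α ^ 2)
  have e1 : (α + Complex.I * (-(Complex.I * R)) : ℂ) = ((R + α : ℝ) : ℂ) := by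
    rw [mul_neg, ← mul_assoc, Complex.I_mul_I]; push_cast; ring
  rw [e1, ← Complex.ofReal_log (by linarith)]
  have hI := Complex.I_sq
  push_cast
  ring_nf
  simp only [hI]
  ring

/-- With q = e^{x/2} one has q ≤ R ≤ q + α, and log((R + α)/q) ≤ 2α/q ≤ 2α. Thus Re ξ tends to +∞ on
the upper edge, which makes the approximations recessive. -/
theorem le_edgeRho {α : ℝ} (hα : 0 ≤ α) {x : ℝ} (hx : 0 ≤ x) :
    Real.exp (x / 2) - 2 * α ^ 2 ≤ edgeRho α x := by
  set q := Real.exp (x / 2) with hq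
  have hq1 : 1 ≤ q := Real.one_le_exp (by linarith)
  have hqx : q ^ 2 = Real.exp x := exp_half_real_sq x
  have hR1 : q ≤ √(Real.exp x + α ^ 2) := Real.le_sqrt_of_sq_le (by nlinarith [sq_nonneg α])
  have hR2 : √(Real.exp x + α ^ 2) ≤ q + α := by
    rw [Real.sqrt_le_left (by linarith)]; nlinarith
  rw [edgeRho]
  set R := √(Real.exp x + α ^ 2)
  have hlog : Real.log (R + α) - x / 2 ≤ 2 * α := by
    have : x / 2 = Real.log q := by rw [hq, Real.log_exp]
    rw [this, ← Real.log_div (by linarith) (by linarith)]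
    refine (Real.log_le_sub_one_of_pos (by positivity)).trans ?_
    rw [sub_le_iff_le_add, div_le_iff₀ (by linarith)]
    nlinarith
  nlinarith

/-- The modulus of the Liouville-Green approximations on the edges of the cut. -/
noncomputable def edgeModulus (u α x : ℝ) : ℝ :=
  Real.exp (x / 2 - Real.log (Real.exp x + α ^ 2) / 4 - u * edgeRho α x)

/-- Im ξ = απ/2 on both edges, so the phase is constant in x. Together with `lgApprox_lower` this is
the source of the factor e^{μπi} in the connection formulas. -/
theorem lgApprox_upper {α : ℝ} (hα : 0 ≤ α) (u x : ℝ) :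
    lgFactor α (x + Real.pi * Complex.I) *
        Complex.exp (-u * lgXi α (x + Real.pi * Complex.I) - Real.pi * Complex.I / 4) =
      edgeModulus u α x * Complex.exp (-(u * α * Real.pi / 2 * Complex.I)) := by
  rw [lgXi_upper hα, lgFactor, shiftPow_upper hα, edgeModulus, Complex.ofReal_exp,
    ← Complex.exp_sub, ← Complex.exp_add, ← Complex.exp_add]
  congr 1
  push_cast
  ring

theorem lgApprox_lower {α : ℝ} (hα : 0 ≤ α) (u x : ℝ) :
    lgFactor α (x - Real.pi * Complex.I) *
        Complex.exp (u * lgXi α (x - Real.pi * Complex.I) + Real.pi * Complex.I / 4) =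
      edgeModulus u α x * Complex.exp (u * α * Real.pi / 2 * Complex.I) := by
  rw [lgXi_lower hα, lgFactor, shiftPow_lower hα, edgeModulus, Complex.ofReal_exp,
    ← Complex.exp_sub, ← Complex.exp_add, ← Complex.exp_add]
  congr 1
  push_cast
  ring

/-! ### The Liouville variable -/

namespace IsSetting

variable {D : Set ℂ} {f g ζ : ℂ → ℂ} {α : ℝ}

theorem zeta_analyticAt (h : IsSetting D f g ζ α) {z : ℂ} (hz : z ∈ D) : AnalyticAt ℂ ζ z :=
  h.zeta_diff.analyticAt (h.isOpen.mem_nhds hz)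

theorem zeta_ne_zero (h : IsSetting D f g ζ α) {z : ℂ} (hz : z ∈ D) (hz0 : z ≠ 0) : ζ z ≠ 0 :=
  fun h0 => hz0 (h.zeta_inj hz h.zero_mem (h0.trans h.zeta_zero.symm))

theorem isOpen_punctured (h : IsSetting D f g ζ α) : IsOpen (D \ {0}) :=
  h.isOpen.sdiff isClosed_singleton

/-- Write ζ = z^{m+1} k with k(0) ≠ 0 and compare leading terms in the equation for f. For α ≠ 0 the
double poles give (m + 1)² = 1; for α = 0 the simple pole of f excludes m > 0. -/
theorem deriv_zeta_zero_ne_zero (h : IsSetting D f g ζ α) : deriv ζ 0 ≠ 0 := by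
  have hD : ∀ᶠ z in 𝓝 (0 : ℂ), z ∈ D := h.isOpen.eventually_mem h.zero_mem
  have hnz : ¬ ∀ᶠ z in 𝓝 (0 : ℂ), ζ z = 0 := by
    intro h0
    have : ∀ᶠ z in 𝓝[≠] (0 : ℂ), False := by
      filter_upwards [nhdsWithin_le_nhds h0, nhdsWithin_le_nhds hD, self_mem_nhdsWithin]
        with z h1 h2 h3 using h.zeta_ne_zero h2 h3 h1
    exact (NeBot.ne inferInstance) (Filter.eventually_false_iff_eq_bot.1 this)
  obtain ⟨n, k, hk, hk0, hev⟩ :=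
    (h.zeta_analyticAt h.zero_mem).exists_eventuallyEq_pow_smul_nonzero_iff.2 hnz
  simp only [sub_zero, smul_eq_mul] at hev
  have hn : n ≠ 0 := by
    rintro rfl
    have := hev.self_of_nhds
    rw [h.zeta_zero] at this
    simp at this
    exact hk0 this.symm
  obtain ⟨m, rfl⟩ := Nat.exists_eq_succ_of_ne_zero hn
  have hder : ∀ᶠ z in 𝓝 (0 : ℂ), deriv ζ z = z ^ m * ((m + 1) * k z + z * deriv k z) := by
    filter_upwards [hev.eventually_nhds, hk.eventually_analyticAt] with z hz hkz
    have e : ζ =ᶠ[𝓝 z] fun z => z ^ (m + 1) * k z := hz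
    rw [e.deriv_eq]
    refine ((hasDerivAt_pow (m + 1) z).mul hkz.differentiableAt.hasDerivAt).deriv.trans ?_
    push_cast
    ring
  obtain ⟨φ, hφ, hφ0, hf⟩ := h.f_laurent
  have hk_ne := hk.continuousAt.eventually_ne hk0
  -- Clearing denominators in the equation for f and cancelling z^{2m+2} leaves A = B off the
  -- origin, hence at the origin by continuity.
  let A : ℂ → ℂ := fun z =>
    ((m + 1) * k z + z * deriv k z) ^ 2 * ((α : ℂ) ^ 2 - z ^ (m + 1) * k z)
  let B : ℂ → ℂ := fun z => ((α : ℂ) ^ 2 + 4 * z * φ z) * k z ^ 2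
  have hkd := hk.deriv.continuousAt
  have hkc := hk.continuousAt
  have hφc := hφ.continuousAt
  have hA : ContinuousAt A 0 := by fun_prop
  have hB : ContinuousAt B 0 := by fun_prop
  have hAB : ∀ᶠ z in 𝓝[≠] (0 : ℂ), A z = B z := by
    filter_upwards [hf, nhdsWithin_le_nhds hev, nhdsWithin_le_nhds hder, nhdsWithin_le_nhds hD,
      nhdsWithin_le_nhds hk_ne, self_mem_nhdsWithin] with z h1 h2 h3 h4 h5 h6
    have h6' : z ≠ 0 := h6
    have := h.zeta_eq z h4 h6
    rw [h1, h2, h3] at this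
    simp only [A, B]
    rw [Nat.succ_eq_add_one] at this
    field_simp at this
    have hcan : z ^ 2 * (z ^ m) ^ 2 ≠ 0 :=
      mul_ne_zero (pow_ne_zero _ h6') (pow_ne_zero _ (pow_ne_zero _ h6'))
    apply mul_left_cancel₀ hcan
    linear_combination -this
  have h00 : A 0 = B 0 :=
    tendsto_nhds_unique_of_eventuallyEq (hA.tendsto.mono_left nhdsWithin_le_nhds)
      (hB.tendsto.mono_left nhdsWithin_le_nhds) hAB
  have hm : m = 0 := by
    by_cases hα : α = 0
    -- Here A = B is divided once more by z k. For m > 0 the limit at 0 would be 0 = 4 φ(0) k(0).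
    · by_contra hm
      have hAB' : ∀ᶠ z in 𝓝[≠] (0 : ℂ), -(((m + 1) * k z + z * deriv k z) ^ 2 * z ^ m)
          = 4 * φ z * k z := by
        filter_upwards [hAB, nhdsWithin_le_nhds hk_ne, self_mem_nhdsWithin] with z h1 h5 h6
        have h6' : z ≠ 0 := h6
        simp only [A, B, hα] at h1
        have hc : z * k z ≠ 0 := mul_ne_zero h6' h5
        apply mul_left_cancel₀ hc
        push_cast at h1
        rw [pow_succ] at h1
        linear_combination h1
      have := tendsto_nhds_unique_of_eventuallyEq
        ((show ContinuousAt (fun z => -(((m + 1) * k z + z * deriv k z) ^ 2 * z ^ m)) 0 by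
          fun_prop).tendsto.mono_left nhdsWithin_le_nhds)
        ((show ContinuousAt (fun z => 4 * φ z * k z) 0 by
          fun_prop).tendsto.mono_left nhdsWithin_le_nhds) hAB'
      simp [hm, hk0] at this
      exact hφ0 hα this
    · have hα' : (α : ℂ) ≠ 0 := by exact_mod_cast hα
      simp only [A, B] at h00
      have h1 : ((m : ℂ) + 1) ^ 2 = 1 := by
        have hc : (k 0) ^ 2 * (α : ℂ) ^ 2 ≠ 0 := by positivity
        apply mul_left_cancel₀ hc
        simp at h00
        linear_combination h00
      have h2 : (m + 1) ^ 2 = 1 := by exact_mod_cast h1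
      nlinarith
  subst hm
  have := hder.self_of_nhds
  simp at this
  rw [this]
  exact hk0

/-- Away from 0, f is ζ'² times an analytic function of z, so a critical point of ζ would be a
multiple zero of f. The only zero of f is simple. -/
theorem deriv_zeta_ne_zero (h : IsSetting D f g ζ α) (hα : 0 ≤ α) {z : ℂ} (hz : z ∈ D) :
    deriv ζ z ≠ 0 := by
  by_cases hz0 : z = 0
  · rw [hz0]; exact h.deriv_zeta_zero_ne_zero
  intro hd
  have hfz : f z = 0 := by rw [h.zeta_eq z hz hz0, hd]; ring
  rcases hα.eq_or_lt with h0 | hpos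
  · exact (h.coalesced h0.symm).1 z hz hz0 hfz
  obtain ⟨x, -, -, -, hdf, -, huniq⟩ := h.turning_point hpos
  rw [← huniq z hz hz0 hfz] at hdf
  apply hdf
  have hζ := h.zeta_analyticAt hz
  have hζ0 := h.zeta_ne_zero hz hz0
  have e : f =ᶠ[𝓝 z] fun z => deriv ζ z ^ 2 *
      ((α : ℂ) ^ 2 / (4 * ζ z ^ 2) - 1 / (4 * ζ z)) := by
    filter_upwards [h.isOpen_punctured.mem_nhds ⟨hz, hz0⟩] with w hw
      using h.zeta_eq w hw.1 hw.2
  rw [e.deriv_eq]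
  have hM : DifferentiableAt ℂ (fun z => (α : ℂ) ^ 2 / (4 * ζ z ^ 2) - 1 / (4 * ζ z)) z := by
    have := hζ.differentiableAt
    refine DifferentiableAt.sub ?_ ?_
    · exact (differentiableAt_const _).div ((this.pow 2).const_mul 4)
        (mul_ne_zero (by norm_num) (pow_ne_zero _ hζ0))
    · exact (differentiableAt_const _).div (this.const_mul 4) (mul_ne_zero (by norm_num) hζ0)
  have h1 := (hζ.deriv.differentiableAt.hasDerivAt.pow 2).mul hM.hasDerivAt
  refine h1.deriv.trans ?_
  simp [hd]

/-- The inverse of the Liouville variable. -/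
theorem hasDerivAt_inv (h : IsSetting D f g ζ α) (hα : 0 ≤ α) {z : ℂ} (hz : z ∈ D) :
    HasDerivAt (Function.invFunOn ζ D) (deriv ζ z)⁻¹ (ζ z) := by
  have hd := h.deriv_zeta_ne_zero hα hz
  have hmap : map ζ (𝓝 z) = 𝓝 (ζ z) :=
    (h.zeta_analyticAt hz).hasStrictDerivAt.map_nhds_eq hd
  have hleft := h.zeta_inj.leftInvOn_invFunOn
  have hmem : ∀ U ∈ 𝓝 z, ∀ᶠ w in 𝓝 (ζ z), Function.invFunOn ζ D w ∈ U ∧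
      ζ (Function.invFunOn ζ D w) = w := by
    intro U hU
    rw [← hmap, eventually_map]
    filter_upwards [hU, h.isOpen.mem_nhds hz] with y hy hyD
    rw [hleft hyD]
    exact ⟨hy, rfl⟩
  have hc : ContinuousAt (Function.invFunOn ζ D) (ζ z) := by
    rw [ContinuousAt, hleft hz]
    exact fun U hU => (hmem U hU).mono fun w hw => hw.1
  refine HasDerivAt.of_local_left_inverse hc ?_ hd ((hmem univ univ_mem).mono fun w hw => hw.2)
  rw [hleft hz]
  exact (h.zeta_analyticAt hz).differentiableAt.hasDerivAt

theorem isOpen_image (h : IsSetting D f g ζ α) (hα : 0 ≤ α) : IsOpen (ζ '' D) := by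
  rw [isOpen_iff_mem_nhds]
  rintro _ ⟨z, hz, rfl⟩
  have hmap : map ζ (𝓝 z) = 𝓝 (ζ z) :=
    (h.zeta_analyticAt hz).hasStrictDerivAt.map_nhds_eq (h.deriv_zeta_ne_zero hα hz)
  rw [← hmap]
  exact image_mem_map (h.isOpen.mem_nhds hz)

theorem isOpen_logSurface (h : IsSetting D f g ζ α) (hα : 0 ≤ α) :
    IsOpen (logSurface D ζ) :=
  (h.isOpen_image hα).preimage Complex.continuous_exp

theorem isPreconnected_logSurface (h : IsSetting D f g ζ α) :
    IsPreconnected (logSurface D ζ) :=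
  h.simplyConnected.isPathConnected.isConnected.isPreconnected

theorem zOf_mem {s : ℂ} (hs : s ∈ logSurface D ζ) : zOf D ζ s ∈ D :=
  Function.invFunOn_mem hs

theorem zeta_zOf {s : ℂ} (hs : s ∈ logSurface D ζ) : ζ (zOf D ζ s) = Complex.exp s :=
  Function.invFunOn_eq hs

theorem zOf_ne_zero (h : IsSetting D f g ζ α) {s : ℂ} (hs : s ∈ logSurface D ζ) :
    zOf D ζ s ≠ 0 := fun h0 => by
  have := zeta_zOf hs
  rw [h0, h.zeta_zero] at this
  exact Complex.exp_ne_zero s this.symm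

theorem differentiableAt_zOf (h : IsSetting D f g ζ α) (hα : 0 ≤ α) {s : ℂ}
    (hs : s ∈ logSurface D ζ) : DifferentiableAt ℂ (zOf D ζ) s := by
  have h1 := h.hasDerivAt_inv hα (zOf_mem hs)
  rw [zeta_zOf hs] at h1
  exact (h1.comp s (Complex.hasDerivAt_exp s)).differentiableAt

theorem differentiableAt_psiTilde (h : IsSetting D f g ζ α) (hα : 0 ≤ α) {z : ℂ}
    (hz : z ∈ D) (hz0 : z ≠ 0) : DifferentiableAt ℂ (psiTilde g ζ) z := by
  have hζ := h.zeta_analyticAt hz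
  have d0 := hζ.differentiableAt
  have d1 := hζ.deriv.differentiableAt
  have d2 : DifferentiableAt ℂ (iteratedDeriv 2 ζ) z := by
    rw [iteratedDeriv_eq_iterate]; exact (hζ.iterated_deriv 2).differentiableAt
  have d3 : DifferentiableAt ℂ (iteratedDeriv 3 ζ) z := by
    rw [iteratedDeriv_eq_iterate]; exact (hζ.iterated_deriv 3).differentiableAt
  have dg : DifferentiableAt ℂ g z :=
    h.g_diff.differentiableAt (h.isOpen_punctured.mem_nhds ⟨hz, hz0⟩)
  have n1 := h.deriv_zeta_ne_zero hα hz
  have n0 := h.zeta_ne_zero hz hz0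
  unfold psiTilde
  refine ((?_ : DifferentiableAt ℂ _ z).add ?_).add ?_
  · exact (d0.mul (((d1.const_mul 2).mul d3).sub ((d2.pow 2).const_mul 3))).div
      ((d1.pow 4).const_mul 4) (mul_ne_zero (by norm_num) (pow_ne_zero _ n1))
  · exact (differentiableAt_const _).div (d0.const_mul 4) (mul_ne_zero (by norm_num) n0)
  · exact (d0.mul dg).div (d1.pow 2) (pow_ne_zero _ n1)

theorem differentiableOn_psiTilde (h : IsSetting D f g ζ α) (hα : 0 ≤ α) :
    DifferentiableOn ℂ (fun s => psiTilde g ζ (zOf D ζ s)) (logSurface D ζ) := fun s hs =>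
  ((h.differentiableAt_psiTilde hα (zOf_mem hs) (h.zOf_ne_zero hs)).comp s
    (h.differentiableAt_zOf hα hs)).differentiableWithinAt

/-- The singularity of `ψ̃` at `ζ = 0` is removable. -/
theorem exists_analyticAt_psiTilde (h : IsSetting D f g ζ α) (hα : 0 ≤ α) :
    ∃ r : ℂ → ℂ, AnalyticAt ℂ r 0 ∧ ∃ ε > 0, ∀ s : ℂ, ‖Complex.exp s‖ < ε →
      s ∈ logSurface D ζ ∧ psiTilde g ζ (zOf D ζ s) = r (Complex.exp s) := by
  have hζ := h.zeta_analyticAt h.zero_mem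
  obtain ⟨φ, hφ, hg⟩ := h.g_laurent
  have hn1 := h.deriv_zeta_zero_ne_zero
  have dsl : ∀ F : ℂ → ℂ, AnalyticAt ℂ F 0 → AnalyticAt ℂ (dslope F 0) 0 := fun F hF => by
    obtain ⟨p, hp⟩ := hF
    exact ⟨_, hp.has_fpower_series_dslope_fslope⟩
  have hk := dsl ζ hζ
  have hk0 : dslope ζ 0 0 ≠ 0 := by rwa [dslope_same]
  -- With ζ = z k, the terms 1/(4ζ) + ζ g/ζ'² combine to N/(4 z k ζ'²). Since k(0) = ζ'(0), N
  -- vanishes at 0 and the pole cancels; `dslope` supplies N/z.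
  let N : ℂ → ℂ := fun z =>
    deriv ζ z ^ 2 - dslope ζ 0 z ^ 2 + 4 * φ z * z * dslope ζ 0 z ^ 2
  have hN : AnalyticAt ℂ N 0 := by
    have := hζ.deriv
    fun_prop
  have hN0 : N 0 = 0 := by simp [N, dslope_same]
  let Ψ : ℂ → ℂ := fun z =>
    ζ z * (2 * deriv ζ z * iteratedDeriv 3 ζ z - 3 * iteratedDeriv 2 ζ z ^ 2) /
      (4 * deriv ζ z ^ 4) + dslope N 0 z / (4 * dslope ζ 0 z * deriv ζ z ^ 2)
  have hΨ : AnalyticAt ℂ Ψ 0 := by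
    have a1 := hζ.deriv
    have a2 : AnalyticAt ℂ (iteratedDeriv 2 ζ) 0 := by
      rw [iteratedDeriv_eq_iterate]; exact hζ.iterated_deriv 2
    have a3 : AnalyticAt ℂ (iteratedDeriv 3 ζ) 0 := by
      rw [iteratedDeriv_eq_iterate]; exact hζ.iterated_deriv 3
    have a4 := dsl N hN
    refine AnalyticAt.add (AnalyticAt.div ?_ ?_ ?_) (AnalyticAt.div a4 ?_ ?_)
    · fun_prop
    · fun_prop
    · exact mul_ne_zero (by norm_num) (pow_ne_zero _ hn1)
    · fun_prop
    · exact mul_ne_zero (mul_ne_zero (by norm_num) hk0) (pow_ne_zero _ hn1)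
  have hinv : AnalyticAt ℂ (Function.invFunOn ζ D) 0 := by
    refine DifferentiableOn.analyticAt (s := ζ '' D) ?_
      ((h.isOpen_image hα).mem_nhds ⟨0, h.zero_mem, h.zeta_zero⟩)
    rintro _ ⟨z, hz, rfl⟩
    exact (h.hasDerivAt_inv hα hz).differentiableAt.differentiableWithinAt
  have hinv0 : Function.invFunOn ζ D 0 = 0 := by
    have := h.zeta_inj.leftInvOn_invFunOn h.zero_mem
    rwa [h.zeta_zero] at this
  have hev : ∀ᶠ z in 𝓝 (0 : ℂ), z ≠ 0 → z ∈ D → psiTilde g ζ z = Ψ z := by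
    rw [eventually_nhdsWithin_iff] at hg
    filter_upwards [hg, hk.continuousAt.eventually_ne hk0,
      hζ.deriv.continuousAt.eventually_ne hn1] with z h1 h2 h3 h4 h5
    have e1 : ζ z = z * dslope ζ 0 z := by
      rw [dslope_of_ne _ h4, slope_def_field, h.zeta_zero]
      field_simp
      ring
    have e2 : dslope N 0 z = N z / z := by
      rw [dslope_of_ne _ h4, slope_def_field, hN0, sub_zero, sub_zero]
    simp only [psiTilde, Ψ]
    rw [add_assoc]
    congr 1
    rw [h1 h4, e2, e1]
    simp only [N]
    field_simp
    ring
  refine ⟨Ψ ∘ Function.invFunOn ζ D, ?_, ?_⟩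
  · exact AnalyticAt.comp (by rwa [hinv0]) hinv
  have hev2 : ∀ᶠ w in 𝓝 (0 : ℂ), w ∈ ζ '' D ∧
      (Function.invFunOn ζ D w ≠ 0 → Function.invFunOn ζ D w ∈ D →
        psiTilde g ζ (Function.invFunOn ζ D w) = Ψ (Function.invFunOn ζ D w)) := by
    have ht : Tendsto (Function.invFunOn ζ D) (𝓝 0) (𝓝 0) := by
      have := hinv.continuousAt
      rwa [ContinuousAt, hinv0] at this
    exact ((h.isOpen_image hα).eventually_mem ⟨0, h.zero_mem, h.zeta_zero⟩).and (ht.eventually hev)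
  obtain ⟨ε, hε, hb⟩ := Metric.eventually_nhds_iff.1 hev2
  refine ⟨ε, hε, fun s hs => ?_⟩
  obtain ⟨m1, m2⟩ := hb (by rwa [dist_zero_right])
  have hsS : s ∈ logSurface D ζ := m1
  exact ⟨hsS, m2 (h.zOf_ne_zero hsS) (zOf_mem hsS)⟩

/-- The Liouville transformation of the equation to the variable `ξ`. -/
theorem lgPsi_identity (h : IsSetting D f g ζ α) (hα : 0 ≤ α) {z : ℂ}
    (hz : z ∈ D) (hz0 : z ≠ 0) (hne : ζ z - (α : ℂ) ^ 2 ≠ 0) :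
    ((α : ℂ) ^ 2 - ζ z) / 4 * lgPsi f g z = ζ z * psiTilde g ζ z -
      (ζ z ^ 2 + 4 * (α : ℂ) ^ 2 * ζ z) / (16 * (ζ z - (α : ℂ) ^ 2) ^ 2) := by
  have hopen := h.isOpen_punctured
  -- Since f = ζ'² M(ζ), the chain rule expresses f' and f'' through M, M' = M₁, M'' = M₂ and
  -- derivatives of ζ. The claim then becomes an identity of rational functions.
  let M : ℂ → ℂ := fun w => (α : ℂ) ^ 2 / (4 * w ^ 2) - 1 / (4 * w)
  let M₁ : ℂ → ℂ := fun w => -(α : ℂ) ^ 2 / (2 * w ^ 3) + 1 / (4 * w ^ 2)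
  let M₂ : ℂ → ℂ := fun w => 3 * (α : ℂ) ^ 2 / (2 * w ^ 4) - 1 / (2 * w ^ 3)
  have hM : ∀ w : ℂ, w ≠ 0 → HasDerivAt M (M₁ w) w := fun w hw => by
    convert! ((hasDerivAt_const w ((α : ℂ) ^ 2)).div ((hasDerivAt_pow 2 w).const_mul 4)
      (mul_ne_zero (by norm_num) (pow_ne_zero _ hw))).sub ((hasDerivAt_const w (1 : ℂ)).div ((hasDerivAt_id w).const_mul 4)
      (by simpa using hw)) using 1
    simp only [M₁, id]
    push_cast
    field_simp
    ring
  have hM₁ : ∀ w : ℂ, w ≠ 0 → HasDerivAt M₁ (M₂ w) w := fun w hw => by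
    convert! ((hasDerivAt_const w (-(α : ℂ) ^ 2)).div ((hasDerivAt_pow 3 w).const_mul 2)
      (mul_ne_zero (by norm_num) (pow_ne_zero _ hw))).add ((hasDerivAt_const w (1 : ℂ)).div ((hasDerivAt_pow 2 w).const_mul 4)
      (mul_ne_zero (by norm_num) (pow_ne_zero _ hw))) using 1
    simp only [M₂]
    push_cast
    field_simp
    ring
  have z0 : ∀ y ∈ D \ {0}, HasDerivAt ζ (deriv ζ y) y := fun y hy =>
    (h.zeta_analyticAt hy.1).differentiableAt.hasDerivAt
  have z1 : ∀ y ∈ D \ {0}, HasDerivAt (deriv ζ) (iteratedDeriv 2 ζ y) y := fun y hy => by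
    rw [iteratedDeriv_succ, iteratedDeriv_one]
    exact (h.zeta_analyticAt hy.1).deriv.differentiableAt.hasDerivAt
  have z2 : ∀ y ∈ D \ {0}, HasDerivAt (iteratedDeriv 2 ζ) (iteratedDeriv 3 ζ y) y := fun y hy => by
    rw [iteratedDeriv_succ (n := 2)]
    refine DifferentiableAt.hasDerivAt ?_
    rw [iteratedDeriv_eq_iterate]
    exact ((h.zeta_analyticAt hy.1).iterated_deriv 2).differentiableAt
  have ef : ∀ y ∈ D \ {0}, f =ᶠ[𝓝 y] fun y => deriv ζ y ^ 2 * M (ζ y) := fun y hy => by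
    filter_upwards [hopen.mem_nhds hy] with w hw using h.zeta_eq w hw.1 hw.2
  have d1 : ∀ y ∈ D \ {0}, deriv f y =
      2 * deriv ζ y * iteratedDeriv 2 ζ y * M (ζ y) + deriv ζ y ^ 3 * M₁ (ζ y) := fun y hy => by
    rw [(ef y hy).deriv_eq]
    have hMz := (hM (ζ y) (h.zeta_ne_zero hy.1 hy.2)).comp y (z0 y hy)
    refine (((z1 y hy).pow 2).mul hMz).deriv.trans ?_
    simp only [Function.comp_apply, Pi.pow_apply]
    push_cast
    ring
  have hzD : z ∈ D \ {0} := ⟨hz, hz0⟩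
  have d2 : iteratedDeriv 2 f z =
      2 * iteratedDeriv 2 ζ z ^ 2 * M (ζ z) + 2 * deriv ζ z * iteratedDeriv 3 ζ z * M (ζ z)
        + 5 * deriv ζ z ^ 2 * iteratedDeriv 2 ζ z * M₁ (ζ z) + deriv ζ z ^ 4 * M₂ (ζ z) := by
    have e : deriv f =ᶠ[𝓝 z] fun y =>
        2 * deriv ζ y * iteratedDeriv 2 ζ y * M (ζ y) + deriv ζ y ^ 3 * M₁ (ζ y) := by
      filter_upwards [hopen.mem_nhds hzD] with w hw using d1 w hw
    rw [iteratedDeriv_succ, iteratedDeriv_one, e.deriv_eq]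
    have hMz := (hM (ζ z) (h.zeta_ne_zero hz hz0)).comp z (z0 z hzD)
    have hM₁z := (hM₁ (ζ z) (h.zeta_ne_zero hz hz0)).comp z (z0 z hzD)
    refine (((((z1 z hzD).const_mul 2).mul (z2 z hzD)).mul hMz).add
      (((z1 z hzD).pow 3).mul hM₁z)).deriv.trans ?_
    simp only [Function.comp_apply, Pi.pow_apply, Pi.mul_apply]
    push_cast
    ring
  have hfz : f z = deriv ζ z ^ 2 * M (ζ z) := (ef z hzD).eq_of_nhds
  rw [lgPsi, d1 z hzD, d2, hfz, psiTilde]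
  have n1 := h.deriv_zeta_ne_zero hα hz
  have n0 := h.zeta_ne_zero hz hz0
  generalize deriv ζ z = a at *
  generalize iteratedDeriv 2 ζ z = b at *
  generalize iteratedDeriv 3 ζ z = c at *
  generalize ζ z = w at *
  have hMw : M w = -(w - (α : ℂ) ^ 2) / (4 * w ^ 2) := by
    simp only [M]; field_simp; ring
  have hM₁w : M₁ w = (w - 2 * (α : ℂ) ^ 2) / (4 * w ^ 3) := by
    simp only [M₁]; field_simp; ring
  have hM₂w : M₂ w = (3 * (α : ℂ) ^ 2 - w) / (2 * w ^ 4) := by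
    simp only [M₂]; field_simp
  rw [hMw, hM₁w, hM₂w, show (α : ℂ) ^ 2 - w = -(w - (α : ℂ) ^ 2) by ring]
  set e := w - (α : ℂ) ^ 2 with he
  have hα2 : (α : ℂ) ^ 2 = w - e := by rw [he]; ring
  rw [hα2]
  field_simp
  ring

end IsSetting

/-! ### The equation in the variable `s = log ζ` -/

/-- The coefficient of the equation `y'' = Q y` satisfied, in the variable `s = log ζ`, by
`y = ζ^{-1/2} W`. -/
noncomputable def logCoeff (D : Set ℂ) (g ζ : ℂ → ℂ) (u α : ℝ) (s : ℂ) : ℂ :=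
  (u : ℂ) ^ 2 * (((α : ℂ) ^ 2 - Complex.exp s) / 4) + Complex.exp s * psiTilde g ζ (zOf D ζ s)

theorem dZeta_dZeta {S : Set ℂ} (hS : IsOpen S) {W : ℂ → ℂ} (hW : DifferentiableOn ℂ W S) {s : ℂ}
    (hs : s ∈ S) :
    dZeta (dZeta W) s = Complex.exp (-s) ^ 2 * (deriv (deriv W) s - deriv W s) := by
  have hd := (hW.analyticAt (hS.mem_nhds hs)).deriv.differentiableAt.hasDerivAt
  have h1 : HasDerivAt (fun s => Complex.exp (-s) * deriv W s)
      (Complex.exp (-s) * (-1) * deriv W s + Complex.exp (-s) * deriv (deriv W) s) s :=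
    ((hasDerivAt_id s).neg.cexp).mul hd
  change Complex.exp (-s) * deriv (fun s => Complex.exp (-s) * deriv W s) s = _
  rw [h1.deriv]
  ring

/-- In s the second ζ-derivative is ζ^{-2}(W'' - W'). The factor ζ^{-1/2} removes the first-order
term and adds 1/4, which cancels the term -1/(4ζ²). -/
theorem isSolution_iff {D : Set ℂ} {g ζ : ℂ → ℂ} {u α : ℝ} {W : ℂ → ℂ}
    (hS : IsOpen (logSurface D ζ)) :
    IsSolution D g ζ u α W ↔
      SolvesOn (logCoeff D g ζ u α) (logSurface D ζ) (fun s => Complex.exp (-s / 2) * W s) := by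
  set S := logSurface D ζ
  have hexp : ∀ s : ℂ, HasDerivAt (fun s : ℂ => Complex.exp (-s / 2))
      (Complex.exp (-s / 2) * (-1 / 2)) s := fun s =>
    ((hasDerivAt_id s).neg.div_const 2).cexp
  have key : DifferentiableOn ℂ W S → ∀ s ∈ S,
      HasDerivAt (fun s => Complex.exp (-s / 2) * W s)
        (Complex.exp (-s / 2) * (deriv W s - W s / 2)) s ∧
      HasDerivAt (fun s => Complex.exp (-s / 2) * (deriv W s - W s / 2))
        (Complex.exp (-s / 2) * (deriv (deriv W) s - deriv W s + W s / 4)) s := by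
    intro hW s hs
    have an := hW.analyticAt (hS.mem_nhds hs)
    have d0 := an.differentiableAt.hasDerivAt
    have d1 := an.deriv.differentiableAt.hasDerivAt
    constructor
    · convert! (hexp s).mul d0 using 1
      ring
    · convert! (hexp s).mul (d1.sub (d0.div_const 2)) using 1
      simp only [Pi.sub_apply]
      ring
  have hE : ∀ s : ℂ, Complex.exp (-s) * Complex.exp s = 1 := fun s => by
    rw [← Complex.exp_add]; simp
  have alg : ∀ s : ℂ, ∀ A B : ℂ,
      (Complex.exp (-s) ^ 2 * A = ((u : ℂ) ^ 2 * ((α : ℂ) ^ 2 / (4 * Complex.exp s ^ 2) -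
        1 / (4 * Complex.exp s)) - 1 / (4 * Complex.exp s ^ 2) +
        psiTilde g ζ (zOf D ζ s) / Complex.exp s) * B) ↔
      Complex.exp (-s / 2) * (A + B / 4) =
        logCoeff D g ζ u α s * (Complex.exp (-s / 2) * B) := by
    intro s A B
    have h0 := Complex.exp_ne_zero s
    have h1 := Complex.exp_ne_zero (-s / 2)
    rw [Complex.exp_neg, logCoeff]
    generalize Complex.exp (-s / 2) = e at *
    generalize Complex.exp s = E at *
    generalize psiTilde g ζ (zOf D ζ s) = p
    field_simp
    constructor <;> intro hh <;> linear_combination hh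
  constructor
  · rintro ⟨hW, heq⟩
    refine solvesOn_of_hasDerivAt hS (fun s hs => (key hW s hs).1) fun s hs => ?_
    have h2 := heq s hs
    rw [dZeta_dZeta hS hW hs, alg] at h2
    rw [← h2]
    exact (key hW s hs).2
  · intro h
    have hW : DifferentiableOn ℂ W S := by
      have : DifferentiableOn ℂ (fun s => Complex.exp (s / 2) * (Complex.exp (-s / 2) * W s)) S :=
        DifferentiableOn.mul (by fun_prop) h.differentiableOn
      refine this.congr fun s _ => ?_
      rw [← mul_assoc, ← Complex.exp_add, show s / 2 + -s / 2 = 0 by ring, Complex.exp_zero,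
        one_mul]
    refine ⟨hW, fun s hs => ?_⟩
    rw [dZeta_dZeta hS hW hs, alg]
    refine (key hW s hs).2.unique ?_
    refine (h s hs).2.congr_of_eventuallyEq ?_
    filter_upwards [hS.mem_nhds hs] with t ht using (key hW t ht).1.deriv.symm

theorem exp_half_mul_cancel (s x : ℂ) :
    Complex.exp (-s / 2) * (Complex.exp (s / 2) * x) = x := by
  rw [← mul_assoc, ← Complex.exp_add, show -s / 2 + s / 2 = 0 by ring, Complex.exp_zero, one_mul]

theorem IsSetting.differentiableOn_logCoeff {D : Set ℂ} {f g ζ : ℂ → ℂ} {α : ℝ}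
    (h : IsSetting D f g ζ α) (hα : 0 ≤ α) (u : ℝ) :
    DifferentiableOn ℂ (logCoeff D g ζ u α) (logSurface D ζ) :=
  DifferentiableOn.add (by fun_prop)
    (Complex.differentiable_exp.differentiableOn.mul (h.differentiableOn_psiTilde hα))

/-! ### Solutions along a path -/

theorem IsPiecewiseC1.exists_finset {L : ℝ → ℂ} (hL : IsPiecewiseC1 L) :
    ∃ B : Finset ℝ, ∀ t, t ∉ B → HasDerivAt L (deriv L t) t ∧ ContinuousAt (deriv L) t := by
  obtain ⟨-, B, hB⟩ := hL
  refine ⟨B, fun t ht => ?_⟩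
  have hmem : ((B : Set ℝ)ᶜ) ∈ 𝓝 t := B.finite_toSet.isClosed.isOpen_compl.mem_nhds ht
  obtain ⟨ε, hε, hball⟩ := Metric.mem_nhds_iff.1 hmem
  have hc := hB (t - ε) (t + ε) (by linarith) fun x hx hx' =>
    hball (by rw [Real.ball_eq_Ioo]; exact hx') hx
  have hc' : ContDiffOn ℝ 1 L (Ioo (t - ε) (t + ε)) := hc.mono Ioo_subset_Icc_self
  have ht' : Ioo (t - ε) (t + ε) ∈ 𝓝 t := Ioo_mem_nhds (by linarith) (by linarith)
  exact ⟨((hc'.differentiableOn (by norm_num)).differentiableAt ht').hasDerivAt,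
    (hc'.continuousOn_deriv_of_isOpen isOpen_Ioo le_rfl).continuousAt ht'⟩

theorem eq_of_hasDerivAt_zero_off_finset {F : ℝ → ℂ} {B : Finset ℝ} {T : Set ℝ}
    (hT : T.OrdConnected) (hF : Continuous F)
    (hd : ∀ t ∈ T, t ∉ B → HasDerivAt F 0 t) {a b : ℝ} (ha : a ∈ T) (hb : b ∈ T) : F a = F b := by
  have := MeasureTheory.integral_eq_of_hasDerivAt_off_countable F (fun _ => 0) (a := a) (b := b)
    B.countable_toSet hF.continuousOn (fun x hx => hd x (hT.uIcc_subset ha hb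
      (Ioo_subset_Icc_self hx.1)) hx.2) intervalIntegrable_const
  rw [intervalIntegral.integral_zero] at this
  exact (sub_eq_zero.1 this.symm).symm

theorem IsLGPath.mem_cutStrip {D : Set ℂ} {ζ : ℂ → ℂ} {α : ℝ} {L : ℝ → ℂ}
    (hL : IsLGPath D ζ α L) (t : ℝ) : L t ∈ cutStrip α := ⟨hL.im_le t, hL.off_cut t⟩

/-- The coefficient `ψ dξ/dt` along a path. -/
noncomputable def pathCoeff (D : Set ℂ) (f g ζ : ℂ → ℂ) (α : ℝ) (L : ℝ → ℂ) (t : ℝ) : ℂ :=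
  lgPsi f g (zOf D ζ (L t)) * lgXiDeriv α (L t) * deriv L t

theorem norm_pathCoeff (D : Set ℂ) (f g ζ : ℂ → ℂ) (α : ℝ) (L : ℝ → ℂ) (t : ℝ) :
    ‖pathCoeff D f g ζ α L t‖ = 2 * lgIntegrand D f g ζ α L 1 t := by
  simp only [pathCoeff, lgIntegrand, lgF, norm_mul, norm_div]
  norm_num
  ring

section Path

variable {D : Set ℂ} {f g ζ : ℂ → ℂ} {α : ℝ} {L : ℝ → ℂ}

theorem lgPsi_path (h : IsSetting D f g ζ α) (hα : 0 ≤ α) {s : ℂ} (hs : s ∈ logSurface D ζ)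
    (hc : s ∈ cutStrip α) :
    lgXiDeriv α s ^ 2 * lgPsi f g (zOf D ζ s) =
      Complex.exp s * psiTilde g ζ (zOf D ζ s) -
        (Complex.exp s ^ 2 + 4 * (α : ℂ) ^ 2 * Complex.exp s) /
          (16 * (Complex.exp s - (α : ℂ) ^ 2) ^ 2) := by
  have e := IsSetting.zeta_zOf hs
  have := h.lgPsi_identity hα (IsSetting.zOf_mem hs) (h.zOf_ne_zero hs)
    (by rw [e]; exact exp_sub_sq_ne_zero hα hc)
  rw [e] at this
  rw [lgXiDeriv_sq, this]

theorem continuousAt_pathCoeff (h : IsSetting D f g ζ α) (hα : 0 ≤ α) (hL : IsLGPath D ζ α L)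
    {t : ℝ} (ht : ContinuousAt (deriv L) t) : ContinuousAt (pathCoeff D f g ζ α L) t := by
  have hLc : ContinuousAt L t := hL.piecewiseC1.1.continuousAt
  have hp : ContinuousAt (fun t => lgXiDeriv α (L t)) t :=
    ContinuousAt.comp (f := L) (hasDerivAt_lgXiDeriv hα (hL.mem_cutStrip t)).continuousAt hLc
  have hψ : ContinuousAt (fun t => psiTilde g ζ (zOf D ζ (L t))) t :=
    ContinuousAt.comp (f := L) (((h.differentiableOn_psiTilde hα).differentiableAt
      ((h.isOpen_logSurface hα).mem_nhds (hL.mem t))).continuousAt) hLc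
  have he : ContinuousAt (fun t => Complex.exp (L t)) t := hLc.cexp
  have hden : (16 * (Complex.exp (L t) - (α : ℂ) ^ 2) ^ 2) ≠ 0 :=
    mul_ne_zero (by norm_num) (pow_ne_zero _ (exp_sub_sq_ne_zero hα (hL.mem_cutStrip t)))
  -- Continuity is read off from the expression of ψ through ψ̃, all of whose ingredients are
  -- continuous along the path.
  have hQ : ContinuousAt (fun t => ((Complex.exp (L t) * psiTilde g ζ (zOf D ζ (L t)) -
        (Complex.exp (L t) ^ 2 + 4 * (α : ℂ) ^ 2 * Complex.exp (L t)) /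
          (16 * (Complex.exp (L t) - (α : ℂ) ^ 2) ^ 2)) / lgXiDeriv α (L t) ^ 2)
          * lgXiDeriv α (L t) * deriv L t) t := by
    refine (((ContinuousAt.sub (he.mul hψ) (ContinuousAt.div ?_ ?_ hden)).div (hp.pow 2)
      (pow_ne_zero _ (lgXiDeriv_ne_zero hα (hL.mem_cutStrip t)))).mul hp).mul ht
    · fun_prop
    · fun_prop
  refine hQ.congr (Eventually.of_forall fun t => ?_)
  have h0 := lgXiDeriv_ne_zero hα (hL.mem_cutStrip t)
  simp only [pathCoeff]
  rw [← lgPsi_path h hα (hL.mem t) (hL.mem_cutStrip t)]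
  field_simp

theorem integrable_pathCoeff (h : IsSetting D f g ζ α) (hα : 0 ≤ α) (hL : IsLGPath D ζ α L)
    (hint : MeasureTheory.Integrable (lgIntegrand D f g ζ α L 1)) :
    MeasureTheory.Integrable (pathCoeff D f g ζ α L) := by
  obtain ⟨B, hB⟩ := hL.piecewiseC1.exists_finset
  have hmeas : MeasureTheory.AEStronglyMeasurable (pathCoeff D f g ζ α L) := by
    have hc : ContinuousOn (pathCoeff D f g ζ α L) ((B : Set ℝ)ᶜ) := fun t ht =>
      (continuousAt_pathCoeff h hα hL (hB t ht).2).continuousWithinAt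
    have := hc.aestronglyMeasurable (μ := MeasureTheory.volume)
      B.finite_toSet.measurableSet.compl
    rwa [MeasureTheory.Measure.restrict_eq_self_of_ae_mem] at this
    exact (B.finite_toSet.measure_zero MeasureTheory.volume : _)
      |> MeasureTheory.compl_mem_ae_iff.2
  refine (MeasureTheory.integrable_norm_iff hmeas).1 ?_
  refine (hint.const_mul 2).congr (Eventually.of_forall fun t => ?_)
  exact (norm_pathCoeff D f g ζ α L t).symm

theorem continuous_lgXi_path (hα : 0 ≤ α) (hL : IsLGPath D ζ α L) :
    Continuous fun t => lgXi α (L t) := by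
  have e : (fun t => lgXi α (L t)) = fun t => lgXiAnalytic α (L t) :=
    funext fun t => lgXi_eq_lgXiAnalytic hα (hL.mem_cutStrip t)
  rw [e]
  exact continuous_iff_continuousAt.2 fun t => ContinuousAt.comp
    (hasDerivAt_lgXiAnalytic hα (hL.mem_cutStrip t)).continuousAt hL.piecewiseC1.1.continuousAt

theorem hasDerivAt_lgXi_path (hα : 0 ≤ α) (hL : IsLGPath D ζ α L) {t : ℝ} {L' : ℂ}
    (ht : HasDerivAt L L' t) :
    HasDerivAt (fun t => lgXi α (L t)) (lgXiDeriv α (L t) * L') t := by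
  have e : (fun t => lgXi α (L t)) = fun t => lgXiAnalytic α (L t) :=
    funext fun t => lgXi_eq_lgXiAnalytic hα (hL.mem_cutStrip t)
  rw [e]
  exact (hasDerivAt_lgXiAnalytic hα (hL.mem_cutStrip t)).comp t ht

/-- A solution with Liouville-Green behaviour at the end of the path, controlled on the part of the
path on which the integral of `|ψ dξ|` is small. -/
theorem exists_lg_solution_path (h : IsSetting D f g ζ α) (hα : 0 ≤ α) (hL : IsLGPath D ζ α L)
    (hint : MeasureTheory.Integrable (lgIntegrand D f g ζ α L 1)) {u : ℝ} (hu : 0 < u)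
    {T : Set ℝ} (hTo : IsOpen T) (hTc : T.OrdConnected) (hTn : T.Nonempty)
    (hsmall : ∫ t in T, lgIntegrand D f g ζ α L 1 t ≤ u / 8) :
    ∃ y v, SolvesOn (logCoeff D g ζ u α) (logSurface D ζ) y ∧
      (∀ t ∈ T, y (L t) = (shiftPow α (1 / 4) (L t))⁻¹ * Complex.exp (u * lgXi α (L t)) * v t) ∧
      (∀ t, ‖v t - 1‖ ≤ 1 / 3) ∧ Tendsto v atTop (𝓝 1) := by
  obtain ⟨B, hB⟩ := hL.piecewiseC1.exists_finset
  have hS := h.isOpen_logSurface hα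
  obtain ⟨φ, ψ, hφ, hψ, hw⟩ := exists_fundamental hS h.simplyConnected
    (h.differentiableOn_logCoeff hα u)
  have hI := integrable_pathCoeff h hα hL hint
  -- Cutting the coefficient off outside T makes the Volterra equation solvable on the whole line;
  -- it agrees with the true equation on T only.
  have hI' : MeasureTheory.Integrable (T.indicator (pathCoeff D f g ζ α L)) :=
    hI.indicator hTo.measurableSet
  have hsm : ∫ t, ‖T.indicator (pathCoeff D f g ζ α L) t‖ ≤ u / 4 := by
    have e : ∀ t, ‖T.indicator (pathCoeff D f g ζ α L) t‖ =
        T.indicator (fun t => 2 * lgIntegrand D f g ζ α L 1 t) t := fun t => by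
      rw [norm_indicator_eq_indicator_norm]
      congr 1
      funext t
      exact norm_pathCoeff D f g ζ α L t
    simp_rw [e]
    rw [MeasureTheory.integral_indicator hTo.measurableSet, MeasureTheory.integral_const_mul]
    linarith
  obtain ⟨v, b, hvc, hbc, hv1, hvt, hvd⟩ := exists_volterra_solution hu
    (continuous_lgXi_path hα hL) hL.antitone hI' hsm
  let A : ℂ → ℂ := fun s => (shiftPow α (1 / 4) s)⁻¹
  let m : ℂ → ℂ := fun s => -(1 / 4) * (Complex.exp s / (Complex.exp s - (α : ℂ) ^ 2))
  have hA : ∀ s ∈ cutStrip α, HasDerivAt A (m s * A s) s := fun s hs => by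
    have h0 := shiftPow_ne_zero hα hs (1 / 4)
    convert! (hasDerivAt_shiftPow hα hs (1 / 4)).inv h0 using 1
    simp only [A, m]
    field_simp
  have hm : ∀ s ∈ cutStrip α, HasDerivAt m
      ((1 / 4) * ((α : ℂ) ^ 2 * Complex.exp s / (Complex.exp s - (α : ℂ) ^ 2) ^ 2)) s :=
    fun s hs => by
    have h0 := exp_sub_sq_ne_zero hα hs
    convert! (((Complex.hasDerivAt_exp s).div ((Complex.hasDerivAt_exp s).sub_const ((α : ℂ) ^ 2))
      h0).const_mul (-(1 / 4) : ℂ)) using 1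
    field_simp
    ring
  have hp := fun s (hs : s ∈ cutStrip α) => hasDerivAt_lgXiDeriv hα hs
  let Ξ : ℝ → ℂ := fun t => lgXi α (L t)
  have hΞc : Continuous Ξ := continuous_lgXi_path hα hL
  -- Y and Z are the candidates for y and dy/ds along the path, with b = dv/dξ. Here m = A'/A, the
  -- prime being d/ds.
  let Y : ℝ → ℂ := fun t => A (L t) * Complex.exp (u * Ξ t) * v t
  let Z : ℝ → ℂ := fun t => A (L t) * Complex.exp (u * Ξ t) *
    (m (L t) * v t + lgXiDeriv α (L t) * (u * v t + b t))
  have hLc := hL.piecewiseC1.1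
  have hcut := hL.mem_cutStrip
  have contL : ∀ F : ℂ → ℂ, (∀ s ∈ cutStrip α, ContinuousAt F s) → Continuous fun t => F (L t) :=
    fun F hF => continuous_iff_continuousAt.2 fun t =>
      ContinuousAt.comp (hF _ (hcut t)) hLc.continuousAt
  have contS : ∀ F : ℂ → ℂ, (∀ s ∈ logSurface D ζ, ContinuousAt F s) →
      Continuous fun t => F (L t) :=
    fun F hF => continuous_iff_continuousAt.2 fun t =>
      ContinuousAt.comp (hF _ (hL.mem t)) hLc.continuousAt
  have cA := contL A fun s hs => (hA s hs).continuousAt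
  have cm := contL m fun s hs => (hm s hs).continuousAt
  have cp := contL (lgXiDeriv α) fun s hs => (hp s hs).continuousAt
  have ce : Continuous fun t => Complex.exp (u * Ξ t) := (continuous_const.mul hΞc).cexp
  have cY : Continuous Y := (cA.mul ce).mul hvc
  have cZ : Continuous Z :=
    (cA.mul ce).mul ((cm.mul hvc).add (cp.mul ((continuous_const.mul hvc).add hbc)))
  have dYZ : ∀ t ∈ T, t ∉ B → HasDerivAt Y (deriv L t * Z t) t ∧
      HasDerivAt Z (deriv L t * (logCoeff D g ζ u α (L t) * Y t)) t := by
    intro t htT htB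
    obtain ⟨dL, cL⟩ := hB t htB
    have hind : ContinuousAt (T.indicator (pathCoeff D f g ζ α L)) t := by
      refine (continuousAt_pathCoeff h hα hL cL).congr ?_
      filter_upwards [hTo.mem_nhds htT] with x hx
      rw [indicator_of_mem hx]
    have dΞ : HasDerivAt Ξ (lgXiDeriv α (L t) * deriv L t) t := hasDerivAt_lgXi_path hα hL dL
    obtain ⟨dv, db⟩ := hvd t _ hind dΞ
    rw [indicator_of_mem htT] at db
    have dA : HasDerivAt (fun t => A (L t)) _ t := (hA _ (hcut t)).comp t dL
    have dm : HasDerivAt (fun t => m (L t)) _ t := (hm _ (hcut t)).comp t dL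
    have dp : HasDerivAt (fun t => lgXiDeriv α (L t)) _ t := (hp _ (hcut t)).comp t dL
    have de : HasDerivAt (fun t => Complex.exp (u * Ξ t)) _ t := (dΞ.const_mul (u : ℂ)).cexp
    constructor
    · convert! (dA.mul de).mul dv using 1
      simp only [Z, Pi.mul_apply]
      ring
    · convert! (dA.mul de).mul ((dm.mul dv).add (dp.mul ((dv.const_mul (u : ℂ)).add db))) using 1
      have hid := lgPsi_path h hα (hL.mem t) (hcut t)
      -- Up to a constant, A is (dξ/ds)^{-1/2}, and the last two terms are m² + dm/ds = A''/A. This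
      -- leaves d²v/dξ² + 2u dv/dξ = ψ v, the Volterra system.
      have hQ : logCoeff D g ζ u α (L t) = (u : ℂ) ^ 2 * lgXiDeriv α (L t) ^ 2 +
          lgXiDeriv α (L t) ^ 2 * lgPsi f g (zOf D ζ (L t)) + m (L t) ^ 2 +
          (1 / 4) * ((α : ℂ) ^ 2 * Complex.exp (L t) /
            (Complex.exp (L t) - (α : ℂ) ^ 2) ^ 2) := by
        rw [hid, logCoeff, lgXiDeriv_sq]
        have h0 := exp_sub_sq_ne_zero hα (hcut t)
        simp only [m]
        field_simp
        ring
      have hmm : 1 / 2 * (Complex.exp (L t) / (Complex.exp (L t) - (α : ℂ) ^ 2)) =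
          -2 * m (L t) := by simp only [m]; ring
      rw [hQ, hmm]
      simp only [Y, pathCoeff, Pi.mul_apply, Pi.add_apply]
      ring
  -- The Wronskian of the path data (Y, Z) with a genuine solution is constant on T. By Cramer's
  -- rule (Y, Z) is thus the restriction of one global solution, the one chosen below.
  have hWr : ∀ χ, SolvesOn (logCoeff D g ζ u α) (logSurface D ζ) χ → ∀ a ∈ T, ∀ b ∈ T,
      Y a * deriv χ (L a) - Z a * χ (L a) = Y b * deriv χ (L b) - Z b * χ (L b) := by
    intro χ hχ a ha b hb
    refine eq_of_hasDerivAt_zero_off_finset (B := B) hTc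
      (F := fun t => Y t * deriv χ (L t) - Z t * χ (L t)) ?_ ?_ ha hb
    · exact (cY.mul (contS _ fun s hs => (hχ s hs).2.continuousAt)).sub
        (cZ.mul (contS _ fun s hs => (hχ s hs).1.continuousAt))
    · intro t htT htB
      obtain ⟨dY, dZ⟩ := dYZ t htT htB
      have dL := (hB t htB).1
      have d1 : HasDerivAt (fun t => χ (L t)) _ t := (hχ _ (hL.mem t)).1.hasDerivAt.comp t dL
      have d2 : HasDerivAt (fun t => deriv χ (L t)) _ t := (hχ _ (hL.mem t)).2.comp t dL
      convert! (dY.mul d2).sub (dZ.mul d1) using 1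
      ring
  obtain ⟨t₀, ht₀⟩ := hTn
  refine ⟨fun s => (Y t₀ * deriv ψ (L t₀) - Z t₀ * ψ (L t₀)) * φ s +
    -(Y t₀ * deriv φ (L t₀) - Z t₀ * φ (L t₀)) * ψ s, v, hφ.lin hS hψ _ _, fun t ht => ?_, hv1, hvt⟩
  have e1 := hWr φ hφ t₀ ht₀ t ht
  have e2 := hWr ψ hψ t₀ ht₀ t ht
  have e3 := hw (L t) (hL.mem t)
  rw [wron] at e3
  change _ = Y t
  simp only [e1, e2]
  linear_combination Y t * e3

end Path

/-! ### The recessive Liouville-Green solutions -/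

theorem SolvesOn.shift {Q y : ℂ → ℂ} {S : Set ℂ} {τ : ℂ} (h : SolvesOn Q S y)
    (hS : ∀ s ∈ S, s + τ ∈ S) (hQ : ∀ s, Q (s + τ) = Q s) :
    SolvesOn Q S (fun s => y (s + τ)) := fun s hs => by
  obtain ⟨h1, h2⟩ := h (s + τ) (hS s hs)
  have e : deriv (fun s => y (s + τ)) = fun s => deriv y (s + τ) :=
    funext fun s => deriv_comp_add_const y τ s
  refine ⟨?_, ?_⟩
  · exact differentiableAt_comp_add_const.2 h1
  · rw [e]
    rw [hQ] at h2
    exact h2.comp_add_const s τ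

theorem add_mem_logSurface {D : Set ℂ} {ζ : ℂ → ℂ} {τ : ℂ} (hτ : Complex.exp τ = 1) {s : ℂ} :
    s + τ ∈ logSurface D ζ ↔ s ∈ logSurface D ζ := by
  simp [logSurface, Complex.exp_add, hτ]

theorem logCoeff_add (D : Set ℂ) (g ζ : ℂ → ℂ) (u α : ℝ) {τ : ℂ} (hτ : Complex.exp τ = 1) (s : ℂ) :
    logCoeff D g ζ u α (s + τ) = logCoeff D g ζ u α s := by
  simp [logCoeff, zOf, Complex.exp_add, hτ]

section Solutions

variable {D : Set ℂ} {f g ζ : ℂ → ℂ} {u α : ℝ} {W W' W₁ W₂ : ℂ → ℂ} {L : ℝ → ℂ}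

theorem IsSolution.shift (hS : IsOpen (logSurface D ζ)) (h : IsSolution D g ζ u α W) {τ : ℂ}
    (hτ : Complex.exp τ = 1) (c : ℂ) : IsSolution D g ζ u α (fun s => c * W (s + τ)) := by
  rw [isSolution_iff hS] at h ⊢
  have h1 := h.shift (fun s hs => (add_mem_logSurface hτ).2 hs) (logCoeff_add D g ζ u α hτ)
  refine (h1.lin hS h1 (c * Complex.exp (τ / 2)) 0).congr hS fun s _ => ?_
  have : Complex.exp (-s / 2) = Complex.exp (τ / 2) * Complex.exp (-(s + τ) / 2) := by
    rw [← Complex.exp_add]; congr 1; ring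
  simp only [this]
  ring

theorem IsSolution.lin (hS : IsOpen (logSurface D ζ)) (h₁ : IsSolution D g ζ u α W₁)
    (h₂ : IsSolution D g ζ u α W₂) (a b : ℂ) :
    IsSolution D g ζ u α (fun s => a * W₁ s + b * W₂ s) := by
  rw [isSolution_iff hS] at h₁ h₂ ⊢
  exact (h₁.lin hS h₂ a b).congr hS fun s _ => by ring

/-- Limits along a path that ends on the lower edge of the cut are limits along the edge. -/
theorem tendsto_lower_edge {R : ℂ → ℂ} {l : ℂ} (hc : Continuous L)
    (he : ∀ᶠ t in atTop, (L t).im = -Real.pi) (hinf : Tendsto (fun t => (L t).re) atTop atTop)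
    (h : Tendsto (fun t => R (L t)) atTop (𝓝 l)) :
    Tendsto (fun x : ℝ => R (x - Real.pi * Complex.I)) atTop (𝓝 l) := by
  intro U hU
  obtain ⟨T, hT⟩ := eventually_atTop.1 ((h.eventually (eventually_mem_set.2 hU)).and he)
  refine mem_map.2 (mem_atTop_sets.2 ⟨(L T).re, fun x hx => ?_⟩)
  obtain ⟨t, ht, htx⟩ := (isPreconnected_Ici (a := T)).intermediate_value_Ici (l := atTop)
    (self_mem_Ici) (le_principal_iff.2 (Ici_mem_atTop T))
    (Complex.continuous_re.comp hc).continuousOn hinf hx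
  obtain ⟨h1, h2⟩ := hT t ht
  have : L t = x - Real.pi * Complex.I := by
    refine Complex.ext ?_ ?_
    · simpa using htx
    · simpa using h2
  rw [mem_preimage, ← this]
  exact h1

theorem lgFactor_ne_zero (hα : 0 ≤ α) {s : ℂ} (hs : s ∈ cutStrip α) : lgFactor α s ≠ 0 :=
  div_ne_zero (Complex.exp_ne_zero _) (shiftPow_ne_zero hα hs _)

theorem exists_isLG2_path (h : IsSetting D f g ζ α) (hα : 0 ≤ α) (hL : IsLGPath D ζ α L)
    (hint : MeasureTheory.Integrable (lgIntegrand D f g ζ α L 1)) (hu : 0 < u)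
    {T : Set ℝ} (hTo : IsOpen T) (hTc : T.OrdConnected) (hTt : ∀ᶠ t in atTop, t ∈ T)
    (hsmall : ∫ t in T, lgIntegrand D f g ζ α L 1 t ≤ u / 8) :
    ∃ W, IsLG2 D g ζ u α W ∧ ∃ v : ℝ → ℂ, (∀ t ∈ T, W (L t) = lgFactor α (L t) *
      Complex.exp (u * lgXi α (L t) + Real.pi * Complex.I / 4) * v t) ∧
      ∀ t, ‖v t - 1‖ ≤ 1 / 3 := by
  obtain ⟨y, v, hy, hyv, hv1, hvt⟩ := exists_lg_solution_path h hα hL hint hu hTo hTc hTt.exists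
    hsmall
  have hS := h.isOpen_logSurface hα
  let W : ℂ → ℂ := fun s => Complex.exp (Real.pi * Complex.I / 4) * (Complex.exp (s / 2) * y s)
  have hW : ∀ t ∈ T, W (L t) = lgFactor α (L t) *
      Complex.exp (u * lgXi α (L t) + Real.pi * Complex.I / 4) * v t := fun t ht => by
    simp only [W]
    rw [hyv t ht, lgFactor, Complex.exp_add]
    ring
  refine ⟨W, ⟨?_, ?_⟩, v, hW, hv1⟩
  · rw [isSolution_iff hS]
    refine (hy.lin hS hy (Complex.exp (Real.pi * Complex.I / 4)) 0).congr hS fun s _ => ?_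
    simp only [W]
    rw [mul_left_comm, exp_half_mul_cancel]
    ring
  · refine tendsto_lower_edge (R := fun s => W s / (lgFactor α s *
      Complex.exp (u * lgXi α s + Real.pi * Complex.I / 4))) hL.piecewiseC1.1 hL.end_edge
      hL.end_infty ?_
    refine hvt.congr' ?_
    filter_upwards [hTt] with t ht
    rw [hW t ht]
    have := lgFactor_ne_zero hα (hL.mem_cutStrip t)
    have := Complex.exp_ne_zero (u * lgXi α (L t) + Real.pi * Complex.I / 4)
    field_simp

/-- For any u > 0 the tail of the convergent integral falls below u/8, so a final piece of the path
suffices. -/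
theorem exists_isLG2 (h : IsSetting D f g ζ α) (hα : 0 ≤ α) (hL : IsLGPath D ζ α L)
    (hint : MeasureTheory.Integrable (lgIntegrand D f g ζ α L 1)) (hu : 0 < u) :
    ∃ W, IsLG2 D g ζ u α W := by
  have ht0 : Tendsto (fun t => ∫ x in Ioi t, lgIntegrand D f g ζ α L 1 x) atTop (𝓝 0) :=
    MeasureTheory.tendsto_integral_Ioi_zero tendsto_id
  obtain ⟨t₀, ht₀⟩ := (ht0.eventually_le_const (by positivity : (0 : ℝ) < u / 8)).exists
  obtain ⟨W, hW, -⟩ := exists_isLG2_path h hα hL hint hu isOpen_Ioi ordConnected_Ioi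
    (eventually_gt_atTop t₀) ht₀
  exact ⟨W, hW⟩

/-- The factor by which the two Liouville-Green approximations differ on the edges of the cut. -/
theorem lgApprox_lower_eq (hα : 0 ≤ α) (x : ℝ) :
    lgFactor α (x - Real.pi * Complex.I) *
        Complex.exp (u * lgXi α (x - Real.pi * Complex.I) + Real.pi * Complex.I / 4) =
      Complex.exp (u * α * Real.pi * Complex.I) * (lgFactor α (x + Real.pi * Complex.I) *
        Complex.exp (-u * lgXi α (x + Real.pi * Complex.I) - Real.pi * Complex.I / 4)) := by
  rw [lgApprox_lower hα, lgApprox_upper hα, mul_left_comm, ← Complex.exp_add]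
  congr 2
  ring

/-- Translation by 2πi carries the lower edge to the upper edge, where the two approximations differ
only by the constant factor e^{μπi}. -/
theorem IsLG1.shift (hS : IsOpen (logSurface D ζ)) (hα : 0 ≤ α) (h : IsLG1 D g ζ u α W) :
    IsLG2 D g ζ u α (fun s => Complex.exp (u * α * Real.pi * Complex.I) *
      W (s + 2 * Real.pi * Complex.I)) := by
  refine ⟨h.1.shift hS Complex.exp_two_pi_mul_I _, h.2.congr fun x => ?_⟩
  rw [lgApprox_lower_eq hα, mul_div_mul_left _ _ (Complex.exp_ne_zero _)]
  congr 2
  ring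

theorem IsLG2.shift (hS : IsOpen (logSurface D ζ)) (hα : 0 ≤ α) (h : IsLG2 D g ζ u α W) :
    IsLG1 D g ζ u α (fun s => Complex.exp (-(u * α * Real.pi * Complex.I)) *
      W (s + -(2 * Real.pi * Complex.I))) := by
  refine ⟨h.1.shift hS (by rw [Complex.exp_neg, Complex.exp_two_pi_mul_I, inv_one]) _,
    h.2.congr fun x => ?_⟩
  rw [lgApprox_lower_eq hα, Complex.exp_neg, ← div_div, div_eq_inv_mul (W _)]
  congr 3
  ring

/-! ### Uniqueness of the recessive solutions. -/

theorem edgeModulus_bound (hα : 0 ≤ α) (hu : 0 < u) {x : ℝ} (hx : 0 ≤ x) :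
    Real.exp (-x / 2) * edgeModulus u α x ≤ Real.exp (2 * u * α ^ 2) := by
  rw [edgeModulus, ← Real.exp_add, Real.exp_le_exp]
  have h1 := le_edgeRho hα hx
  have h2 : 0 ≤ Real.log (Real.exp x + α ^ 2) :=
    Real.log_nonneg (by nlinarith [Real.one_le_exp hx, sq_nonneg α])
  have h3 := Real.exp_pos (x / 2)
  nlinarith

/-- Let d be the difference of two candidates and y the first one, so d/y → 0. If the Wronskian C of
y and d were nonzero, (d/y)' = C/y² would have nearly constant argument and modulus bounded below on
the edge, so d/y would grow at least linearly. Hence C = 0, and the limit forces d = 0. -/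
theorem IsLG2.unique (h : IsSetting D f g ζ α) (hα : 0 ≤ α) (hu : 0 < u)
    (hW : IsLG2 D g ζ u α W) (hW' : IsLG2 D g ζ u α W') : EqOn W' W (logSurface D ζ) := by
  have hS := h.isOpen_logSurface hα
  have hc := h.isPreconnected_logSurface
  let y : ℂ → ℂ := fun s => Complex.exp (-s / 2) * W s
  let d : ℂ → ℂ := fun s => Complex.exp (-s / 2) * (1 * W s + (-1) * W' s)
  have hy : SolvesOn (logCoeff D g ζ u α) (logSurface D ζ) y := (isSolution_iff hS).1 hW.1
  have hd : SolvesOn (logCoeff D g ζ u α) (logSurface D ζ) d :=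
    (isSolution_iff hS).1 (hW.1.lin hS hW'.1 1 (-1))
  let e : ℝ → ℂ := fun x => x - Real.pi * Complex.I
  have heS : ∀ x, e x ∈ logSurface D ζ := fun x => by
    have h1 := h.neg_mem (Real.exp x) (Real.exp_pos x)
    have : Complex.exp (e x) = -Real.exp x := by
      simp only [e]
      rw [Complex.exp_sub, Complex.exp_pi_mul_I]
      push_cast
      ring
    change Complex.exp (e x) ∈ ζ '' D
    rw [this]
    exact h1
  have de : ∀ x, HasDerivAt e 1 x := fun x => by
    exact ((hasDerivAt_id x).ofReal_comp).sub_const (Real.pi * Complex.I)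
  let E : ℝ → ℂ := fun x => edgeModulus u α x * Complex.exp (u * α * Real.pi / 2 * Complex.I)
  have hE0 : ∀ x, E x ≠ 0 := fun x =>
    mul_ne_zero (by exact_mod_cast (Real.exp_pos _).ne') (Complex.exp_ne_zero _)
  let q : ℝ → ℂ := fun x => W (e x) / E x
  have hq : Tendsto q atTop (𝓝 1) := by
    refine hW.2.congr fun x => ?_
    rw [lgApprox_lower hα]
  have hq' : Tendsto (fun x => W' (e x) / E x) atTop (𝓝 1) := by
    refine hW'.2.congr fun x => ?_
    rw [lgApprox_lower hα]
  have hqne : ∀ᶠ x in atTop, q x ≠ 0 := hq.eventually_ne one_ne_zero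
  have hyq : ∀ x, y (e x) = Complex.exp (-(e x) / 2) * (E x * q x) := fun x => by
    simp only [y, q]
    rw [mul_div_cancel₀ _ (hE0 x)]
  have hF : Tendsto (fun x => d (e x) / y (e x)) atTop (𝓝 0) := by
    have h1 : Tendsto (fun x => 1 - (W' (e x) / E x) / q x) atTop (𝓝 (1 - 1 / 1)) :=
      tendsto_const_nhds.sub (hq'.div hq one_ne_zero)
    rw [div_one, sub_self] at h1
    refine h1.congr' ?_
    filter_upwards [hqne] with x hx
    rw [hyq]
    have h2 : W (e x) = E x * q x := (mul_div_cancel₀ _ (hE0 x)).symm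
    simp only [d]
    rw [h2]
    have := hE0 x
    have := Complex.exp_ne_zero (-(e x) / 2)
    field_simp
    ring
  set C := wron y d (e 0) with hC
  have hwr : ∀ x, wron y d (e x) = C := fun x => hy.wron_eq hS hc hd (heS x) (heS 0)
  have hC0 : C = 0 := by
    by_contra hne
    let k : ℂ := -Complex.exp (u * α * Real.pi * Complex.I)
    have hk : k ≠ 0 := neg_ne_zero.2 (Complex.exp_ne_zero _)
    -- Along the edge y² is a fixed phase k times a bounded positive number times q² → 1.
    -- Multiplication by k/C therefore makes the real part of (d/y)' at least 1/(2M).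
    have hy2 : ∀ x, y (e x) ^ 2 =
        k * ((Real.exp (-x / 2) * edgeModulus u α x) ^ 2 : ℝ) * q x ^ 2 := fun x => by
      have e1 : Complex.exp (-(e x) / 2) = Complex.I * Real.exp (-x / 2) := by
        simp only [e]
        rw [show -(x - Real.pi * Complex.I : ℂ) / 2 =
          Real.pi / 2 * Complex.I + ((-x / 2 : ℝ) : ℂ) by push_cast; ring, Complex.exp_add,
          Complex.exp_pi_div_two_mul_I, Complex.ofReal_exp]
      have e2 : Complex.exp (u * α * Real.pi * Complex.I) =
          Complex.exp (u * α * Real.pi / 2 * Complex.I) ^ 2 := by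
        rw [← Complex.exp_nat_mul]; congr 1; push_cast; ring
      rw [hyq, e1]
      simp only [E, k]
      rw [e2]
      push_cast [Complex.ofReal_exp]
      have := Complex.I_sq
      linear_combination (Complex.exp (-x / 2) ^ 2 * (edgeModulus u α x : ℂ) ^ 2 *
        Complex.exp (u * α * Real.pi / 2 * Complex.I) ^ 2 * q x ^ 2) * this
    let M : ℝ := Real.exp (2 * u * α ^ 2) ^ 2
    have hM : 0 < M := by positivity
    have hqi : Tendsto (fun x => ((q x ^ 2)⁻¹).re) atTop (𝓝 1) := by
      have := ((hq.pow 2).inv₀ (by norm_num))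
      have h2 := (Complex.continuous_re.tendsto _).comp this
      rwa [one_pow, inv_one, Complex.one_re] at h2
    obtain ⟨X, hX⟩ := eventually_atTop.1 ((hqne.and (hqi.eventually_const_le
      (by norm_num : (1 / 2 : ℝ) < 1))).and (eventually_ge_atTop 0))
    let Φ : ℝ → ℝ := fun x => (k / C * (d (e x) / y (e x))).re
    have hΦd : ∀ x, X ≤ x → ∃ D', HasDerivAt Φ D' x ∧ 1 / 2 / M ≤ D' := by
      intro x hx
      obtain ⟨⟨hq0, hq2⟩, hx0⟩ := hX x hx
      have hy0 : y (e x) ≠ 0 := by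
        rw [hyq]
        exact mul_ne_zero (Complex.exp_ne_zero _) (mul_ne_zero (hE0 x) hq0)
      have d1 : HasDerivAt (fun s => d s / y s) (C / y (e x) ^ 2) (e x) := by
        convert! (hd _ (heS x)).1.hasDerivAt.div (hy _ (heS x)).1.hasDerivAt hy0 using 1
        rw [← hwr x, wron]
        ring
      have d2 : HasDerivAt (fun x => k / C * (d (e x) / y (e x)))
          (k / C * (C / y (e x) ^ 2)) x := by
        have := (d1.comp x (de x)).const_mul (k / C)
        simpa using this
      set H : ℝ := (Real.exp (-x / 2) * edgeModulus u α x) ^ 2 with hH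
      have hHp : 0 < H := by
        have : 0 < edgeModulus u α x := Real.exp_pos _
        positivity
      have hHM : H ≤ M := by
        have : 0 < edgeModulus u α x := Real.exp_pos _
        have := edgeModulus_bound hα hu hx0
        simp only [H, M]
        gcongr
      refine ⟨_, Complex.reCLM.hasFDerivAt.comp_hasDerivAt x d2, ?_⟩
      have e3 : k / C * (C / y (e x) ^ 2) = ((H⁻¹ : ℝ) : ℂ) * (q x ^ 2)⁻¹ := by
        rw [hy2 x, ← hH]
        have : (H : ℂ) ≠ 0 := by exact_mod_cast hHp.ne'
        push_cast
        field_simp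
      rw [e3, Complex.reCLM_apply, Complex.re_ofReal_mul, div_eq_mul_inv, mul_comm]
      have : M⁻¹ ≤ H⁻¹ := inv_anti₀ hHp hHM
      exact mul_le_mul this hq2 (by norm_num) (inv_pos.2 hHp).le
    have hΦ0 : Tendsto Φ atTop (𝓝 0) := by
      have := (Complex.continuous_re.tendsto _).comp (hF.const_mul (k / C))
      rwa [mul_zero, Complex.zero_re] at this
    have hgrow := (convex_Ici X).mul_sub_le_image_sub_of_le_deriv (f := Φ) (C := 1 / 2 / M)
      (fun x hx => by
        obtain ⟨D', h1, -⟩ := hΦd x hx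
        exact h1.continuousAt.continuousWithinAt)
      (fun x hx => by
        obtain ⟨D', h1, -⟩ := hΦd x (interior_subset hx)
        exact h1.differentiableAt.differentiableWithinAt)
      (fun x hx => by
        obtain ⟨D', h1, h2⟩ := hΦd x (interior_subset hx)
        rwa [h1.deriv])
    obtain ⟨x, hx1, hx2, hx3⟩ := ((hΦ0.eventually_lt_const one_pos).and
      ((eventually_ge_atTop X).and (eventually_ge_atTop (X + (1 - Φ X) / (1 / 2 / M))))).exists
    have h4 := hgrow X self_mem_Ici x hx2 hx2
    have h5 : (1 - Φ X) / (1 / 2 / M) ≤ x - X := by linarith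
    rw [div_le_iff₀ (by positivity)] at h5
    linarith
  obtain ⟨a, b, hab, hz⟩ := hy.exists_dependent hS hc hd (heS 0) hC0
  have hF0 : Tendsto (fun x => a + b * (d (e x) / y (e x))) atTop (𝓝 (a + b * 0)) :=
    tendsto_const_nhds.add (hF.const_mul b)
  have ha : a = 0 := by
    have h0 : (fun x => a + b * (d (e x) / y (e x))) =ᶠ[atTop] fun _ => 0 := by
      filter_upwards [hqne] with x hq0
      have hy0 : y (e x) ≠ 0 := by
        rw [hyq]
        exact mul_ne_zero (Complex.exp_ne_zero _) (mul_ne_zero (hE0 x) hq0)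
      have := hz _ (heS x)
      field_simp
      rw [this, mul_zero]
    have := tendsto_nhds_unique (hF0.congr' h0) tendsto_const_nhds
    simpa using this
  have hb : b ≠ 0 := fun hb => hab ⟨ha, hb⟩
  intro s hs
  have := hz s hs
  rw [ha, zero_mul, zero_add, mul_eq_zero, or_iff_right hb] at this
  simp only [d] at this
  rw [mul_eq_zero, or_iff_right (Complex.exp_ne_zero _)] at this
  linear_combination -this

theorem IsLG1.shift_eq (h : IsSetting D f g ζ α) (hα : 0 ≤ α) (hu : 0 < u)
    (h₁ : IsLG1 D g ζ u α W₁) (h₂ : IsLG2 D g ζ u α W₂) {s : ℂ} (hs : s ∈ logSurface D ζ) :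
    W₁ (s + 2 * Real.pi * Complex.I) =
      Complex.exp (-(u * α * Real.pi * Complex.I)) * W₂ s := by
  have := IsLG2.unique h hα hu h₂ (h₁.shift (h.isOpen_logSurface hα) hα) hs
  rw [← this, ← mul_assoc, ← Complex.exp_add]
  simp

theorem IsLG1.unique (h : IsSetting D f g ζ α) (hα : 0 ≤ α) (hu : 0 < u)
    (hW : IsLG1 D g ζ u α W) (hW' : IsLG1 D g ζ u α W') : EqOn W' W (logSurface D ζ) := by
  intro s hs
  have hS := h.isOpen_logSurface hα
  have h2 := hW.shift hS hα
  have hs' : s + -(2 * Real.pi * Complex.I) ∈ logSurface D ζ :=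
    (add_mem_logSurface (by rw [Complex.exp_neg, Complex.exp_two_pi_mul_I, inv_one])).2 hs
  have e1 := hW.shift_eq h hα hu h2 hs'
  have e2 := hW'.shift_eq h hα hu h2 hs'
  rw [neg_add_cancel_right] at e1 e2
  rw [e1, e2]

/-- When the whole integral is small, W₂ keeps its Liouville-Green form, with |v - 1| ≤ 1/3, back to
the start of the path. It is dominant there and W₁ recessive, so no nontrivial relation can hold. -/
theorem linIndepOn_of_small (h : IsSetting D f g ζ α) (hα : 0 ≤ α) (hL : IsLGPath D ζ α L)
    (hint : MeasureTheory.Integrable (lgIntegrand D f g ζ α L 1)) (hu : 0 < u)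
    (hsmall : ∫ t, lgIntegrand D f g ζ α L 1 t ≤ u / 8) (h₁ : IsLG1 D g ζ u α W₁)
    (h₂ : IsLG2 D g ζ u α W₂) : LinIndepOn (logSurface D ζ) W₁ W₂ := by
  obtain ⟨W, hW, v, hWv, hv⟩ := exists_isLG2_path h hα hL hint hu isOpen_univ ordConnected_univ
    (Eventually.of_forall fun _ => mem_univ _) (by rwa [MeasureTheory.setIntegral_univ])
  intro a b hab
  have hlow : ∀ᶠ t in atBot, L t = ((L t).re : ℂ) + Real.pi * Complex.I := by
    filter_upwards [hL.start_edge] with t ht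
    exact Complex.ext (by simp) (by simpa using ht)
  have hq : Tendsto (fun t => W₁ (L t) / (lgFactor α (L t) *
      Complex.exp (-u * lgXi α (L t) - Real.pi * Complex.I / 4))) atBot (𝓝 1) := by
    refine (h₁.2.comp hL.start_infty).congr' ?_
    filter_upwards [hlow] with t ht
    simp only [Function.comp_apply]
    rw [← ht]
  have hexp : Tendsto (fun t => Complex.exp (-2 * u * lgXi α (L t))) atBot (𝓝 0) := by
    rw [tendsto_zero_iff_norm_tendsto_zero]
    have h1 : Tendsto (fun t => Real.exp (-(2 * u * edgeRho α (L t).re))) atBot (𝓝 0) := by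
      refine Real.tendsto_exp_neg_atTop_nhds_zero.comp ?_
      refine Tendsto.const_mul_atTop (by positivity) ?_
      have h2 : Tendsto (fun x : ℝ => Real.exp (x / 2) - 2 * α ^ 2) atTop atTop :=
        tendsto_atTop_add_const_right _ _
          (Real.tendsto_exp_atTop.comp (tendsto_id.atTop_div_const (by norm_num)))
      have h3 : Tendsto (edgeRho α) atTop atTop := by
        refine tendsto_atTop_mono' _ ?_ h2
        filter_upwards [eventually_ge_atTop 0] with x hx using le_edgeRho hα hx
      exact h3.comp hL.start_infty
    refine h1.congr' ?_
    filter_upwards [hlow] with t ht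
    rw [Complex.norm_exp, ht, lgXi_upper hα]
    congr 1
    simp
  -- This is the relation divided by the modulating factor of W₂. At the start the left side tends
  -- to 0, whereas |v| ≥ 2/3 on the right, so b = 0.
  have hrel : ∀ t, a * (Complex.exp (-2 * u * lgXi α (L t)) *
      Complex.exp (-(Real.pi * Complex.I / 4)) * (W₁ (L t) / (lgFactor α (L t) *
      Complex.exp (-u * lgXi α (L t) - Real.pi * Complex.I / 4)))) =
      -(b * Complex.exp (Real.pi * Complex.I / 4) * v t) := fun t => by
    have e1 := hab _ (hL.mem t)
    rw [IsLG2.unique h hα hu hW h₂ (hL.mem t), hWv t (mem_univ _)] at e1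
    have n1 := lgFactor_ne_zero hα (hL.mem_cutStrip t)
    have n2 := Complex.exp_ne_zero (u * lgXi α (L t))
    have n3 := Complex.exp_ne_zero (Real.pi * Complex.I / 4)
    have x1 : Complex.exp (-2 * u * lgXi α (L t)) = (Complex.exp (u * lgXi α (L t)) ^ 2)⁻¹ := by
      rw [← Complex.exp_nat_mul, ← Complex.exp_neg]; congr 1; push_cast; ring
    have x2 : Complex.exp (-u * lgXi α (L t) - Real.pi * Complex.I / 4) =
        (Complex.exp (u * lgXi α (L t)))⁻¹ * (Complex.exp (Real.pi * Complex.I / 4))⁻¹ := by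
      rw [← Complex.exp_neg, ← Complex.exp_neg, ← Complex.exp_add]; congr 1; ring
    rw [x1, x2, Complex.exp_neg]
    rw [Complex.exp_add] at e1
    generalize Complex.exp (u * lgXi α (L t)) = p at *
    generalize Complex.exp (Real.pi * Complex.I / 4) = r at *
    field_simp
    linear_combination e1
  have hb : b = 0 := by
    have hlim : Tendsto (fun t => -(b * Complex.exp (Real.pi * Complex.I / 4) * v t)) atBot
        (𝓝 0) := by
      have := (((hexp.mul_const (Complex.exp (-(Real.pi * Complex.I / 4)))).mul hq).const_mul a)
      simp only [zero_mul, mul_zero] at this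
      exact this.congr hrel
    by_contra hb
    have hlim2 := hlim.norm
    rw [norm_zero] at hlim2
    have hpos : 0 < ‖b‖ * (2 / 3) := mul_pos (norm_pos_iff.2 hb) (by norm_num)
    obtain ⟨t, ht⟩ := (hlim2.eventually_lt_const hpos).exists
    have hn : ‖Complex.exp (Real.pi * Complex.I / 4)‖ = 1 := by
      rw [Complex.norm_exp]; simp
    rw [norm_neg, norm_mul, norm_mul, hn, mul_one] at ht
    have h1 : 2 / 3 ≤ ‖v t‖ := by
      have := norm_sub_norm_le (1 : ℂ) (1 - v t)
      rw [norm_one, sub_sub_cancel, norm_sub_rev] at this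
      linarith [hv t]
    exact absurd ht (not_lt.2 (mul_le_mul_of_nonneg_left h1 (norm_nonneg _)))
  refine ⟨?_, hb⟩
  obtain ⟨t, ht⟩ := (hq.eventually_ne one_ne_zero).exists
  have h0 := hab _ (hL.mem t)
  rw [hb, zero_mul, add_zero, mul_eq_zero] at h0
  rcases h0 with h0 | h0
  · exact h0
  · simp [h0] at ht

end Solutions

/-! ### Frobenius solutions -/

/-- The coefficients of the Frobenius series with exponent `ρ` for `y'' = (ρ² + ζ r(ζ)) y`,
`ζ = e^s`, where `r = ∑ q_j ζ^j`. -/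
noncomputable def frobCoeff (q : ℕ → ℂ) (ρ : ℂ) : ℕ → ℂ
  | 0 => 1
  | n + 1 => (∑ j : Fin (n + 1), q (n - j) * frobCoeff q ρ j) / ((n + 1) * (n + 1 + 2 * ρ))

theorem frobCoeff_succ (q : ℕ → ℂ) (ρ : ℂ) (n : ℕ) : frobCoeff q ρ (n + 1) =
    (∑ j ∈ Finset.range (n + 1), frobCoeff q ρ j * q (n - j)) /
      ((n + 1) * (n + 1 + 2 * ρ)) := by
  rw [frobCoeff, Finset.sum_range]
  congr 1
  exact Finset.sum_congr rfl fun j _ => mul_comm _ _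

/-- The factors |n + 1 + 2ρ| tend to infinity, so their minimum is attained, and it is positive by
non-resonance. -/
theorem exists_lower_bound_nonresonant {ρ : ℂ} (hρ : ∀ k : ℕ, 1 ≤ k → (k : ℂ) + 2 * ρ ≠ 0) :
    ∃ δ : ℝ, 0 < δ ∧ ∀ n : ℕ, δ ≤ ‖((n : ℂ) + 1) * (n + 1 + 2 * ρ)‖ := by
  have ht : Tendsto (fun n : ℕ => ‖(n : ℂ) + 1 + 2 * ρ‖) cofinite atTop := by
    rw [Nat.cofinite_eq_atTop]
    have h1 : Tendsto (fun n : ℕ => (n : ℝ) + (1 - ‖2 * ρ‖)) atTop atTop :=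
      tendsto_atTop_add_const_right _ _ tendsto_natCast_atTop_atTop
    refine tendsto_atTop_mono (fun n => ?_) h1
    have h2 : ‖(n : ℂ) + 1‖ = n + 1 := by
      have : (n : ℂ) + 1 = ((n + 1 : ℕ) : ℂ) := by push_cast; rfl
      rw [this, Complex.norm_natCast]; push_cast; rfl
    have h3 := norm_sub_norm_le ((n : ℂ) + 1) (-(2 * ρ))
    rw [norm_neg, sub_neg_eq_add, h2] at h3
    linarith
  obtain ⟨n₀, hn₀⟩ := ht.exists_forall_le
  have hpos : 0 < ‖(n₀ : ℂ) + 1 + 2 * ρ‖ := by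
    rw [norm_pos_iff]
    simpa using hρ (n₀ + 1) (by omega)
  refine ⟨_, hpos, fun n => ?_⟩
  have h2 : ‖(n : ℂ) + 1‖ = n + 1 := by
    have : (n : ℂ) + 1 = ((n + 1 : ℕ) : ℂ) := by push_cast; rfl
    rw [this, Complex.norm_natCast]; push_cast; rfl
  rw [norm_mul, h2]
  have h3 := hn₀ n
  have h4 : (0 : ℝ) ≤ n := Nat.cast_nonneg n
  nlinarith [norm_nonneg ((n : ℂ) + 1 + 2 * ρ)]

/-- A majorant with ratio B, twice the ratio in the bound for q, makes the convolution at most M Bⁿ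
∑ 2^{-j} ≤ 2M Bⁿ. The condition 2M ≤ δB closes the induction. -/
theorem norm_frobCoeff_le {q : ℕ → ℂ} {ρ : ℂ} {δ M B : ℝ} (hδ : 0 < δ) (hM : 0 ≤ M)
    (hρ : ∀ n : ℕ, δ ≤ ‖((n : ℂ) + 1) * (n + 1 + 2 * ρ)‖) (hB : 0 ≤ B)
    (hq : ∀ n, ‖q n‖ ≤ M * (B / 2) ^ n) (hMB : 2 * M ≤ δ * B) (n : ℕ) :
    ‖frobCoeff q ρ n‖ ≤ B ^ n := by
  induction n using Nat.strong_induction_on with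
  | _ n ih =>
    cases n with
    | zero => simp [frobCoeff]
    | succ n =>
      rw [frobCoeff_succ, norm_div, div_le_iff₀ (hδ.trans_le (hρ n))]
      have hgeo : ∑ j ∈ Finset.range (n + 1), (1 / 2 : ℝ) ^ (n - j) ≤ 2 := by
        rw [← Finset.sum_range_reflect]
        refine (Finset.sum_le_sum fun j hj => ?_).trans
          ((summable_geometric_two).sum_le_tsum (Finset.range (n + 1))
            (fun _ _ => by positivity) |>.trans_eq tsum_geometric_two)
        have : j < n + 1 := Finset.mem_range.1 hj
        rw [show n - (n + 1 - 1 - j) = j by omega]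
      calc ‖∑ j ∈ Finset.range (n + 1), frobCoeff q ρ j * q (n - j)‖
          ≤ ∑ j ∈ Finset.range (n + 1), M * B ^ n * (1 / 2 : ℝ) ^ (n - j) := by
            refine norm_sum_le_of_le _ fun j hj => ?_
            have hj' : j < n + 1 := Finset.mem_range.1 hj
            rw [norm_mul]
            refine (mul_le_mul (ih j hj') (hq (n - j)) (norm_nonneg _) (by positivity)).trans
              (le_of_eq ?_)
            have : B ^ n = B ^ j * B ^ (n - j) := by rw [← pow_add]; congr 1; omega
            rw [this, div_pow, div_pow, one_pow]
            ring
        _ ≤ M * B ^ n * 2 := by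
            rw [← Finset.mul_sum]
            exact mul_le_mul_of_nonneg_left hgeo (by positivity)
        _ ≤ B ^ (n + 1) * δ := by
            rw [pow_succ]
            nlinarith [pow_nonneg hB n]
        _ ≤ _ := mul_le_mul_of_nonneg_left (hρ n) (by positivity)

/-- Frobenius series: existence for a non-resonant exponent. -/
theorem exists_frobenius_series {r : ℂ → ℂ} (hr : AnalyticAt ℂ r 0) {ρ : ℂ}
    (hρ : ∀ k : ℕ, 1 ≤ k → (k : ℂ) + 2 * ρ ≠ 0) :
    ∃ V : ℂ → ℂ, AnalyticAt ℂ V 0 ∧ V 0 = 1 ∧ ∃ ε > 0,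
      SolvesOn (fun s => ρ ^ 2 + Complex.exp s * r (Complex.exp s)) {s | ‖Complex.exp s‖ < ε}
        (fun s => Complex.exp (ρ * s) * V (Complex.exp s)) := by
  obtain ⟨p, hp⟩ := hr
  rw [hasFPowerSeriesAt_iff] at hp
  simp only [zero_add, smul_eq_mul] at hp
  obtain ⟨ε₀, hε₀, hsum⟩ := Metric.eventually_nhds_iff.1 hp
  simp only [dist_zero_right] at hsum
  set q : ℕ → ℂ := p.coeff
  obtain ⟨δ, hδ, hδn⟩ := exists_lower_bound_nonresonant hρ
  set a : ℝ := ε₀ / 2 with ha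
  have hap : 0 < a := by positivity
  have hs₀ : Summable fun n => (a : ℂ) ^ n * q n :=
    (hsum (by rw [Complex.norm_real, Real.norm_of_nonneg hap.le]; linarith)).summable
  obtain ⟨M, hM⟩ : ∃ M : ℝ, ∀ n, ‖(a : ℂ) ^ n * q n‖ ≤ M := by
    obtain ⟨M, hM⟩ := hs₀.tendsto_atTop_zero.norm.bddAbove_range
    exact ⟨M, fun n => hM ⟨n, rfl⟩⟩
  have hM0 : 0 ≤ M := (norm_nonneg _).trans (hM 0)
  -- The first summand makes (B/2)ⁿ dominate a^{-n} and thus the coefficients q; the second gives 2M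
  -- ≤ δB.
  set B : ℝ := 2 / a + 2 * M / δ with hB
  have hB0 : 0 < B := by positivity
  have hqB : ∀ n, ‖q n‖ ≤ M * (B / 2) ^ n := fun n => by
    have h1 := hM n
    rw [norm_mul, norm_pow, Complex.norm_real, Real.norm_of_nonneg hap.le] at h1
    have h2 : ‖q n‖ ≤ M * (1 / a) ^ n := by
      rw [one_div, inv_pow, ← div_eq_mul_inv, le_div_iff₀ (by positivity)]
      linarith
    refine h2.trans (mul_le_mul_of_nonneg_left (pow_le_pow_left₀ (by positivity) ?_ n) hM0)
    have : 0 ≤ 2 * M / δ := by positivity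
    rw [hB]
    have h4 : 2 / a = 2 * (1 / a) := by ring
    linarith
  have hMB : 2 * M ≤ δ * B := by
    have : δ * B = δ * (2 / a) + 2 * M := by rw [hB]; field_simp
    rw [this]
    have : 0 ≤ δ * (2 / a) := by positivity
    linarith
  set v : ℕ → ℂ := frobCoeff q ρ with hv
  have hvB : ∀ n, ‖v n‖ ≤ B ^ n := norm_frobCoeff_le hδ hM0 hδn hB0.le hqB hMB
  set ε : ℝ := min ε₀ (1 / (2 * B)) with hε
  have hεp : 0 < ε := lt_min hε₀ (by positivity)
  have hterm : ∀ w : ℂ, ‖w‖ < ε → ∀ n, ‖v n * w ^ n‖ ≤ (1 / 2 : ℝ) ^ n := by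
    intro w hw n
    have h1 : B * ‖w‖ ≤ 1 / 2 := by
      have : ‖w‖ ≤ 1 / (2 * B) := hw.le.trans (min_le_right _ _)
      calc B * ‖w‖ ≤ B * (1 / (2 * B)) := by gcongr
        _ = 1 / 2 := by field_simp
    rw [norm_mul, norm_pow]
    calc ‖v n‖ * ‖w‖ ^ n ≤ B ^ n * ‖w‖ ^ n := by gcongr; exact hvB n
      _ = (B * ‖w‖) ^ n := (mul_pow _ _ _).symm
      _ ≤ _ := pow_le_pow_left₀ (by positivity) h1 n
  have hgeo : ∀ k : ℕ, Summable fun n : ℕ => (n : ℝ) ^ k * (1 / 2 : ℝ) ^ n := fun k =>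
    summable_pow_mul_geometric_of_norm_lt_one k (by norm_num)
  let U : Set ℂ := {s | ‖Complex.exp s‖ < ε}
  have hUre : U = {s | s.re < Real.log ε} := by
    ext s
    simp only [U, mem_ofPred_eq, Complex.norm_exp]
    rw [Real.lt_log_iff_exp_lt hεp]
  have hUo : IsOpen U := isOpen_lt (Complex.continuous_exp.norm) continuous_const
  have hUc : IsPreconnected U := by
    rw [hUre]
    exact (convex_halfSpace_re_lt _).isPreconnected
  -- G k is the k-th s-derivative of V(e^s), since d/ds multiplies the n-th term by n. The equation
  -- becomes G₂ + 2ρG₁ = ζ r G₀, a Cauchy product that encodes the recursion.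
  let G : ℕ → ℂ → ℂ := fun k s => ∑' n : ℕ, (n : ℂ) ^ k * (v n * Complex.exp s ^ n)
  have hGn : ∀ (k : ℕ) (s : ℂ), s ∈ U → ∀ n : ℕ,
      ‖(n : ℂ) ^ k * (v n * Complex.exp s ^ n)‖ ≤ (n : ℝ) ^ k * (1 / 2 : ℝ) ^ n := by
    intro k s hs n
    rw [norm_mul, norm_pow, Complex.norm_natCast]
    exact mul_le_mul_of_nonneg_left (hterm _ hs n) (by positivity)
  have hGs : ∀ (k : ℕ) (s : ℂ), s ∈ U →
      Summable fun n : ℕ => (n : ℂ) ^ k * (v n * Complex.exp s ^ n) := fun k s hs =>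
    Summable.of_norm_bounded (hgeo k) (hGn k s hs)
  have hGd : ∀ (k : ℕ) (s : ℂ), s ∈ U → HasDerivAt (G k) (G (k + 1) s) s := by
    intro k s hs
    refine hasDerivAt_tsum_of_isPreconnected (hgeo (k + 1)) hUo hUc
      (g' := fun (n : ℕ) (s : ℂ) => (n : ℂ) ^ (k + 1) * (v n * Complex.exp s ^ n))
      (fun n t ht => ?_) (fun n t ht => hGn (k + 1) t ht n) hs (hGs k s hs) hs
    have h1 : HasDerivAt (fun s => Complex.exp s ^ n) (n * Complex.exp t ^ n) t := by
      have : (fun s => Complex.exp s ^ n) = fun s => Complex.exp (n * s) :=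
        funext fun s => (Complex.exp_nat_mul s n).symm
      rw [this, ← Complex.exp_nat_mul]
      convert! ((hasDerivAt_id t).const_mul (n : ℂ)).cexp using 1
      simp [mul_comm]
    convert! (h1.const_mul (v n)).const_mul ((n : ℂ) ^ k) using 1
    ring
  have hode : ∀ s ∈ U, G 2 s + 2 * ρ * G 1 s = Complex.exp s * r (Complex.exp s) * G 0 s := by
    intro s hs
    set w := Complex.exp s
    have hw : ‖w‖ < ε := hs
    have hrs := hsum (hw.trans_le (min_le_left _ _))
    have h0 : G 0 s = ∑' n, v n * w ^ n := by simp [G, w]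
    have hs0 : Summable fun n => ‖v n * w ^ n‖ :=
      Summable.of_nonneg_of_le (fun _ => norm_nonneg _) (hterm w hw) summable_geometric_two
    have hL : G 2 s + 2 * ρ * G 1 s =
        ∑' n : ℕ, ((n : ℂ) * (n + 2 * ρ)) * (v n * w ^ n) := by
      simp only [G]
      rw [← tsum_mul_left, ← (hGs 2 s hs).tsum_add ((hGs 1 s hs).mul_left _)]
      congr 1
      funext n
      ring
    have hLs : Summable fun n : ℕ => ((n : ℂ) * (n + 2 * ρ)) * (v n * w ^ n) := by
      refine ((hGs 2 s hs).add ((hGs 1 s hs).mul_left (2 * ρ))).congr fun n => ?_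
      simp only [w]
      ring
    have hR : r w * G 0 s = ∑' n : ℕ, ∑ j ∈ Finset.range (n + 1),
        (v j * w ^ j) * (w ^ (n - j) * q (n - j)) := by
      rw [h0, ← hrs.tsum_eq, mul_comm]
      exact tsum_mul_tsum_eq_tsum_sum_range_of_summable_norm hs0 hrs.summable.norm
    rw [hL, hLs.tsum_eq_zero_add, mul_assoc w, hR, ← tsum_mul_left]
    simp only [Nat.cast_zero, zero_mul, zero_add]
    congr 1
    funext n
    have hne : ((n : ℂ) + 1) * (n + 1 + 2 * ρ) ≠ 0 := norm_pos_iff.1 (hδ.trans_le (hδn n))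
    have hvn : ((n : ℂ) + 1) * (n + 1 + 2 * ρ) * v (n + 1) =
        ∑ j ∈ Finset.range (n + 1), v j * q (n - j) := by
      rw [hv, frobCoeff_succ]
      exact mul_div_cancel₀ _ hne
    push_cast
    rw [← mul_assoc, hvn, Finset.sum_mul, Finset.mul_sum]
    refine Finset.sum_congr rfl fun j hj => ?_
    have hj' : j < n + 1 := Finset.mem_range.1 hj
    have : w ^ (n + 1) = w * (w ^ j * w ^ (n - j)) := by
      rw [← pow_add, pow_succ, mul_comm]; congr 2; omega
    rw [this]
    ring
  let V : ℂ → ℂ := fun w => ∑' n : ℕ, v n * w ^ n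
  have hVG : ∀ s, V (Complex.exp s) = G 0 s := fun s => by simp [V, G]
  refine ⟨V, ?_, ?_, ε, hεp, ?_⟩
  · have hd : DifferentiableOn ℂ V (Metric.ball 0 ε) :=
      Complex.differentiableOn_tsum_of_summable_norm summable_geometric_two
        (fun n => by fun_prop) Metric.isOpen_ball
        (fun n w hw => hterm w (by simpa using hw) n)
    exact hd.analyticAt (Metric.ball_mem_nhds 0 hεp)
  · simp only [V]
    rw [tsum_eq_single 0]
    · simp [hv, frobCoeff]
    · intro n hn
      simp [hn]
  · have hexp : ∀ s, HasDerivAt (fun s => Complex.exp (ρ * s)) (Complex.exp (ρ * s) * ρ) s :=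
      fun s => by simpa using ((hasDerivAt_id s).const_mul ρ).cexp
    have e : (fun s => Complex.exp (ρ * s) * V (Complex.exp s)) =
        fun s => Complex.exp (ρ * s) * G 0 s := funext fun s => by rw [hVG]
    rw [e]
    refine solvesOn_of_hasDerivAt hUo
      (y' := fun s => Complex.exp (ρ * s) * (ρ * G 0 s + G 1 s)) (fun s hs => ?_) (fun s hs => ?_)
    · convert! (hexp s).mul (hGd 0 s hs) using 1
      ring
    · convert! (hexp s).mul (((hGd 0 s hs).const_mul ρ).add (hGd 1 s hs)) using 1
      simp only [Pi.add_apply]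
      have := hode s hs
      linear_combination (-Complex.exp (ρ * s)) * this

/-! ### Frobenius solutions on the whole surface and their monodromy. -/

section Frobenius

variable {D : Set ℂ} {f g ζ : ℂ → ℂ} {u α : ℝ} {W W' W₁ W₂ : ℂ → ℂ}

theorem eventually_punctured_iff {P : ℂ → Prop} :
    (∀ᶠ x in 𝓝[≠] (0 : ℂ), ∀ s : ℂ, Complex.exp s = x → P s) ↔
      ∃ ε > 0, ∀ s, ‖Complex.exp s‖ < ε → P s := by
  rw [eventually_nhdsWithin_iff, Metric.eventually_nhds_iff]
  refine exists_congr fun ε => and_congr_right fun _ => ⟨fun h s hs => ?_, fun h x hx _ s hs => ?_⟩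
  · exact h (by simpa using hs) (Complex.exp_ne_zero s) s rfl
  · exact h s (by rw [hs]; simpa using hx)

theorem IsSetting.exists_mem_logSurface (h : IsSetting D f g ζ α) (hα : 0 ≤ α) :
    ∃ ε > 0, ∀ s, ‖Complex.exp s‖ < ε → s ∈ logSurface D ζ := by
  obtain ⟨r, -, ε, hε, hr⟩ := h.exists_analyticAt_psiTilde hα
  exact ⟨ε, hε, fun s hs => (hr s hs).1⟩

theorem exists_frobenius_solution (h : IsSetting D f g ζ α) (hα : 0 ≤ α) {ρ : ℂ}
    (hρ2 : ρ ^ 2 = (u * α / 2) ^ 2) (hρ : ∀ k : ℕ, 1 ≤ k → (k : ℂ) + 2 * ρ ≠ 0) :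
    ∃ W, IsFrobenius D g ζ u α (ρ + 1 / 2) 1 W := by
  obtain ⟨r, hr, ε₁, hε₁, hrε⟩ := h.exists_analyticAt_psiTilde hα
  -- The term -u² ζ/4 of Q is absorbed into the analytic part, so only ρ² = (μ/2)² remains as the
  -- constant term.
  obtain ⟨V, hV, hV0, ε₂, hε₂, hsol⟩ := exists_frobenius_series
    (r := fun w => r w - (u : ℂ) ^ 2 / 4) (hr.sub analyticAt_const) hρ
  have hS := h.isOpen_logSurface hα
  set ε := min ε₁ ε₂ with hε
  have hεp : 0 < ε := lt_min hε₁ hε₂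
  let U : Set ℂ := {s | ‖Complex.exp s‖ < ε}
  have hUre : U = {s | s.re < Real.log ε} := by
    ext s
    simp only [U, mem_ofPred_eq, Complex.norm_exp]
    rw [Real.lt_log_iff_exp_lt hεp]
  have hUo : IsOpen U := isOpen_lt (Complex.continuous_exp.norm) continuous_const
  have hUc : IsPreconnected U := by
    rw [hUre]
    exact (convex_halfSpace_re_lt _).isPreconnected
  have hUS : U ⊆ logSurface D ζ := fun s hs => (hrε s (lt_of_lt_of_le hs (min_le_left _ _))).1
  let y₀ : ℂ → ℂ := fun s => Complex.exp (ρ * s) * V (Complex.exp s)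
  have hy₀ : SolvesOn (logCoeff D g ζ u α) U y₀ := fun s hs => by
    have hs' : ‖Complex.exp s‖ < ε := hs
    have hs₂ : ‖Complex.exp s‖ < ε₂ := hs'.trans_le (min_le_right _ _)
    obtain ⟨h1, h2⟩ := hsol s hs₂
    refine ⟨h1, ?_⟩
    convert! h2 using 2
    rw [logCoeff, (hrε s (lt_of_lt_of_le hs (min_le_left _ _))).2, hρ2]
    ring
  obtain ⟨φ, ψ, hφ, hψ, hw⟩ := exists_fundamental hS h.simplyConnected
    (h.differentiableOn_logCoeff hα u)
  obtain ⟨s₀, hs₀⟩ : U.Nonempty := ⟨((Real.log ε - 1 : ℝ) : ℂ), by rw [hUre]; simp⟩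
  -- On a left half-plane the series is a combination of a global fundamental pair, which continues
  -- it to the whole surface.
  obtain ⟨a, b, hab⟩ := (hφ.mono hUS).exists_eq_lin hUo hUc (hψ.mono hUS) hy₀ hs₀
    (by rw [hw s₀ (hUS hs₀)]; exact one_ne_zero)
  refine ⟨fun s => Complex.exp (s / 2) * (a * φ s + b * ψ s), ?_, V, hV, hV0, ?_⟩
  · rw [isSolution_iff hS]
    exact (hφ.lin hS hψ a b).congr hS fun s _ => exp_half_mul_cancel s _
  · have h3 := eventually_punctured_iff (P := fun s => Complex.exp (s / 2) * (a * φ s + b * ψ s) =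
      Complex.exp ((ρ + 1 / 2) * s) * V (Complex.exp s)).2 ⟨ε, hεp, fun s hs => by
        rw [← hab s hs]
        simp only [y₀]
        rw [← mul_assoc, ← Complex.exp_add]
        congr 2
        ring⟩
    refine h3.mono fun x hx s hs => ?_
    rw [← hs]
    exact hx s hs

theorem IsFrobenius.exists_eps {σ c : ℂ} (hW : IsFrobenius D g ζ u α σ c W) :
    ∃ V : ℂ → ℂ, AnalyticAt ℂ V 0 ∧ V 0 = c ∧ ∃ ε > 0, ∀ s, ‖Complex.exp s‖ < ε →
      W s = Complex.exp (σ * s) * V (Complex.exp s) := by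
  obtain ⟨-, V, hV, hVc, hev⟩ := hW
  exact ⟨V, hV, hVc, eventually_punctured_iff.1 (hev.mono fun x hx s hs => by rw [hx s hs, hs])⟩

theorem IsSolution.eqOn_of_small (h : IsSetting D f g ζ α) (hα : 0 ≤ α)
    (hW : IsSolution D g ζ u α W) (hW' : IsSolution D g ζ u α W') {ε : ℝ} (hε : 0 < ε)
    (he : ∀ s, ‖Complex.exp s‖ < ε → W s = W' s) : EqOn W W' (logSurface D ζ) := by
  have hS := h.isOpen_logSurface hα
  obtain ⟨ε', hε', hmem⟩ := h.exists_mem_logSurface hα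
  let s₀ : ℂ := ((Real.log (min ε ε') - 1 : ℝ) : ℂ)
  have hmin : 0 < min ε ε' := lt_min hε hε'
  have hs₀ : ‖Complex.exp s₀‖ < min ε ε' := by
    rw [Complex.norm_exp, Complex.ofReal_re, ← Real.lt_log_iff_exp_lt hmin]
    linarith
  have hev : ∀ᶠ s in 𝓝 s₀, ‖Complex.exp s‖ < ε :=
    (Complex.continuous_exp.norm.tendsto s₀).eventually_lt_const
      (hs₀.trans_le (min_le_left _ _))
  have := ((isSolution_iff hS).1 hW).eqOn_of_eventuallyEq hS h.isPreconnected_logSurface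
    ((isSolution_iff hS).1 hW') (hmem s₀ (hs₀.trans_le (min_le_right _ _)))
    (hev.mono fun s hs => by simp only [he s hs])
  intro s hs
  exact mul_left_cancel₀ (Complex.exp_ne_zero (-s / 2)) (this hs)

/-- V is single-valued, so only the power ζ^σ changes under continuation. The relation near ζ = 0
extends because both sides are solutions. -/
theorem IsFrobenius.monodromy {σ c : ℂ} (h : IsSetting D f g ζ α) (hα : 0 ≤ α)
    (hW : IsFrobenius D g ζ u α σ c W) {s : ℂ} (hs : s ∈ logSurface D ζ) :
    W (s + 2 * Real.pi * Complex.I) = Complex.exp (2 * Real.pi * Complex.I * σ) * W s := by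
  have hS := h.isOpen_logSurface hα
  obtain ⟨V, -, -, ε, hε, he⟩ := hW.exists_eps
  have h1 := hW.1.shift hS Complex.exp_two_pi_mul_I 1
  have h2 := hW.1.lin hS hW.1 (Complex.exp (2 * Real.pi * Complex.I * σ)) 0
  have := IsSolution.eqOn_of_small h hα h1 h2 hε (fun s hs => by
    have e1 : Complex.exp (s + 2 * Real.pi * Complex.I) = Complex.exp s := by
      rw [Complex.exp_add, Complex.exp_two_pi_mul_I, mul_one]
    rw [he s hs, he (s + 2 * Real.pi * Complex.I) (by rwa [e1]), e1, mul_add, Complex.exp_add]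
    rw [show σ * (2 * Real.pi * Complex.I) = 2 * Real.pi * Complex.I * σ by ring]
    ring) hs
  simpa using this

/-- Solutions that are multiplied by a constant on continuation around `ζ = 0`. -/
theorem exists_eq_of_monodromy (h : IsSetting D f g ζ α) (hα : 0 ≤ α) (hu : 0 < u)
    (h₁ : IsLG1 D g ζ u α W₁) (h₂ : IsLG2 D g ζ u α W₂)
    (hind : LinIndepOn (logSurface D ζ) W₁ W₂) (hW : IsSolution D g ζ u α W) {κ : ℂ}
    (hκ : ∀ s ∈ logSurface D ζ, W (s + 2 * Real.pi * Complex.I) = -κ * W s) :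
    ∃ a : ℂ, ∀ s ∈ logSurface D ζ,
      W s = a * (W₁ s + κ * Complex.exp (-(u * α * Real.pi * Complex.I)) * W₂ s) := by
  have hS := h.isOpen_logSurface hα
  have hc := h.isPreconnected_logSurface
  set S := logSurface D ζ
  set τ : ℂ := 2 * Real.pi * Complex.I with hτ
  have hτ1 : Complex.exp τ = 1 := Complex.exp_two_pi_mul_I
  have hSτ : ∀ s ∈ S, s + τ ∈ S := fun s hs => (add_mem_logSurface hτ1).2 hs
  set Λ := Complex.exp (-(u * α * Real.pi * Complex.I)) with hΛ
  have hΛ0 : Λ ≠ 0 := Complex.exp_ne_zero _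
  let y₁ : ℂ → ℂ := fun s => Complex.exp (-s / 2) * W₁ s
  let y₂ : ℂ → ℂ := fun s => Complex.exp (-s / 2) * W₂ s
  let y : ℂ → ℂ := fun s => Complex.exp (-s / 2) * W s
  have hy₁ : SolvesOn (logCoeff D g ζ u α) S y₁ := (isSolution_iff hS).1 h₁.1
  have hy₂ : SolvesOn (logCoeff D g ζ u α) S y₂ := (isSolution_iff hS).1 h₂.1
  have hy : SolvesOn (logCoeff D g ζ u α) S y := (isSolution_iff hS).1 hW
  -- The factor ζ^{-1/2} changes sign around the origin, which explains the minus sign in the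
  -- multiplier -κ of W.
  have hexp : ∀ s : ℂ, Complex.exp (-(s + τ) / 2) = -Complex.exp (-s / 2) := fun s => by
    rw [show -(s + τ) / 2 = -s / 2 - Real.pi * Complex.I by rw [hτ]; ring, Complex.exp_sub,
      Complex.exp_pi_mul_I]
    ring
  have sh₁ : ∀ s ∈ S, y₁ (s + τ) = -Λ * y₂ s := fun s hs => by
    simp only [y₁, y₂]
    rw [hexp, h₁.shift_eq h hα hu h₂ hs]
    ring
  have shy : ∀ s ∈ S, y (s + τ) = κ * y s := fun s hs => by
    simp only [y]
    rw [hexp, hκ s hs]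
    ring
  obtain ⟨s₀, hs₀⟩ := h.simplyConnected.nonempty
  have hw : wron y₁ y₂ s₀ ≠ 0 := fun h0 => by
    obtain ⟨a, b, hab, hz⟩ := hy₁.exists_dependent hS hc hy₂ hs₀ h0
    refine hab (hind a b fun s hs => ?_)
    have := hz s hs
    simp only [y₁, y₂] at this
    refine mul_left_cancel₀ (Complex.exp_ne_zero (-s / 2)) ?_
    linear_combination this
  have hτy₂ := hy₂.shift (τ := τ) hSτ (logCoeff_add D g ζ u α hτ1)
  obtain ⟨A, B, hAB⟩ := hy₁.exists_eq_lin hS hc hy₂ hτy₂ hs₀ hw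
  obtain ⟨a, b, hab⟩ := hy₁.exists_eq_lin hS hc hy₂ hy hs₀ hw
  -- The Wronskian at s₀ + 2πi is computed from the translated pair as ΛA times its value at s₀. It
  -- is also constant, so the monodromy has determinant one.
  have hA : Λ * A = 1 := by
    have e1 : wron y₁ y₂ (s₀ + τ) = Λ * A * wron y₁ y₂ s₀ := by
      have d1 : deriv y₁ (s₀ + τ) = -Λ * deriv y₂ s₀ := by
        rw [← deriv_comp_add_const]
        have : (fun s => y₁ (s + τ)) =ᶠ[𝓝 s₀] fun s => -Λ * y₂ s := by
          filter_upwards [hS.mem_nhds hs₀] with s hs using sh₁ s hs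
        rw [this.deriv_eq]
        exact ((hy₂ s₀ hs₀).1.hasDerivAt.const_mul _).deriv
      have d2 : deriv y₂ (s₀ + τ) = A * deriv y₁ s₀ + B * deriv y₂ s₀ := by
        rw [← deriv_comp_add_const]
        have : (fun s => y₂ (s + τ)) =ᶠ[𝓝 s₀] fun s => A * y₁ s + B * y₂ s := by
          filter_upwards [hS.mem_nhds hs₀] with s hs using hAB s hs
        rw [this.deriv_eq]
        exact hy₁.deriv_lin hy₂ A B hs₀
      rw [wron, d1, d2, sh₁ s₀ hs₀, hAB s₀ hs₀, wron]
      ring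
    rw [hy₁.wron_eq hS hc hy₂ (hSτ s₀ hs₀) hs₀] at e1
    exact mul_right_cancel₀ hw (by rw [← e1, one_mul])
  -- Comparison of the y₁ coefficients in T y = κ y gives bA = κa, hence b = κΛa. The coefficient B
  -- does not enter.
  have hcoef := hind (b * A - κ * a) (-Λ * a + b * B - κ * b) fun s hs => by
    have e1 := shy s hs
    rw [hab _ (hSτ s hs), hab s hs, sh₁ s hs, hAB s hs] at e1
    refine mul_left_cancel₀ (Complex.exp_ne_zero (-s / 2)) ?_
    simp only [y₁, y₂] at e1
    linear_combination e1
  have hb : b = κ * Λ * a := by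
    have h1 := hcoef.1
    linear_combination Λ * h1 - b * hA
  refine ⟨a, fun s hs => ?_⟩
  have e1 := hab s hs
  simp only [y, y₁, y₂] at e1
  refine mul_left_cancel₀ (Complex.exp_ne_zero (-s / 2)) ?_
  rw [e1, hb]
  ring

end Frobenius

/-! ### The connection formulas. -/

section Connection

variable {D : Set ℂ} {f g ζ : ℂ → ℂ} {u α : ℝ} {W W' W₁ W₂ : ℂ → ℂ} {σ c : ℂ}

theorem IsFrobenius.const_mul_congr (h : IsSetting D f g ζ α) (hα : 0 ≤ α)
    (hW : IsFrobenius D g ζ u α σ c W) (hW' : IsSolution D g ζ u α W') {k : ℂ}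
    (he : ∀ s ∈ logSurface D ζ, W' s = k * W s) : IsFrobenius D g ζ u α σ (k * c) W' := by
  obtain ⟨-, V, hV, hVc, hev⟩ := hW
  refine ⟨hW', fun x => k * V x, analyticAt_const.mul hV, by simp only [hVc], ?_⟩
  have hmem := eventually_punctured_iff.2 (h.exists_mem_logSurface hα)
  filter_upwards [hev, hmem] with x h1 h2 s hs
  rw [he s (h2 s hs), h1 s hs]
  ring

/-- A Frobenius solution with exponent `σ` also has exponent `σ - m`. -/
theorem IsFrobenius.sub_nat (hW : IsFrobenius D g ζ u α σ c W) (m : ℕ) :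
    ∃ c', IsFrobenius D g ζ u α (σ - m) c' W := by
  obtain ⟨hs, V, hV, -, hev⟩ := hW
  refine ⟨_, hs, fun x => x ^ m * V x, (analyticAt_id.pow m).mul hV, rfl, ?_⟩
  refine hev.mono fun x hx s hs => ?_
  rw [hx s hs, ← hs]
  simp only
  rw [← Complex.exp_nat_mul, ← mul_assoc, ← Complex.exp_add]
  congr 2
  ring

theorem IsFrobenius.not_eqOn_zero (h : IsSetting D f g ζ α) (hα : 0 ≤ α)
    (hW : IsFrobenius D g ζ u α σ c W) (hc : c ≠ 0) : ¬ ∀ s ∈ logSurface D ζ, W s = 0 := by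
  intro h0
  obtain ⟨-, V, hV, hVc, hev⟩ := hW
  have hmem := eventually_punctured_iff.2 (h.exists_mem_logSurface hα)
  have hne : ∀ᶠ x in 𝓝[≠] (0 : ℂ), V x ≠ 0 :=
    (hV.continuousAt.eventually_ne (by rwa [hVc])).filter_mono nhdsWithin_le_nhds
  obtain ⟨x, h1, h2, h3, h4⟩ :=
    (hev.and (hmem.and (hne.and (self_mem_nhdsWithin : ∀ᶠ x in 𝓝[≠] (0 : ℂ), x ≠ 0)))).exists
  have hx := Complex.exp_log h4
  have := h1 _ hx
  rw [h0 _ (h2 _ hx)] at this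
  exact mul_ne_zero (Complex.exp_ne_zero _) h3 this.symm

/-- The solutions with exponent `(μ + 1) / 2` are multiples of `W₁ + W₂`. -/
theorem IsFrobenius.eq_of_pos (h : IsSetting D f g ζ α) (hα : 0 ≤ α) (hu : 0 < u)
    (h₁ : IsLG1 D g ζ u α W₁) (h₂ : IsLG2 D g ζ u α W₂)
    (hind : LinIndepOn (logSurface D ζ) W₁ W₂)
    (hW : IsFrobenius D g ζ u α ((u * α + 1) / 2) c W) :
    ∃ a : ℂ, ∀ s ∈ logSurface D ζ, W s = a * (W₁ s + W₂ s) := by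
  obtain ⟨a, ha⟩ := exists_eq_of_monodromy h hα hu h₁ h₂ hind hW.1
    (κ := Complex.exp (u * α * Real.pi * Complex.I)) fun s hs => by
      rw [hW.monodromy h hα hs, show 2 * Real.pi * Complex.I * ((u * α + 1) / 2) =
        u * α * Real.pi * Complex.I + Real.pi * Complex.I by ring, Complex.exp_add,
        Complex.exp_pi_mul_I, mul_neg_one]
  refine ⟨a, fun s hs => ?_⟩
  rw [ha s hs, ← Complex.exp_add, add_neg_cancel, Complex.exp_zero, one_mul]

/-- The solutions with exponent `(-μ + 1) / 2` are multiples of `e^{μπi} W₁ + e^{-μπi} W₂`. -/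
theorem IsFrobenius.eq_of_neg (h : IsSetting D f g ζ α) (hα : 0 ≤ α) (hu : 0 < u)
    (h₁ : IsLG1 D g ζ u α W₁) (h₂ : IsLG2 D g ζ u α W₂)
    (hind : LinIndepOn (logSurface D ζ) W₁ W₂)
    (hW : IsFrobenius D g ζ u α ((-(u * α) + 1) / 2) c W) :
    ∃ a : ℂ, ∀ s ∈ logSurface D ζ, W s = a * (Complex.exp (u * α * Real.pi * Complex.I) * W₁ s +
      Complex.exp (-(u * α * Real.pi * Complex.I)) * W₂ s) := by
  obtain ⟨a, ha⟩ := exists_eq_of_monodromy h hα hu h₁ h₂ hind hW.1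
    (κ := Complex.exp (-(u * α * Real.pi * Complex.I))) fun s hs => by
      rw [hW.monodromy h hα hs, show 2 * Real.pi * Complex.I * ((-(u * α) + 1) / 2) =
        -(u * α * Real.pi * Complex.I) + Real.pi * Complex.I by ring, Complex.exp_add,
        Complex.exp_pi_mul_I, mul_neg_one]
  refine ⟨a * Complex.exp (-(u * α * Real.pi * Complex.I)), fun s hs => ?_⟩
  rw [ha s hs]
  have : Complex.exp (-(u * α * Real.pi * Complex.I)) *
      Complex.exp (u * α * Real.pi * Complex.I) = 1 := by
    rw [← Complex.exp_add, neg_add_cancel, Complex.exp_zero]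
  linear_combination (-a * W₁ s) * this

theorem exists_isFrobenius_of_eq_mul (h : IsSetting D f g ζ α) (hα : 0 ≤ α)
    (hW : IsFrobenius D g ζ u α σ 1 W) (hW' : IsSolution D g ζ u α W') {a : ℂ}
    (he : ∀ s ∈ logSurface D ζ, W s = a * W' s) : ∃ c ≠ 0, IsFrobenius D g ζ u α σ c W' := by
  have ha : a ≠ 0 := fun h0 => hW.not_eqOn_zero h hα one_ne_zero fun s hs => by
    rw [he s hs, h0, zero_mul]
  refine ⟨a⁻¹ * 1, by simpa using ha, hW.const_mul_congr h hα hW' fun s hs => ?_⟩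
  rw [he s hs, inv_mul_cancel_left₀ ha]

theorem exists_isFrobenius_pos (h : IsSetting D f g ζ α) (hα : 0 ≤ α) (hu : 0 < u)
    (h₁ : IsLG1 D g ζ u α W₁) (h₂ : IsLG2 D g ζ u α W₂)
    (hind : LinIndepOn (logSurface D ζ) W₁ W₂) :
    ∃ c ≠ 0, IsFrobenius D g ζ u α ((u * α + 1) / 2) c fun s => W₁ s + W₂ s := by
  obtain ⟨W, hW⟩ := exists_frobenius_solution (u := u) (ρ := u * α / 2) h hα rfl fun k hk => by
    have h1 : (0 : ℝ) < k + u * α := by positivity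
    rw [mul_div_cancel₀ _ two_ne_zero]
    exact_mod_cast h1.ne'
  rw [← add_div] at hW
  obtain ⟨a, ha⟩ := hW.eq_of_pos h hα hu h₁ h₂ hind
  refine exists_isFrobenius_of_eq_mul h hα hW ?_ ha
  simpa using h₁.1.lin (h.isOpen_logSurface hα) h₂.1 1 1

/-- Off resonance the series exists and is renormalized. If μ = m is a positive integer then e^{mπi}
= e^{-mπi}, so the combination is a multiple of W₁ + W₂. Its exponent (m + 1)/2 exceeds (1 - m)/2 by
m, so it has the required form with an extra factor ζ^m in V. -/
theorem exists_isFrobenius_neg (h : IsSetting D f g ζ α) (hα : 0 ≤ α) (hu : 0 < u)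
    (h₁ : IsLG1 D g ζ u α W₁) (h₂ : IsLG2 D g ζ u α W₂)
    (hind : LinIndepOn (logSurface D ζ) W₁ W₂) :
    ∃ c : ℂ, ((∀ m : ℕ, 1 ≤ m → u * α ≠ m) → c ≠ 0) ∧
      IsFrobenius D g ζ u α ((-(u * α) + 1) / 2) c fun s =>
        Complex.exp (u * α * Real.pi * Complex.I) * W₁ s +
          Complex.exp (-(u * α * Real.pi * Complex.I)) * W₂ s := by
  have hsol := h₁.1.lin (h.isOpen_logSurface hα) h₂.1 (Complex.exp (u * α * Real.pi * Complex.I))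
    (Complex.exp (-(u * α * Real.pi * Complex.I)))
  by_cases hm : ∀ m : ℕ, 1 ≤ m → u * α ≠ m
  · obtain ⟨W, hW⟩ := exists_frobenius_solution (u := u) (ρ := -(u * α) / 2) h hα (by ring)
      fun k hk => by
        rw [mul_div_cancel₀ _ two_ne_zero, ← sub_eq_add_neg, sub_ne_zero]
        exact_mod_cast (hm k hk).symm
    rw [← add_div] at hW
    obtain ⟨a, ha⟩ := hW.eq_of_neg h hα hu h₁ h₂ hind
    obtain ⟨c, hc, hf⟩ := exists_isFrobenius_of_eq_mul h hα hW hsol ha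
    exact ⟨c, fun _ => hc, hf⟩
  · push Not at hm
    obtain ⟨m, hm1, hm⟩ := hm
    obtain ⟨c, -, hf⟩ := exists_isFrobenius_pos h hα hu h₁ h₂ hind
    have hmc : (u * α : ℂ) = m := by exact_mod_cast hm
    have hper : Complex.exp (-(u * α * Real.pi * Complex.I)) =
        Complex.exp (u * α * Real.pi * Complex.I) := by
      rw [Complex.exp_eq_exp_iff_exists_int]
      refine ⟨-m, ?_⟩
      rw [hmc]
      push_cast
      ring
    obtain ⟨c', hf'⟩ := (hf.const_mul_congr h hα hsol
      (k := Complex.exp (u * α * Real.pi * Complex.I)) fun s _ => by rw [hper]; ring).sub_nat m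
    refine ⟨c', fun hne => absurd hm (hne m hm1), ?_⟩
    convert! hf' using 1
    rw [hmc]
    ring

end Connection

/-! ### The theorem, with connection constant one. -/

theorem mainTheorem2 (D : Set ℂ) (α₀ : ℝ) (hα₀ : 0 < α₀) (f ζ : ℝ → ℂ → ℂ) (g : ℂ → ℂ)
    (L : ℝ → ℝ → ℂ)
    (hset : ∀ α ∈ Icc 0 α₀, IsSetting D (f α) g (ζ α) α)
    (hpath : ∀ α ∈ Icc 0 α₀, IsLGPath D (ζ α) α (L α))
    (hint : ∀ α ∈ Icc 0 α₀, ∀ n : ℕ, 1 ≤ n →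
      MeasureTheory.Integrable (lgIntegrand D (f α) g (ζ α) α (L α) n)) :
    ∃ (W₁ W₂ W₀ Wneg : ℝ → ℝ → ℂ → ℂ) (γ : ℝ → ℝ → ℂ),
      -- the recessive Liouville-Green solutions exist and are unique
      (∀ u : ℝ, 0 < u → ∀ α ∈ Icc 0 α₀,
        (IsLG1 D g (ζ α) u α (W₁ u α) ∧
          ∀ W, IsLG1 D g (ζ α) u α W → EqOn W (W₁ u α) (logSurface D (ζ α))) ∧
        (IsLG2 D g (ζ α) u α (W₂ u α) ∧
          ∀ W, IsLG2 D g (ζ α) u α W → EqOn W (W₂ u α) (logSurface D (ζ α)))) ∧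
      -- the Frobenius solutions (unique up to a constant factor) and the connection formulas,
      -- with the same constant `γ`
      (∀ u : ℝ, 0 < u → ∀ α ∈ Icc 0 α₀,
        LinIndepOn (logSurface D (ζ α)) (W₁ u α) (W₂ u α) → ∀ μ : ℝ, μ = u * α →
        ((∃ c : ℂ, c ≠ 0 ∧ IsFrobenius D g (ζ α) u α ((μ + 1) / 2) c (W₀ u α)) ∧
          (∀ W c, IsFrobenius D g (ζ α) u α ((μ + 1) / 2) c W →
            ∃ k : ℂ, ∀ s ∈ logSurface D (ζ α), W s = k * W₀ u α s) ∧
          ∀ s ∈ logSurface D (ζ α), W₀ u α s = W₁ u α s + γ u α * W₂ u α s) ∧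
        ((∃ c : ℂ, ((∀ m : ℕ, 1 ≤ m → μ ≠ m) → c ≠ 0) ∧
            IsFrobenius D g (ζ α) u α ((-μ + 1) / 2) c (Wneg u α)) ∧
          (∀ W c, IsFrobenius D g (ζ α) u α ((-μ + 1) / 2) c W →
            ∃ k : ℂ, ∀ s ∈ logSurface D (ζ α), W s = k * Wneg u α s) ∧
          ∀ s ∈ logSurface D (ζ α), Wneg u α s =
            Complex.exp (μ * Real.pi * Complex.I) * W₁ u α s
              + γ u α * Complex.exp (-μ * Real.pi * Complex.I) * W₂ u α s)) ∧
      -- `W₁`, `W₂` are independent for large `u`, and `γ = 1 + O(u⁻ⁿ)` for every `n`, uniformly on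
      -- every set of `α` on which the integrals are uniformly bounded (e.g. a single `α`)
      (∀ A : Set ℝ, A ⊆ Icc 0 α₀ →
        (∀ n : ℕ, 1 ≤ n → ∃ K : ℝ, ∀ α ∈ A,
          (∫ t, lgIntegrand D (f α) g (ζ α) α (L α) n t) ≤ K) →
        ∀ n : ℕ, ∃ C U : ℝ, 0 < U ∧ ∀ α ∈ A, ∀ u : ℝ, U ≤ u →
          LinIndepOn (logSurface D (ζ α)) (W₁ u α) (W₂ u α) ∧
          ‖γ u α - 1‖ ≤ C / u ^ n) := by
  have hex : ∀ u α : ℝ, ∃ W₁ W₂ : ℂ → ℂ, 0 < u → α ∈ Icc 0 α₀ →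
      IsLG1 D g (ζ α) u α W₁ ∧ IsLG2 D g (ζ α) u α W₂ := by
    intro u α
    by_cases hc : 0 < u ∧ α ∈ Icc 0 α₀
    · obtain ⟨hu, hα⟩ := hc
      obtain ⟨W₂, h₂⟩ := exists_isLG2 (hset α hα) hα.1 (hpath α hα) (hint α hα 1 le_rfl) hu
      exact ⟨_, W₂, fun _ _ => ⟨h₂.shift ((hset α hα).isOpen_logSurface hα.1) hα.1, h₂⟩⟩
    · exact ⟨0, 0, fun hu hα => absurd ⟨hu, hα⟩ hc⟩
  choose W₁ W₂ hW using hex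
  -- The Wronskian is invariant under continuation around `ζ = 0`, which forces `γ = 1`.
  refine ⟨W₁, W₂, fun u α s => W₁ u α s + W₂ u α s, fun u α s =>
    Complex.exp (u * α * Real.pi * Complex.I) * W₁ u α s +
      Complex.exp (-(u * α * Real.pi * Complex.I)) * W₂ u α s, fun _ _ => 1, ?_, ?_, ?_⟩
  · intro u hu α hα
    obtain ⟨h₁, h₂⟩ := hW u α hu hα
    exact ⟨⟨h₁, fun W h => h₁.unique (hset α hα) hα.1 hu h⟩,
      ⟨h₂, fun W h => h₂.unique (hset α hα) hα.1 hu h⟩⟩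
  · rintro u hu α hα hind μ rfl
    obtain ⟨h₁, h₂⟩ := hW u α hu hα
    have h := hset α hα
    push_cast
    refine ⟨⟨exists_isFrobenius_pos h hα.1 hu h₁ h₂ hind, fun W c hF =>
      hF.eq_of_pos h hα.1 hu h₁ h₂ hind, fun s _ => by rw [one_mul]⟩,
      exists_isFrobenius_neg h hα.1 hu h₁ h₂ hind, fun W c hF =>
      hF.eq_of_neg h hα.1 hu h₁ h₂ hind, fun s _ => ?_⟩
    rw [one_mul]
    simp only [neg_mul]
  · intro A hA hK n
    obtain ⟨K, hK⟩ := hK 1 le_rfl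
    -- The error is zero. The threshold 8K makes the integral of |F₁ dξ| at most u/8, as
    -- independence requires.
    refine ⟨0, max 1 (8 * K), by positivity, fun α hα u hu => ⟨?_, by simp⟩⟩
    have hu0 : 0 < u := one_pos.trans_le ((le_max_left _ _).trans hu)
    have hu1 : 8 * K ≤ u := (le_max_right _ _).trans hu
    obtain ⟨h₁, h₂⟩ := hW u α hu0 (hA hα)
    exact linIndepOn_of_small (hset α (hA hα)) (hA hα).1 (hpath α (hA hα))
      (hint α (hA hα) 1 le_rfl) hu0 (by linarith [hK α hα]) h₁ h₂
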